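/- Let $\mathcal V$ be a complete and cocomplete closed symmetric monoidal category. Write $[\mathsf A,\mathcal B]$ for the $\mathcal V$-category of $\mathcal V$-functors from a small $\mathcal V$-category $\mathsf A$ to a $\mathcal V$-category $\mathcal B$. For a small symmetric monoidal $\mathcal V$-category $\mathsf A$, equip the presheaf category $\hat{\mathsf A}=[\mathsf A^{\mathrm{op}},\mathcal V]$ with the convolution product $(P*Q)(c)=\int^{a,b\in\mathsf A}\mathsf A(c,a\otimes b)\otimes P(a)\otimes Q(b)$, whose unit is $\mathsf A(-,\mathbf 1)$. Symmetric monoidal $\mathcal V$-functors are strong: $F(a)\otimes F(b)\to F(a\otimes b)$ and $\mathbf 1\to F(\mathbf 1)$ are isomorphisms. A $\mathcal V$-pattern is a symmetric monoidal $\mathcal V$-functor $\tau:\mathsf S\to\mathsf T$ between small symmetric monoidal $\mathcal V$-categories such that restriction of presheaves $\hat\tau:\hat{\mathsf T}\to\hat{\mathsf S}$, with its canonical lax symmetric monoidal structure, is symmetric monoidal; that is, for all presheaves $P,Q$ on $\mathsf T$ the canonical maps $\hat\tau P*\hat\tau Q\to\hat\tau(P*Q)$ and $\mathsf S(-,\mathbf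 1)\to\mathsf T(\tau-,\mathbf 1)$, induced by $\mathsf S(c,a\otimes b)\to\mathsf T(\tau c,\tau(a\otimes b))\cong\mathsf T(\tau c,\tau a\otimes\tau b)$ and by $\mathsf S(c,\mathbf 1)\to\mathsf T(\tau c,\tau\mathbf 1)\cong\mathsf T(\tau c,\mathbf 1)$, are isomorphisms. Let $\tau:\mathsf S\to\mathsf T$ be a $\mathcal V$-pattern, and let $\mathcal C$ be a symmetric monoidal $\mathcal V$-category that has all small weighted colimits and whose tensor product preserves them in each variable. Let $\mathrm{PreOp}_\tau(\mathcal C)$ and $\mathrm{Op}_\tau(\mathcal C)$ be the categories of symmetric monoidal $\mathcal V$-functors from $\mathsf S$, respectively $\mathsf T$, to $\mathcal C$, and monoidal $\mathcal V$-natural transformations; when $\mathcal V$ is cartesian, regard them as $\mathcal V$-categories, whose hom-objects are the subobjects of monoidal transformations in the hom-objects of $[\mathsf S,\mathcal C]$ and $[\mathsf T,\mathcal C]$. Then: 1. Restriction $\tau^*:[\mathsf T,\mathcal C]\to[\mathsf S,\mathcal C]$ has a left $\mathcal V$-adjoint $\tau_*$, given by the left Kan extension $\tau_*G(B)=\int^{A\in\mathsf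 S}\mathsf T(\tau A,B)\otimes G(A)$, where the coend is exhibited by the maps induced by the unit $\eta_G:G\to\tau^*\tau_*G$ of the adjunction. 2. If $G:\mathsf S\to\mathcal C$ is a symmetric monoidal $\mathcal V$-functor, there is exactly one structure of symmetric monoidal $\mathcal V$-functor on $\tau_*G$ for which $\eta_G:G\to\tau^*\tau_*G$ is monoidal. 3. The adjunction of 1 induces an adjunction $$\tau_*:\mathrm{PreOp}_\tau(\mathcal C)\rightleftarrows\mathrm{Op}_\tau(\mathcal C):\tau^*$$ whose left adjoint is, up to natural isomorphism, the left adjoint of 1 on the underlying $\mathcal V$-functors, and whose unit and counit are, through this isomorphism, those of the adjunction of 1. When $\mathcal V$ is cartesian, the same holds with a $\mathcal V$-adjunction between the $\mathcal V$-categories $\mathrm{PreOp}_\tau(\mathcal C)$ and $\mathrm{Op}_\tau(\mathcal C)$ and a $\mathcal V$-natural isomorphism. -/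

import Mathlib

open CategoryTheory MonoidalCategory Limits Opposite

universe w v u u₁ u₂ u₃ v₁ v₂ v₃

set_option linter.unusedSectionVars false

noncomputable section

namespace EnrichedPattern

/-! ### The `V`-category of `V`-functors -/

section FunctorCategory

variable (V : Type v) [Category.{w} V] [MonoidalCategory V]

/-- `V`-naturality of a family of elements `𝟙_ V ⟶ (F X ⟶[V] G X)`. -/
def IsVNatural {A : Type u₁} [EnrichedCategory V A] {B : Type u₂} [EnrichedCategory V B]
    (F G : EnrichedFunctor V A B) (α : ∀ X : A, 𝟙_ V ⟶ (F.obj X ⟶[V] G.obj X)) : Prop :=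
  ∀ X Y : A, (ρ_ (X ⟶[V] Y)).inv ≫ (F.map X Y ⊗ₘ α Y) ≫ eComp V _ _ _ =
    (λ_ (X ⟶[V] Y)).inv ≫ (α X ⊗ₘ G.map X Y) ≫ eComp V _ _ _

variable [SymmetricCategory V]

/-- `V`-naturality of a family of maps `X ⟶ (F a ⟶[V] G a)` in `V`, for an object `X` of `V`. -/
def IsGradedVNatural {A : Type u₁} [EnrichedCategory V A] {B : Type u₂} [EnrichedCategory V B]
    (F G : EnrichedFunctor V A B) {X : V} (α : ∀ a : A, X ⟶ (F.obj a ⟶[V] G.obj a)) : Prop :=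
  ∀ a a' : A, (F.map a a' ⊗ₘ α a') ≫ eComp V _ _ _ =
    (β_ (a ⟶[V] a') X).hom ≫ (α a ⊗ₘ G.map a a') ≫ eComp V _ _ _

variable {V}
variable {A : Type w} [EnrichedCategory V A] {B : Type u} [EnrichedCategory V B]

lemma tensor_eComp_assoc {B : Type u₂} [EnrichedCategory V B] {P Q R : V} {b₁ b₂ b₃ b₄ : B}
    (f : P ⟶ (b₁ ⟶[V] b₂)) (g : Q ⟶ (b₂ ⟶[V] b₃)) (h : R ⟶ (b₃ ⟶[V] b₄)) :
    (((f ⊗ₘ g) ≫ eComp V _ _ _) ⊗ₘ h) ≫ eComp V _ _ _ =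
      (α_ P Q R).hom ≫ (f ⊗ₘ ((g ⊗ₘ h) ≫ eComp V _ _ _)) ≫ eComp V _ _ _ := by
  rw [← MonoidalCategory.tensorHom_comp_whiskerLeft, ← MonoidalCategory.tensorHom_comp_whiskerRight,
    Category.assoc, Category.assoc, ← e_assoc, associator_inv_naturality_assoc,
    Iso.hom_inv_id_assoc]

lemma eId_tensor_eComp {B : Type u₂} [EnrichedCategory V B] {P : V} {b b' : B}
    (f : P ⟶ (b ⟶[V] b')) : (eId V b ⊗ₘ f) ≫ eComp V _ _ _ = (λ_ P).hom ≫ f := by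
  have e := e_id_comp V b b'
  rw [Iso.inv_comp_eq, Category.comp_id] at e
  rw [MonoidalCategory.tensorHom_def', Category.assoc, e, MonoidalCategory.id_whiskerLeft]
  simp

lemma tensor_eId_eComp {B : Type u₂} [EnrichedCategory V B] {P : V} {b b' : B}
    (f : P ⟶ (b ⟶[V] b')) : (f ⊗ₘ eId V b') ≫ eComp V _ _ _ = (ρ_ P).hom ≫ f := by
  have e := e_comp_id V b b'
  rw [Iso.inv_comp_eq, Category.comp_id] at e
  rw [MonoidalCategory.tensorHom_def, Category.assoc, e, MonoidalCategory.whiskerRight_id]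
  simp

lemma IsGradedVNatural.precomp {F G : EnrichedFunctor V A B} {X Y : V}
    {α : ∀ a : A, X ⟶ (F.obj a ⟶[V] G.obj a)} (h : IsGradedVNatural V F G α) (f : Y ⟶ X) :
    IsGradedVNatural V F G (fun a => f ≫ α a) := by
  intro a a'
  have h1 : (F.map a a' ⊗ₘ (f ≫ α a')) = (_ ◁ f) ≫ (F.map a a' ⊗ₘ α a') := by
    rw [MonoidalCategory.whiskerLeft_comp_tensorHom]
  have h2 : ((f ≫ α a) ⊗ₘ G.map a a') = (f ▷ _) ≫ (α a ⊗ₘ G.map a a') := by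
    rw [MonoidalCategory.whiskerRight_comp_tensorHom]
  rw [h1, h2, Category.assoc, h a a', Category.assoc,
    BraidedCategory.braiding_naturality_right_assoc]

lemma IsGradedVNatural.id (F : EnrichedFunctor V A B) :
    IsGradedVNatural V F F (fun a => eId V (F.obj a)) := by
  intro a a'
  dsimp only
  rw [eId_tensor_eComp, tensor_eId_eComp]
  simp

lemma IsGradedVNatural.comp {F G H : EnrichedFunctor V A B} {X Y : V}
    {α : ∀ a : A, X ⟶ (F.obj a ⟶[V] G.obj a)} (hα : IsGradedVNatural V F G α)
    {γ : ∀ a : A, Y ⟶ (G.obj a ⟶[V] H.obj a)} (hγ : IsGradedVNatural V G H γ) :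
    IsGradedVNatural V F H (fun a => (α a ⊗ₘ γ a) ≫ eComp V _ _ _) := by
  intro a a'
  dsimp only
  have l1 := tensor_eComp_assoc (F.map a a') (α a') (γ a')
  rw [← Iso.inv_comp_eq] at l1
  rw [← l1, hα a a',
    ← MonoidalCategory.whiskerRight_comp_tensorHom, Category.assoc, tensor_eComp_assoc, hγ a a',
    ← MonoidalCategory.whiskerLeft_comp_tensorHom, Category.assoc]
  have l2 := tensor_eComp_assoc (α a) (γ a) (H.map a a')
  rw [← Iso.inv_comp_eq] at l2
  rw [← l2]
  simp

lemma IsGradedVNatural.whisker {A' : Type u₁} [EnrichedCategory V A'] (K : EnrichedFunctor V A' A)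
    {F G : EnrichedFunctor V A B} {X : V}
    {α : ∀ a : A, X ⟶ (F.obj a ⟶[V] G.obj a)} (h : IsGradedVNatural V F G α) :
    IsGradedVNatural V (K.comp V F) (K.comp V G) (fun a => α (K.obj a)) := by
  intro a a'
  have := h (K.obj a) (K.obj a')
  dsimp only [EnrichedFunctor.comp]
  rw [← MonoidalCategory.whiskerRight_comp_tensorHom, Category.assoc, this,
    BraidedCategory.braiding_naturality_left_assoc,
    ← MonoidalCategory.whiskerLeft_comp_tensorHom, Category.assoc]

variable [MonoidalClosed V]

/-- The two families of maps `(F a ⟶[V] G a) ⟶ [A(a, a'), B(F a, G a')]` and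
`(F a' ⟶[V] G a') ⟶ [A(a, a'), B(F a, G a')]` whose joint equalizer is the end
`∫ a, B(F a, G a)`. -/
def endIndex (F G : EnrichedFunctor V A B) :
    MulticospanIndex
      ({ L := A, R := A × A, fst := Prod.fst, snd := Prod.snd } : MulticospanShape.{w, w}) V where
  left a := F.obj a ⟶[V] G.obj a
  right p := (ihom (p.1 ⟶[V] p.2)).obj (F.obj p.1 ⟶[V] G.obj p.2)
  fst p := MonoidalClosed.curry
    ((β_ _ _).hom ≫ (_ ◁ G.map p.1 p.2) ≫ eComp V _ _ _)
  snd p := MonoidalClosed.curry ((F.map p.1 p.2 ▷ _) ≫ eComp V _ _ _)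

lemma isGradedVNatural_iff (F G : EnrichedFunctor V A B) {X : V}
    (α : ∀ a : A, X ⟶ (F.obj a ⟶[V] G.obj a)) :
    IsGradedVNatural V F G α ↔
      ∀ p : A × A, α p.1 ≫ (endIndex F G).fst p = α p.2 ≫ (endIndex F G).snd p := by
  have key : ∀ a a' : A, (α a ≫ (endIndex F G).fst (a, a') = α a' ≫ (endIndex F G).snd (a, a')) ↔
      (F.map a a' ⊗ₘ α a') ≫ eComp V _ _ _ =
        (β_ (a ⟶[V] a') X).hom ≫ (α a ⊗ₘ G.map a a') ≫ eComp V _ _ _ := by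
    intro a a'
    dsimp only [endIndex]
    rw [← MonoidalClosed.curry_natural_left, ← MonoidalClosed.curry_natural_left,
      MonoidalClosed.curry_injective.eq_iff, eq_comm,
      BraidedCategory.braiding_naturality_right_assoc, whisker_exchange_assoc]
    simp only [MonoidalCategory.tensorHom_def, Category.assoc]
  exact ⟨fun h p => (key p.1 p.2).2 (h p.1 p.2), fun h a a' => (key a a').1 (h (a, a'))⟩

variable [HasLimits V]

/-- The object `∫ a, B(F a, G a)` of `V`-natural transformations from `F` to `G`. -/
def homObj (F G : EnrichedFunctor V A B) : V := multiequalizer (endIndex F G)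

/-- The projection of the end to its component at `a`. -/
def homProj (F G : EnrichedFunctor V A B) (a : A) : homObj F G ⟶ (F.obj a ⟶[V] G.obj a) :=
  Multiequalizer.ι (endIndex F G) a

lemma homProj_natural (F G : EnrichedFunctor V A B) :
    IsGradedVNatural V F G (homProj F G) :=
  (isGradedVNatural_iff F G _).2 fun p => Multiequalizer.condition (endIndex F G) p

/-- The universal property of the object of `V`-natural transformations. -/
def homLift (F G : EnrichedFunctor V A B) {X : V} (α : ∀ a : A, X ⟶ (F.obj a ⟶[V] G.obj a))
    (h : IsGradedVNatural V F G α) : X ⟶ homObj F G :=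
  Multiequalizer.lift (endIndex F G) X α ((isGradedVNatural_iff F G α).1 h)

@[simp]
lemma homLift_proj (F G : EnrichedFunctor V A B) {X : V}
    (α : ∀ a : A, X ⟶ (F.obj a ⟶[V] G.obj a)) (h : IsGradedVNatural V F G α) (a : A) :
    homLift F G α h ≫ homProj F G a = α a :=
  Multiequalizer.lift_ι (endIndex F G) X α _ a

@[simp]
lemma homLift_proj_assoc (F G : EnrichedFunctor V A B) {X Z : V}
    (α : ∀ a : A, X ⟶ (F.obj a ⟶[V] G.obj a)) (h : IsGradedVNatural V F G α) (a : A)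
    (k : (F.obj a ⟶[V] G.obj a) ⟶ Z) :
    homLift F G α h ≫ homProj F G a ≫ k = α a ≫ k := by
  rw [← Category.assoc, homLift_proj]

lemma homObj_ext {F G : EnrichedFunctor V A B} {X : V} {f g : X ⟶ homObj F G}
    (h : ∀ a, f ≫ homProj F G a = g ≫ homProj F G a) : f = g :=
  Multiequalizer.hom_ext (endIndex F G) f g h

/-- The `V`-category `[A, B]` of `V`-functors from a small `V`-category `A` to `B`. -/
instance functorCategory : EnrichedCategory V (EnrichedFunctor V A B) where
  Hom F G := homObj F G
  id F := homLift F F (fun a => eId V (F.obj a)) (IsGradedVNatural.id F)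
  comp F G H := homLift F H (fun a => (homProj F G a ⊗ₘ homProj G H a) ≫ eComp V _ _ _)
    ((homProj_natural F G).comp (homProj_natural G H))
  id_comp F G := homObj_ext fun a => by
    rw [Category.assoc, Category.assoc, homLift_proj, Category.id_comp]
    rw [MonoidalCategory.whiskerRight_comp_tensorHom_assoc, homLift_proj, eId_tensor_eComp]
    simp
  comp_id F G := homObj_ext fun a => by
    rw [Category.assoc, Category.assoc, homLift_proj, Category.id_comp]
    rw [MonoidalCategory.whiskerLeft_comp_tensorHom_assoc, homLift_proj, tensor_eId_eComp]
    simp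
  assoc F G H K := homObj_ext fun a => by
    rw [Category.assoc, Category.assoc, Category.assoc, homLift_proj, homLift_proj,
      MonoidalCategory.whiskerRight_comp_tensorHom_assoc,
      MonoidalCategory.whiskerLeft_comp_tensorHom_assoc, homLift_proj, homLift_proj,
      tensor_eComp_assoc]
    simp

/-- The component at `a` of the `V`-object of `V`-natural transformations. -/
def natProj (F G : EnrichedFunctor V A B) (a : A) : (F ⟶[V] G) ⟶ (F.obj a ⟶[V] G.obj a) :=
  homProj F G a

/-- A `V`-natural family of maps `X ⟶ (F a ⟶[V] G a)` determines a map `X ⟶ (F ⟶[V] G)`. -/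
def natLift (F G : EnrichedFunctor V A B) {X : V} (α : ∀ a : A, X ⟶ (F.obj a ⟶[V] G.obj a))
    (h : IsGradedVNatural V F G α) : X ⟶ (F ⟶[V] G) :=
  homLift F G α h

lemma natProj_natural (F G : EnrichedFunctor V A B) : IsGradedVNatural V F G (natProj F G) :=
  homProj_natural F G

@[simp]
lemma natLift_proj (F G : EnrichedFunctor V A B) {X : V}
    (α : ∀ a : A, X ⟶ (F.obj a ⟶[V] G.obj a)) (h : IsGradedVNatural V F G α) (a : A) :
    natLift F G α h ≫ natProj F G a = α a :=
  homLift_proj F G α h a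

lemma nat_ext {F G : EnrichedFunctor V A B} {X : V} {f g : X ⟶ (F ⟶[V] G)}
    (h : ∀ a, f ≫ natProj F G a = g ≫ natProj F G a) : f = g :=
  homObj_ext h

lemma eId_natProj (F : EnrichedFunctor V A B) (a : A) :
    eId V F ≫ natProj F F a = eId V (F.obj a) :=
  homLift_proj F F _ (IsGradedVNatural.id F) a

lemma eComp_natProj (F G H : EnrichedFunctor V A B) (a : A) :
    eComp V F G H ≫ natProj F H a = (natProj F G a ⊗ₘ natProj G H a) ≫ eComp V _ _ _ :=
  homLift_proj F H _ ((homProj_natural F G).comp (homProj_natural G H)) a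

/-- The map `(F ⟶[V] G) ⟶ (F ∘ K ⟶[V] G ∘ K)` given by restriction along `K`. -/
def restrictionMap {A' : Type w} [EnrichedCategory V A'] (K : EnrichedFunctor V A A')
    (F G : EnrichedFunctor V A' B) : (F ⟶[V] G) ⟶ (K.comp V F ⟶[V] K.comp V G) :=
  natLift (K.comp V F) (K.comp V G) (fun a => natProj F G (K.obj a))
    ((natProj_natural F G).whisker K)

lemma restrictionMap_natProj {A' : Type w} [EnrichedCategory V A'] (K : EnrichedFunctor V A A')
    (F G : EnrichedFunctor V A' B) (a : A) :
    restrictionMap K F G ≫ natProj (K.comp V F) (K.comp V G) a = natProj F G (K.obj a) :=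
  natLift_proj (K.comp V F) (K.comp V G) (fun a => natProj F G (K.obj a)) _ a

/-- Restriction along a `V`-functor `K`, as a `V`-functor `[A', B] ⟶ [A, B]`. -/
def restriction {A' : Type w} [EnrichedCategory V A'] (K : EnrichedFunctor V A A')
    (B : Type u) [EnrichedCategory V B] :
    EnrichedFunctor V (EnrichedFunctor V A' B) (EnrichedFunctor V A B) where
  obj F := K.comp V F
  map F G := restrictionMap K F G
  map_id F := nat_ext fun a => by
    rw [Category.assoc, restrictionMap_natProj, eId_natProj]
    exact eId_natProj F (K.obj a)
  map_comp F G H := nat_ext fun a => by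
    rw [Category.assoc, restrictionMap_natProj, Category.assoc, eComp_natProj,
      MonoidalCategory.tensorHom_comp_tensorHom_assoc, restrictionMap_natProj,
      restrictionMap_natProj]
    exact eComp_natProj F G H (K.obj a)

end FunctorCategory

/-! ### Symmetric monoidal `V`-categories and `V`-functors -/

section SymmetricMonoidal

variable (V : Type v) [Category.{w} V] [MonoidalCategory V]

/-- The functor between underlying categories induced by a `V`-functor. -/
abbrev ordinary {V : Type v} [Category.{w} V] [MonoidalCategory V]
    {C : Type u₁} [Category.{v₁} C] [EnrichedOrdinaryCategory V C]
    {D : Type u₂} [Category.{v₂} D] [EnrichedOrdinaryCategory V D]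
    (F : EnrichedFunctor V C D) : C ⥤ D where
  obj := F.obj
  map {X Y} f := (eHomEquiv V).symm (eHomEquiv V f ≫ F.map X Y)
  map_id X := by
    rw [eHomEquiv_id, F.map_id, ← eHomEquiv_id, Equiv.symm_apply_apply]
  map_comp {X Y Z} f g := by
    apply (eHomEquiv V).injective
    rw [Equiv.apply_symm_apply, eHomEquiv_comp, eHomEquiv_comp, Equiv.apply_symm_apply,
      Equiv.apply_symm_apply, Category.assoc, Category.assoc, F.map_comp,
      MonoidalCategory.tensorHom_comp_tensorHom_assoc]

lemma eHomEquiv_ordinary_map {V : Type v} [Category.{w} V] [MonoidalCategory V]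
    {C : Type u₁} [Category.{v₁} C] [EnrichedOrdinaryCategory V C]
    {D : Type u₂} [Category.{v₂} D] [EnrichedOrdinaryCategory V D]
    (F : EnrichedFunctor V C D) {X Y : C} (f : X ⟶ Y) :
    eHomEquiv V ((ordinary F).map f) = eHomEquiv V f ≫ F.map X Y :=
  Equiv.apply_symm_apply _ _

lemma eHomEquiv_comp_left {V : Type v} [Category.{w} V] [MonoidalCategory V]
    {C : Type u₁} [Category.{v₁} C] [EnrichedOrdinaryCategory V C]
    {X Y Z : C} (f : X ⟶ Y) (g : Y ⟶ Z) :
    eHomEquiv V (f ≫ g) = eHomEquiv V f ≫ eHomWhiskerLeft V X g := by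
  rw [eHomWhiskerLeft, eHomEquiv_comp, MonoidalCategory.tensorHom_def,
    MonoidalCategory.rightUnitor_inv_naturality_assoc, unitors_inv_equal, Category.assoc]

lemma eHomEquiv_comp_right {V : Type v} [Category.{w} V] [MonoidalCategory V]
    {C : Type u₁} [Category.{v₁} C] [EnrichedOrdinaryCategory V C]
    {X Y Z : C} (f : X ⟶ Y) (g : Y ⟶ Z) :
    eHomEquiv V (f ≫ g) = eHomEquiv V g ≫ eHomWhiskerRight V f Z := by
  rw [eHomWhiskerRight, eHomEquiv_comp, MonoidalCategory.tensorHom_def',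
    MonoidalCategory.leftUnitor_inv_naturality_assoc, Category.assoc]

lemma eHomWhiskerLeft_map {V : Type v} [Category.{w} V] [MonoidalCategory V]
    {C : Type u₁} [Category.{v₁} C] [EnrichedOrdinaryCategory V C]
    {D : Type u₂} [Category.{v₂} D] [EnrichedOrdinaryCategory V D]
    (F : EnrichedFunctor V C D) (X : C) {Y Y' : C} (f : Y ⟶ Y') :
    eHomWhiskerLeft V X f ≫ F.map X Y' =
      F.map X Y ≫ eHomWhiskerLeft V (F.obj X) ((ordinary F).map f) := by
  rw [eHomWhiskerLeft, eHomWhiskerLeft, eHomEquiv_ordinary_map, Category.assoc, Category.assoc,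
    F.map_comp, MonoidalCategory.tensorHom_def', MonoidalCategory.whiskerLeft_comp]
  simp only [Category.assoc]
  rw [MonoidalCategory.rightUnitor_inv_naturality_assoc]
  simp only [MonoidalCategory.whisker_exchange_assoc]

lemma eHomWhiskerRight_map {V : Type v} [Category.{w} V] [MonoidalCategory V]
    {C : Type u₁} [Category.{v₁} C] [EnrichedOrdinaryCategory V C]
    {D : Type u₂} [Category.{v₂} D] [EnrichedOrdinaryCategory V D]
    (F : EnrichedFunctor V C D) {X X' : C} (f : X ⟶ X') (Y : C) :
    eHomWhiskerRight V f Y ≫ F.map X Y =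
      F.map X' Y ≫ eHomWhiskerRight V ((ordinary F).map f) (F.obj Y) := by
  rw [eHomWhiskerRight, eHomWhiskerRight, eHomEquiv_ordinary_map, Category.assoc, Category.assoc,
    F.map_comp, MonoidalCategory.tensorHom_def, MonoidalCategory.comp_whiskerRight]
  simp only [Category.assoc]
  rw [MonoidalCategory.leftUnitor_inv_naturality_assoc]
  simp only [MonoidalCategory.whisker_exchange_assoc]

variable [SymmetricCategory V]

/-- A symmetric monoidal `V`-category: a symmetric monoidal structure on the underlying category
of the `V`-category `C`, whose tensor product is equipped with an extension to a `V`-functor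
`C ⊗ C ⟶ C`, and whose structure isomorphisms are `V`-natural. -/
class SymmetricMonoidalEnriched (C : Type u₁) [Category.{v₁} C] [EnrichedOrdinaryCategory V C]
    [MonoidalCategory C] [SymmetricCategory C] where
  /-- The action of the tensor product on `V`-objects of morphisms. -/
  tensorMap (X X' Y Y' : C) : (X ⟶[V] X') ⊗ (Y ⟶[V] Y') ⟶ ((X ⊗ Y : C) ⟶[V] (X' ⊗ Y' : C))
  tensorMap_homEquiv {X X' Y Y' : C} (f : X ⟶ X') (g : Y ⟶ Y') :
    (λ_ (𝟙_ V)).inv ≫ (eHomEquiv V f ⊗ₘ eHomEquiv V g) ≫ tensorMap X X' Y Y' =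
      eHomEquiv V (f ⊗ₘ g)
  tensorMap_comp (X X' X'' Y Y' Y'' : C) :
    (tensorMap X X' Y Y' ⊗ₘ tensorMap X' X'' Y' Y'') ≫ eComp V _ _ _ =
      tensorμ (X ⟶[V] X') (Y ⟶[V] Y') (X' ⟶[V] X'') (Y' ⟶[V] Y'') ≫
        (eComp V _ _ _ ⊗ₘ eComp V _ _ _) ≫ tensorMap X X'' Y Y''
  associator_natural (X X' Y Y' Z Z' : C) :
    (tensorMap X X' Y Y' ▷ (Z ⟶[V] Z')) ≫ tensorMap (X ⊗ Y) (X' ⊗ Y') Z Z' ≫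
        eHomWhiskerLeft V _ (α_ X' Y' Z').hom =
      (α_ (X ⟶[V] X') (Y ⟶[V] Y') (Z ⟶[V] Z')).hom ≫ ((X ⟶[V] X') ◁ tensorMap Y Y' Z Z') ≫
        tensorMap X X' (Y ⊗ Z) (Y' ⊗ Z') ≫ eHomWhiskerRight V (α_ X Y Z).hom _
  leftUnitor_natural (X X' : C) :
    (λ_ (X ⟶[V] X')).inv ≫ (eId V (𝟙_ C) ▷ (X ⟶[V] X')) ≫ tensorMap (𝟙_ C) (𝟙_ C) X X' ≫
        eHomWhiskerLeft V _ (λ_ X').hom =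
      eHomWhiskerRight V (λ_ X).hom X'
  rightUnitor_natural (X X' : C) :
    (ρ_ (X ⟶[V] X')).inv ≫ ((X ⟶[V] X') ◁ eId V (𝟙_ C)) ≫ tensorMap X X' (𝟙_ C) (𝟙_ C) ≫
        eHomWhiskerLeft V _ (ρ_ X').hom =
      eHomWhiskerRight V (ρ_ X).hom X'
  braiding_natural (X X' Y Y' : C) :
    tensorMap X X' Y Y' ≫ eHomWhiskerLeft V _ (β_ X' Y').hom =
      (β_ (X ⟶[V] X') (Y ⟶[V] Y')).hom ≫ tensorMap Y Y' X X' ≫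
        eHomWhiskerRight V (β_ X Y).hom _

open SymmetricMonoidalEnriched Functor.LaxMonoidal Functor.OplaxMonoidal

section

variable {V}
variable {C : Type u₁} [Category.{v₁} C] [EnrichedOrdinaryCategory V C]
    [MonoidalCategory C] [SymmetricCategory C] [SymmetricMonoidalEnriched V C]
  {D : Type u₂} [Category.{v₂} D] [EnrichedOrdinaryCategory V D]
    [MonoidalCategory D] [SymmetricCategory D] [SymmetricMonoidalEnriched V D]
  {E : Type u₃} [Category.{v₃} E] [EnrichedOrdinaryCategory V E]
    [MonoidalCategory E] [SymmetricCategory E] [SymmetricMonoidalEnriched V E]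

/-- A (strong) symmetric monoidal structure on a `V`-functor `F`: a strong symmetric monoidal
structure on the underlying functor, with `V`-natural `F X ⊗ F Y ≅ F (X ⊗ Y)`. -/
structure SymmetricMonoidalStructure (F : EnrichedFunctor V C D) where
  /-- The strong symmetric monoidal structure on the underlying functor. -/
  [braided : (ordinary F).Braided]
  μ_natural (X X' Y Y' : C) :
    (F.map X X' ⊗ₘ F.map Y Y') ≫ tensorMap (F.obj X) (F.obj X') (F.obj Y) (F.obj Y') ≫
        eHomWhiskerLeft V _ (μ (ordinary F) X' Y') =
      tensorMap X X' Y Y' ≫ F.map (X ⊗ Y) (X' ⊗ Y') ≫ eHomWhiskerRight V (μ (ordinary F) X Y) _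

variable (V C D) in
/-- A (strong) symmetric monoidal `V`-functor from `C` to `D`. -/
structure SymmetricMonoidalVFunctor where
  /-- The underlying `V`-functor. -/
  functor : EnrichedFunctor V C D
  /-- The symmetric monoidal structure. -/
  str : SymmetricMonoidalStructure functor

instance (F : SymmetricMonoidalVFunctor V C D) : (ordinary F.functor).Braided := F.str.braided

/-- The underlying functor of a composite of `V`-functors. -/
def ordinaryComp (F : EnrichedFunctor V C D) (G : EnrichedFunctor V D E) :
    ordinary F ⋙ ordinary G ≅ ordinary (F.comp V G) :=
  NatIso.ofComponents (fun X => Iso.refl (G.obj (F.obj X))) (fun {X Y} f => by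
    refine (Category.comp_id _).trans (Eq.trans ?_ (Category.id_comp _).symm)
    simp [ordinary]
    rfl)

/-- Transport of a strong symmetric monoidal structure along a natural isomorphism. -/
@[reducible]
def braidedTransport {F G : C ⥤ D} [F.Braided] (i : F ≅ G) : G.Braided :=
  { Functor.Monoidal.transport i with
    braided X Y := by
      change ((i.inv.app X ⊗ₘ i.inv.app Y) ≫ μ F X Y ≫ i.hom.app (X ⊗ Y)) ≫ G.map (β_ X Y).hom =
        (β_ (G.obj X) (G.obj Y)).hom ≫ (i.inv.app Y ⊗ₘ i.inv.app X) ≫ μ F Y X ≫ i.hom.app (Y ⊗ X)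
      rw [Category.assoc, Category.assoc, ← i.hom.naturality, Functor.LaxBraided.braided_assoc,
        BraidedCategory.braiding_naturality_assoc] }

/-- The composite of symmetric monoidal structures. -/
@[reducible]
def braidedComp (F : EnrichedFunctor V C D) (G : EnrichedFunctor V D E)
    [(ordinary F).Braided] [(ordinary G).Braided] : (ordinary (F.comp V G)).Braided :=
  braidedTransport (ordinaryComp F G)

lemma braidedComp_μ (F : EnrichedFunctor V C D) (G : EnrichedFunctor V D E)
    [(ordinary F).Braided] [(ordinary G).Braided] (X Y : C) :
    letI := braidedComp F G
    μ (ordinary (F.comp V G)) X Y =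
      μ (ordinary G) (F.obj X) (F.obj Y) ≫ (ordinary G).map (μ (ordinary F) X Y) := by
  change (𝟙 (G.obj (F.obj X)) ⊗ₘ 𝟙 (G.obj (F.obj Y))) ≫
    (μ (ordinary G) (F.obj X) (F.obj Y) ≫ (ordinary G).map (μ (ordinary F) X Y)) ≫ 𝟙 _ = _
  rw [Category.comp_id, MonoidalCategory.id_tensorHom_id]
  exact Category.id_comp _

lemma braidedComp_ε (F : EnrichedFunctor V C D) (G : EnrichedFunctor V D E)
    [(ordinary F).Braided] [(ordinary G).Braided] :
    letI := braidedComp F G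
    ε (ordinary (F.comp V G)) = ε (ordinary G) ≫ (ordinary G).map (ε (ordinary F)) := by
  change (ε (ordinary G) ≫ (ordinary G).map (ε (ordinary F))) ≫ 𝟙 _ = _
  rw [Category.comp_id]

/-- The composite of symmetric monoidal `V`-functors. -/
def SymmetricMonoidalVFunctor.comp (F : SymmetricMonoidalVFunctor V C D)
    (G : SymmetricMonoidalVFunctor V D E) : SymmetricMonoidalVFunctor V C E where
  functor := F.functor.comp V G.functor
  str :=
    letI := braidedComp F.functor G.functor
    { μ_natural X X' Y Y' := by
        rw [braidedComp_μ, braidedComp_μ]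
        have hF := F.str.μ_natural X X' Y Y'
        have hG := G.str.μ_natural (F.functor.obj X) (F.functor.obj X') (F.functor.obj Y)
          (F.functor.obj Y')
        change ((F.functor.map X X' ≫ G.functor.map _ _) ⊗ₘ (F.functor.map Y Y' ≫
            G.functor.map _ _)) ≫ tensorMap _ _ _ _ ≫ eHomWhiskerLeft V _ (μ (ordinary G.functor)
              (F.functor.obj X') (F.functor.obj Y') ≫ (ordinary G.functor).map
                (μ (ordinary F.functor) X' Y')) =
          tensorMap X X' Y Y' ≫ (F.functor.map (X ⊗ Y) (X' ⊗ Y') ≫ G.functor.map _ _) ≫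
            eHomWhiskerRight V (μ (ordinary G.functor) (F.functor.obj X) (F.functor.obj Y) ≫
              (ordinary G.functor).map (μ (ordinary F.functor) X Y)) _
        rw [← MonoidalCategory.tensorHom_comp_tensorHom, Category.assoc, eHomWhiskerLeft_comp,
          reassoc_of% hG, ← eHom_whisker_exchange, ← reassoc_of% eHomWhiskerLeft_map,
          reassoc_of% hF, eHomWhiskerRight_comp, Category.assoc,
          ← reassoc_of% eHomWhiskerRight_map] }

end

/-! ### The category of symmetric monoidal `V`-functors -/

section

variable {V}
variable {C : Type u₁} [Category.{v₁} C] [EnrichedOrdinaryCategory V C]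
    [MonoidalCategory C] [SymmetricCategory C] [SymmetricMonoidalEnriched V C]
  {D : Type u₂} [Category.{v₂} D] [EnrichedOrdinaryCategory V D]
    [MonoidalCategory D] [SymmetricCategory D] [SymmetricMonoidalEnriched V D]

/-- A monoidal `V`-natural transformation between symmetric monoidal `V`-functors. -/
@[ext]
structure MonoidalVNatTrans (F G : SymmetricMonoidalVFunctor V C D) where
  /-- The components. -/
  app (X : C) : F.functor.obj X ⟶ G.functor.obj X
  vnatural : IsVNatural V F.functor G.functor (fun X => eHomEquiv V (app X))
  unit : ε (ordinary F.functor) ≫ app (𝟙_ C) = ε (ordinary G.functor)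
  tensor (X Y : C) : μ (ordinary F.functor) X Y ≫ app (X ⊗ Y) =
    (app X ⊗ₘ app Y) ≫ μ (ordinary G.functor) X Y

lemma isVNatural_iff (F G : EnrichedFunctor V C D) (α : ∀ X, F.obj X ⟶ G.obj X) :
    IsVNatural V F G (fun X => eHomEquiv V (α X)) ↔
      ∀ X Y, F.map X Y ≫ eHomWhiskerLeft V _ (α Y) = G.map X Y ≫ eHomWhiskerRight V (α X) _ := by
  refine forall₂_congr fun X Y => ?_
  rw [eHomWhiskerLeft, eHomWhiskerRight, MonoidalCategory.rightUnitor_inv_naturality_assoc,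
    MonoidalCategory.leftUnitor_inv_naturality_assoc, MonoidalCategory.tensorHom_def,
    MonoidalCategory.tensorHom_def', Category.assoc, Category.assoc]

lemma MonoidalVNatTrans.naturality {F G : SymmetricMonoidalVFunctor V C D}
    (α : MonoidalVNatTrans F G) {X Y : C} (f : X ⟶ Y) :
    (ordinary F.functor).map f ≫ α.app Y = α.app X ≫ (ordinary G.functor).map f := by
  apply (eHomEquiv V).injective
  rw [eHomEquiv_comp_left, eHomEquiv_comp_right, eHomEquiv_ordinary_map, eHomEquiv_ordinary_map, Category.assoc, Category.assoc,
    (isVNatural_iff _ _ _).1 α.vnatural X Y]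

instance : Category (SymmetricMonoidalVFunctor V C D) where
  Hom F G := MonoidalVNatTrans F G
  id F :=
    { app X := 𝟙 _
      vnatural := (isVNatural_iff _ _ _).2 fun X Y => by simp
      unit := Category.comp_id _
      tensor X Y := by
        rw [MonoidalCategory.id_tensorHom_id, Category.id_comp]
        exact Category.comp_id _ }
  comp α γ :=
    { app X := α.app X ≫ γ.app X
      vnatural := (isVNatural_iff _ _ _).2 fun X Y => by
        have h1 := (isVNatural_iff _ _ _).1 α.vnatural X Y
        have h2 := (isVNatural_iff _ _ _).1 γ.vnatural X Y
        rw [eHomWhiskerLeft_comp, reassoc_of% h1, ← eHom_whisker_exchange, reassoc_of% h2,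
          eHomWhiskerRight_comp]
      unit := by rw [reassoc_of% α.unit, γ.unit]
      tensor X Y := by
        rw [reassoc_of% α.tensor, γ.tensor, MonoidalCategory.tensorHom_comp_tensorHom_assoc] }
  id_comp α := by
    apply MonoidalVNatTrans.ext; funext X; exact Category.id_comp _
  comp_id α := by
    apply MonoidalVNatTrans.ext; funext X; exact Category.comp_id _
  assoc α γ δ := by
    apply MonoidalVNatTrans.ext; funext X; exact Category.assoc _ _ _

end

section

variable {V} [MonoidalClosed V] [HasLimits V]
variable {S : Type w} [Category.{v₁} S] [EnrichedOrdinaryCategory V S]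
    [MonoidalCategory S] [SymmetricCategory S] [SymmetricMonoidalEnriched V S]
  {T : Type w} [Category.{v₂} T] [EnrichedOrdinaryCategory V T]
    [MonoidalCategory T] [SymmetricCategory T] [SymmetricMonoidalEnriched V T]

lemma IsVNatural.graded {A : Type w} [EnrichedCategory V A] {B : Type u} [EnrichedCategory V B]
    {F G : EnrichedFunctor V A B} {α : ∀ X : A, 𝟙_ V ⟶ (F.obj X ⟶[V] G.obj X)}
    (h : IsVNatural V F G α) : IsGradedVNatural V F G α := by
  intro X Y
  have := h X Y
  rw [Iso.inv_comp_eq] at this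
  rw [this]
  simp

variable (S) (C : Type u) [Category.{v₃} C] [EnrichedOrdinaryCategory V C]
    [MonoidalCategory C] [SymmetricCategory C] [SymmetricMonoidalEnriched V C]

/-- The functor forgetting the symmetric monoidal structures, with values in the underlying
category of the `V`-category `[S, C]`. -/
def forgetMonoidal :
    SymmetricMonoidalVFunctor V S C ⥤ ForgetEnrichment V (EnrichedFunctor V S C) where
  obj F := ForgetEnrichment.of V F.functor
  map {F G} α := ForgetEnrichment.homOf V
    (natLift F.functor G.functor (fun X => eHomEquiv V (α.app X)) α.vnatural.graded)
  map_id F := by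
    rw [← ForgetEnrichment.homOf_eId]
    congr 1
    refine nat_ext fun a => ?_
    rw [natLift_proj, eId_natProj]
    exact eHomEquiv_id V _
  map_comp {F G H} α γ := by
    rw [← ForgetEnrichment.homOf_comp]
    congr 1
    refine nat_ext fun a => ?_
    rw [natLift_proj, Category.assoc, Category.assoc, eComp_natProj,
      MonoidalCategory.tensorHom_comp_tensorHom_assoc, natLift_proj, natLift_proj]
    exact eHomEquiv_comp V _ _

variable {S}

lemma MonoidalVNatTrans.comp_unit (τ : SymmetricMonoidalVFunctor V S T)
    {F G : SymmetricMonoidalVFunctor V T C} (α : MonoidalVNatTrans F G) :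
    (ε (ordinary F.functor) ≫ (ordinary F.functor).map (ε (ordinary τ.functor))) ≫
      α.app (τ.functor.obj (𝟙_ S)) =
    ε (ordinary G.functor) ≫ (ordinary G.functor).map (ε (ordinary τ.functor)) := by
  have h := α.naturality (ε (ordinary τ.functor))
  rw [Category.assoc, h, ← α.unit, Category.assoc]

lemma MonoidalVNatTrans.comp_tensor (τ : SymmetricMonoidalVFunctor V S T)
    {F G : SymmetricMonoidalVFunctor V T C} (α : MonoidalVNatTrans F G) (X Y : S) :
    (μ (ordinary F.functor) (τ.functor.obj X) (τ.functor.obj Y) ≫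
        (ordinary F.functor).map (μ (ordinary τ.functor) X Y)) ≫ α.app (τ.functor.obj (X ⊗ Y)) =
      (α.app (τ.functor.obj X) ⊗ₘ α.app (τ.functor.obj Y)) ≫
        μ (ordinary G.functor) (τ.functor.obj X) (τ.functor.obj Y) ≫
          (ordinary G.functor).map (μ (ordinary τ.functor) X Y) := by
  have h := α.naturality (μ (ordinary τ.functor) X Y)
  rw [Category.assoc, h, reassoc_of% α.tensor]

lemma MonoidalVNatTrans.comp_vnatural (τ : SymmetricMonoidalVFunctor V S T)
    {F G : SymmetricMonoidalVFunctor V T C} (α : MonoidalVNatTrans F G) (X Y : S) :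
    (τ.functor.map X Y ≫ F.functor.map (τ.functor.obj X) (τ.functor.obj Y)) ≫
        eHomWhiskerLeft V _ (α.app (τ.functor.obj Y)) =
      (τ.functor.map X Y ≫ G.functor.map (τ.functor.obj X) (τ.functor.obj Y)) ≫
        eHomWhiskerRight V (α.app (τ.functor.obj X)) _ := by
  rw [Category.assoc, Category.assoc, (isVNatural_iff _ _ _).1 α.vnatural]

/-- Restriction of symmetric monoidal `V`-functors along a symmetric monoidal `V`-functor `τ`. -/
def restrictionMonoidal (τ : SymmetricMonoidalVFunctor V S T) :
    SymmetricMonoidalVFunctor V T C ⥤ SymmetricMonoidalVFunctor V S C where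
  obj F := τ.comp F
  map {F G} α :=
    { app X := α.app (τ.functor.obj X)
      vnatural := (isVNatural_iff _ _ _).2 (MonoidalVNatTrans.comp_vnatural C τ α)
      unit := (congrArg (· ≫ α.app (τ.functor.obj (𝟙_ S)))
          (braidedComp_ε τ.functor F.functor)).trans
        ((MonoidalVNatTrans.comp_unit C τ α).trans (braidedComp_ε τ.functor G.functor).symm)
      tensor X Y := (congrArg (· ≫ α.app (τ.functor.obj (X ⊗ Y)))
          (braidedComp_μ τ.functor F.functor X Y)).trans
        ((MonoidalVNatTrans.comp_tensor C τ α X Y).trans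
          (congrArg ((α.app (τ.functor.obj X) ⊗ₘ α.app (τ.functor.obj Y)) ≫ ·)
            (braidedComp_μ τ.functor G.functor X Y).symm)) }
  map_id F := rfl
  map_comp α γ := rfl

end

/-! ### The `V`-category of symmetric monoidal `V`-functors, for cartesian `V` -/

end SymmetricMonoidal

section Cartesian

open SymmetricMonoidalEnriched Functor.LaxMonoidal Functor.OplaxMonoidal

/-- The monoidal category `V` is cartesian: its unit is terminal and, for all `X` and `Y`, the
canonical maps `X ⊗ Y ⟶ X` and `X ⊗ Y ⟶ Y` exhibit `X ⊗ Y` as a product. -/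
class IsCartesianMonoidal (V : Type v) [Category.{w} V] [MonoidalCategory V] : Prop where
  isTerminal : Nonempty (IsTerminal (𝟙_ V))
  isProduct (X Y : V) (f : X ⟶ 𝟙_ V) (g : Y ⟶ 𝟙_ V) :
    Nonempty (IsLimit (BinaryFan.mk (X ◁ g ≫ (ρ_ X).hom) (f ▷ Y ≫ (λ_ Y).hom)))

section

variable (V : Type v) [Category.{w} V] [m : MonoidalCategory V] [IsCartesianMonoidal V]

/-- The associated structure of a cartesian monoidal category. -/
@[reducible]
def cartesian : CartesianMonoidalCategory V :=
  { m with
    isTerminalTensorUnit := IsCartesianMonoidal.isTerminal.some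
    fst X Y := X ◁ IsCartesianMonoidal.isTerminal.some.from Y ≫ (ρ_ X).hom
    snd X Y := IsCartesianMonoidal.isTerminal.some.from X ▷ Y ≫ (λ_ Y).hom
    tensorProductIsBinaryProduct X Y := (IsCartesianMonoidal.isProduct X Y _ _).some }

variable {V}

/-- The map to the unit object. -/
def counit (X : V) : X ⟶ 𝟙_ V := IsCartesianMonoidal.isTerminal.some.from X

/-- The diagonal map. -/
def diag (X : V) : X ⟶ X ⊗ X :=
  letI := cartesian V
  CartesianMonoidalCategory.lift (𝟙 X) (𝟙 X)

lemma counit_unique {X : V} (f g : X ⟶ 𝟙_ V) : f = g :=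
  IsCartesianMonoidal.isTerminal.some.hom_ext f g

lemma diag_natural {X Y : V} (f : X ⟶ Y) : f ≫ diag Y = diag X ≫ (f ⊗ₘ f) := by
  letI := cartesian V
  unfold diag
  ext <;> simp

lemma diag_unit : diag (𝟙_ V) = (λ_ (𝟙_ V)).inv := by
  letI := cartesian V
  unfold diag
  exact CartesianMonoidalCategory.hom_ext _ _ (counit_unique _ _) (counit_unique _ _)

lemma diag_tensor [BraidedCategory V] (X Y : V) :
    diag (X ⊗ Y) = (diag X ⊗ₘ diag Y) ≫ tensorμ X X Y Y := by
  letI := cartesian V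
  unfold diag
  apply CartesianMonoidalCategory.hom_ext
  · rw [Category.assoc, CartesianMonoidalCategory.tensorμ_fst]; simp
  · rw [Category.assoc, CartesianMonoidalCategory.tensorμ_snd]; simp

end

variable {V : Type v} [Category.{w} V] [MonoidalCategory V] [SymmetricCategory V]

lemma eHomEquiv_tensor_eComp {C : Type u₁} [Category.{v₁} C] [EnrichedOrdinaryCategory V C]
    {P : V} {X Y Z : C} (f : X ⟶ Y) (g : P ⟶ (Y ⟶[V] Z)) :
    (eHomEquiv V f ⊗ₘ g) ≫ eComp V _ _ _ = (λ_ P).hom ≫ g ≫ eHomWhiskerRight V f Z := by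
  rw [eHomWhiskerRight, MonoidalCategory.leftUnitor_inv_naturality_assoc, Iso.hom_inv_id_assoc,
    MonoidalCategory.tensorHom_def', Category.assoc]

lemma tensor_eHomEquiv_eComp {C : Type u₁} [Category.{v₁} C] [EnrichedOrdinaryCategory V C]
    {P : V} {X Y Z : C} (g : P ⟶ (X ⟶[V] Y)) (f : Y ⟶ Z) :
    (g ⊗ₘ eHomEquiv V f) ≫ eComp V _ _ _ = (ρ_ P).hom ≫ g ≫ eHomWhiskerLeft V X f := by
  rw [eHomWhiskerLeft, MonoidalCategory.rightUnitor_inv_naturality_assoc, Iso.hom_inv_id_assoc,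
    MonoidalCategory.tensorHom_def, Category.assoc]

lemma tensor_eComp_middle {C : Type u₁} [Category.{v₁} C] [EnrichedOrdinaryCategory V C]
    {P Q : V} {X Y Y' Z : C} (f : P ⟶ (X ⟶[V] Y)) (g : Y ⟶ Y') (h : Q ⟶ (Y' ⟶[V] Z)) :
    ((f ≫ eHomWhiskerLeft V X g) ⊗ₘ h) ≫ eComp V _ _ _ =
      (f ⊗ₘ (h ≫ eHomWhiskerRight V g Z)) ≫ eComp V _ _ _ := by
  have h1 : f ≫ eHomWhiskerLeft V X g = (ρ_ P).inv ≫ (f ⊗ₘ eHomEquiv V g) ≫ eComp V _ _ _ := by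
    rw [tensor_eHomEquiv_eComp, Iso.inv_hom_id_assoc]
  have h2 : h ≫ eHomWhiskerRight V g Z = (λ_ Q).inv ≫ (eHomEquiv V g ⊗ₘ h) ≫ eComp V _ _ _ := by
    rw [eHomEquiv_tensor_eComp, Iso.inv_hom_id_assoc]
  have h3 : (f ⊗ₘ ((λ_ Q).inv ≫ (eHomEquiv V g ⊗ₘ h) ≫ eComp V _ _ _)) =
      (P ◁ (λ_ Q).inv) ≫ (f ⊗ₘ ((eHomEquiv V g ⊗ₘ h) ≫ eComp V _ _ _)) :=
    (MonoidalCategory.whiskerLeft_comp_tensorHom _ _ _).symm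
  rw [h1, h2, ← MonoidalCategory.whiskerRight_comp_tensorHom, Category.assoc, tensor_eComp_assoc,
    h3, Category.assoc]
  simp

section

variable {S : Type u₁} [Category.{v₁} S] [EnrichedOrdinaryCategory V S]
    [MonoidalCategory S] [SymmetricCategory S] [SymmetricMonoidalEnriched V S]
  {C : Type u} [Category.{v₃} C] [EnrichedOrdinaryCategory V C]
    [MonoidalCategory C] [SymmetricCategory C] [SymmetricMonoidalEnriched V C]
  [IsCartesianMonoidal V]

/-- A family of maps `X ⟶ (F a ⟶[V] G a)` in `V` is compatible with the symmetric monoidal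
structures of `F` and `G`. -/
structure IsGradedMonoidal (F G : SymmetricMonoidalVFunctor V S C) {X : V}
    (α : ∀ a : S, X ⟶ (F.functor.obj a ⟶[V] G.functor.obj a)) : Prop where
  unit : α (𝟙_ S) ≫ eHomWhiskerRight V (ε (ordinary F.functor)) _ =
    counit X ≫ eHomEquiv V (ε (ordinary G.functor))
  tensor (a b : S) : α (a ⊗ b) ≫ eHomWhiskerRight V (μ (ordinary F.functor) a b) _ =
    diag X ≫ (α a ⊗ₘ α b) ≫ tensorMap _ _ _ _ ≫
      eHomWhiskerLeft V _ (μ (ordinary G.functor) a b)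

lemma IsGradedMonoidal.precomp {F G : SymmetricMonoidalVFunctor V S C} {X Y : V}
    {α : ∀ a : S, X ⟶ (F.functor.obj a ⟶[V] G.functor.obj a)} (h : IsGradedMonoidal F G α)
    (f : Y ⟶ X) : IsGradedMonoidal F G (fun a => f ≫ α a) where
  unit := by
    rw [Category.assoc, h.unit, ← Category.assoc, counit_unique (f ≫ counit X) (counit Y)]
  tensor a b := by
    rw [Category.assoc, h.tensor, reassoc_of% diag_natural,
      MonoidalCategory.tensorHom_comp_tensorHom_assoc]

lemma IsGradedMonoidal.id (F : SymmetricMonoidalVFunctor V S C) :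
    IsGradedMonoidal F F (fun a => eId V (F.functor.obj a)) where
  unit := by
    rw [counit_unique (counit (𝟙_ V)) (𝟙 _), Category.id_comp,
      ← eHomEquiv_id, ← eHomEquiv_comp_right, Category.comp_id]
  tensor a b := by
    rw [← eHomEquiv_id, ← eHomEquiv_comp_right, Category.comp_id, ← eHomEquiv_id, ← eHomEquiv_id,
      diag_unit, reassoc_of% tensorMap_homEquiv, ← eHomEquiv_comp_left,
      MonoidalCategory.id_tensorHom_id, Category.id_comp]

lemma IsGradedMonoidal.comp {F G H : SymmetricMonoidalVFunctor V S C} {X Y : V}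
    {α : ∀ a : S, X ⟶ (F.functor.obj a ⟶[V] G.functor.obj a)} (hα : IsGradedMonoidal F G α)
    {γ : ∀ a : S, Y ⟶ (G.functor.obj a ⟶[V] H.functor.obj a)} (hγ : IsGradedMonoidal G H γ) :
    IsGradedMonoidal F H (fun a => (α a ⊗ₘ γ a) ≫ eComp V _ _ _) where
  unit := by
    rw [Category.assoc, eComp_eHomWhiskerRight, MonoidalCategory.tensorHom_comp_whiskerRight_assoc,
      hα.unit, ← MonoidalCategory.whiskerRight_comp_tensorHom, Category.assoc,
      eHomEquiv_tensor_eComp, hγ.unit, ← Category.assoc, ← Category.assoc,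
      counit_unique ((counit X ▷ Y ≫ (λ_ Y).hom) ≫ counit Y) (counit (X ⊗ Y))]
  tensor a b := by
    rw [Category.assoc, eComp_eHomWhiskerRight, MonoidalCategory.tensorHom_comp_whiskerRight_assoc,
      hα.tensor]
    have h1 : diag X ≫ (α a ⊗ₘ α b) ≫ tensorMap _ _ _ _ ≫
        eHomWhiskerLeft V _ (μ (ordinary G.functor) a b) =
        (diag X ≫ (α a ⊗ₘ α b) ≫ tensorMap _ _ _ _) ≫
          eHomWhiskerLeft V _ (μ (ordinary G.functor) a b) := by simp only [Category.assoc]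
    have h2 : diag Y ≫ (γ a ⊗ₘ γ b) ≫ tensorMap _ _ _ _ ≫
        eHomWhiskerLeft V _ (μ (ordinary H.functor) a b) =
        (diag Y ≫ (γ a ⊗ₘ γ b) ≫ tensorMap _ _ _ _) ≫
          eHomWhiskerLeft V _ (μ (ordinary H.functor) a b) := by simp only [Category.assoc]
    rw [h1, tensor_eComp_middle, hγ.tensor, h2, ← MonoidalCategory.tensorHom_comp_whiskerLeft,
      Category.assoc, ← eComp_eHomWhiskerLeft, ← MonoidalCategory.tensorHom_comp_tensorHom,
      ← MonoidalCategory.tensorHom_comp_tensorHom, Category.assoc, Category.assoc,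
      reassoc_of% tensorMap_comp, diag_tensor, Category.assoc,
      reassoc_of% tensorμ_natural, MonoidalCategory.tensorHom_comp_tensorHom_assoc]

end

section

variable [MonoidalClosed V] [HasLimits V] [IsCartesianMonoidal V]
variable {S : Type w} [Category.{v₁} S] [EnrichedOrdinaryCategory V S]
    [MonoidalCategory S] [SymmetricCategory S] [SymmetricMonoidalEnriched V S]
  {T : Type w} [Category.{v₂} T] [EnrichedOrdinaryCategory V T]
    [MonoidalCategory T] [SymmetricCategory T] [SymmetricMonoidalEnriched V T]
  {C : Type u} [Category.{v₃} C] [EnrichedOrdinaryCategory V C]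
    [MonoidalCategory C] [SymmetricCategory C] [SymmetricMonoidalEnriched V C]

/-- The target of the two maps whose equalizer is the object of monoidal `V`-natural
transformations. -/
abbrev monoidalTarget (F G : SymmetricMonoidalVFunctor V S C) : V :=
  (∏ᶜ fun p : S × S => ((F.functor.obj p.1 ⊗ F.functor.obj p.2 : C) ⟶[V]
    G.functor.obj (p.1 ⊗ p.2))) ⨯ (𝟙_ C ⟶[V] G.functor.obj (𝟙_ S))

/-- Components of a transformation at tensor products, and at the unit. -/
def monoidalFst (F G : SymmetricMonoidalVFunctor V S C) :
    (F.functor ⟶[V] G.functor) ⟶ monoidalTarget F G :=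
  prod.lift
    (Pi.lift fun p : S × S => natProj F.functor G.functor (p.1 ⊗ p.2) ≫
      eHomWhiskerRight V (μ (ordinary F.functor) p.1 p.2) _)
    (natProj F.functor G.functor (𝟙_ S) ≫ eHomWhiskerRight V (ε (ordinary F.functor)) _)

/-- Tensor products of components of a transformation, and the identity of the unit. -/
def monoidalSnd (F G : SymmetricMonoidalVFunctor V S C) :
    (F.functor ⟶[V] G.functor) ⟶ monoidalTarget F G :=
  prod.lift
    (Pi.lift fun p : S × S => diag _ ≫
      (natProj F.functor G.functor p.1 ⊗ₘ natProj F.functor G.functor p.2) ≫ tensorMap _ _ _ _ ≫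
        eHomWhiskerLeft V _ (μ (ordinary G.functor) p.1 p.2))
    (counit _ ≫ eHomEquiv V (ε (ordinary G.functor)))

/-- The object of monoidal `V`-natural transformations from `F` to `G`. -/
def monoidalHomObj (F G : SymmetricMonoidalVFunctor V S C) : V :=
  equalizer (monoidalFst F G) (monoidalSnd F G)

/-- The inclusion into the object of `V`-natural transformations. -/
def monoidalHomι (F G : SymmetricMonoidalVFunctor V S C) :
    monoidalHomObj F G ⟶ (F.functor ⟶[V] G.functor) :=
  equalizer.ι (monoidalFst F G) (monoidalSnd F G)

lemma comp_monoidalFst_eq_iff (F G : SymmetricMonoidalVFunctor V S C) {X : V}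
    (f : X ⟶ (F.functor ⟶[V] G.functor)) :
    f ≫ monoidalFst F G = f ≫ monoidalSnd F G ↔
      IsGradedMonoidal F G (fun a => f ≫ natProj F.functor G.functor a) := by
  have e1 : f ≫ counit _ = counit X := counit_unique _ _
  constructor
  · intro h
    constructor
    · have := congrArg (· ≫ prod.snd) h
      simp only [monoidalFst, monoidalSnd, Category.assoc, prod.lift_snd] at this
      rw [Category.assoc, this, ← Category.assoc, e1]
    · intro a b
      have := congrArg (· ≫ prod.fst ≫ Pi.π _ (a, b)) h
      simp only [monoidalFst, monoidalSnd, Category.assoc, prod.lift_fst_assoc,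
        Pi.lift_π] at this
      rw [Category.assoc, this, reassoc_of% diag_natural,
        MonoidalCategory.tensorHom_comp_tensorHom_assoc]
  · intro h
    unfold monoidalFst monoidalSnd
    apply Limits.prod.hom_ext
    · apply Limits.Pi.hom_ext
      rintro ⟨a, b⟩
      have := h.tensor a b
      simp only [Category.assoc, prod.lift_fst, Pi.lift_π]
      rw [Category.assoc] at this
      rw [this, reassoc_of% diag_natural,
        MonoidalCategory.tensorHom_comp_tensorHom_assoc]
    · have := h.unit
      rw [Category.assoc] at this
      simp only [Category.assoc, prod.lift_snd]
      rw [this, ← Category.assoc, e1]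

/-- The component at `a` of the `V`-object of monoidal `V`-natural transformations. -/
def monoidalProj (F G : SymmetricMonoidalVFunctor V S C) (a : S) :
    monoidalHomObj F G ⟶ (F.functor.obj a ⟶[V] G.functor.obj a) :=
  monoidalHomι F G ≫ natProj F.functor G.functor a

lemma monoidalProj_natural (F G : SymmetricMonoidalVFunctor V S C) :
    IsGradedVNatural V F.functor G.functor (monoidalProj F G) :=
  (natProj_natural F.functor G.functor).precomp (monoidalHomι F G)

lemma monoidalProj_monoidal (F G : SymmetricMonoidalVFunctor V S C) :
    IsGradedMonoidal F G (monoidalProj F G) :=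
  (comp_monoidalFst_eq_iff F G (monoidalHomι F G)).1 (equalizer.condition _ _)

/-- The universal property of the object of monoidal `V`-natural transformations. -/
def monoidalLift (F G : SymmetricMonoidalVFunctor V S C) {X : V}
    (α : ∀ a : S, X ⟶ (F.functor.obj a ⟶[V] G.functor.obj a))
    (h : IsGradedVNatural V F.functor G.functor α) (h' : IsGradedMonoidal F G α) :
    X ⟶ monoidalHomObj F G :=
  equalizer.lift (natLift F.functor G.functor α h)
    ((comp_monoidalFst_eq_iff F G _).2 (by simpa only [natLift_proj] using h'))

lemma monoidalLift_ι (F G : SymmetricMonoidalVFunctor V S C) {X : V}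
    (α : ∀ a : S, X ⟶ (F.functor.obj a ⟶[V] G.functor.obj a))
    (h : IsGradedVNatural V F.functor G.functor α) (h' : IsGradedMonoidal F G α) :
    monoidalLift F G α h h' ≫ monoidalHomι F G = natLift F.functor G.functor α h :=
  equalizer.lift_ι _ _

lemma monoidalLift_proj (F G : SymmetricMonoidalVFunctor V S C) {X : V}
    (α : ∀ a : S, X ⟶ (F.functor.obj a ⟶[V] G.functor.obj a))
    (h : IsGradedVNatural V F.functor G.functor α) (h' : IsGradedMonoidal F G α) (a : S) :
    monoidalLift F G α h h' ≫ monoidalProj F G a = α a := by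
  rw [monoidalProj, ← Category.assoc, monoidalLift_ι, natLift_proj]

lemma monoidalHomObj_ext {F G : SymmetricMonoidalVFunctor V S C} {X : V}
    {f g : X ⟶ monoidalHomObj F G}
    (h : ∀ a, f ≫ monoidalProj F G a = g ≫ monoidalProj F G a) : f = g := by
  apply equalizer.hom_ext
  refine nat_ext fun a => ?_
  exact (Category.assoc _ _ _).trans ((h a).trans (Category.assoc _ _ _).symm)

/-- The `V`-category of symmetric monoidal `V`-functors from `S` to `C`. -/
instance monoidalFunctorCategory : EnrichedCategory V (SymmetricMonoidalVFunctor V S C) where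
  Hom F G := monoidalHomObj F G
  id F := monoidalLift F F (fun a => eId V (F.functor.obj a)) (IsGradedVNatural.id F.functor)
    (IsGradedMonoidal.id F)
  comp F G H := monoidalLift F H
    (fun a => (monoidalProj F G a ⊗ₘ monoidalProj G H a) ≫ eComp V _ _ _)
    ((monoidalProj_natural F G).comp (monoidalProj_natural G H))
    ((monoidalProj_monoidal F G).comp (monoidalProj_monoidal G H))
  id_comp F G := monoidalHomObj_ext fun a => by
    rw [Category.assoc, Category.assoc, monoidalLift_proj, Category.id_comp]
    rw [MonoidalCategory.whiskerRight_comp_tensorHom_assoc, monoidalLift_proj, eId_tensor_eComp]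
    simp
  comp_id F G := monoidalHomObj_ext fun a => by
    rw [Category.assoc, Category.assoc, monoidalLift_proj, Category.id_comp]
    rw [MonoidalCategory.whiskerLeft_comp_tensorHom_assoc, monoidalLift_proj, tensor_eId_eComp]
    simp
  assoc F G H K := monoidalHomObj_ext fun a => by
    rw [Category.assoc, Category.assoc, Category.assoc, monoidalLift_proj, monoidalLift_proj,
      MonoidalCategory.whiskerRight_comp_tensorHom_assoc,
      MonoidalCategory.whiskerLeft_comp_tensorHom_assoc, monoidalLift_proj, monoidalLift_proj,
      tensor_eComp_assoc]
    simp

/-- The component at `a`, with its source expressed through the enrichment. -/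
def monProj (F G : SymmetricMonoidalVFunctor V S C) (a : S) :
    (F ⟶[V] G) ⟶ (F.functor.obj a ⟶[V] G.functor.obj a) :=
  monoidalProj F G a

/-- The inclusion, with its source expressed through the enrichment. -/
def monι (F G : SymmetricMonoidalVFunctor V S C) :
    (F ⟶[V] G) ⟶ (F.functor ⟶[V] G.functor) :=
  monoidalHomι F G

lemma monι_natProj (F G : SymmetricMonoidalVFunctor V S C) (a : S) :
    monι F G ≫ natProj F.functor G.functor a = monProj F G a := rfl

lemma mon_ext {F G : SymmetricMonoidalVFunctor V S C} {X : V} {f g : X ⟶ (F ⟶[V] G)}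
    (h : ∀ a, f ≫ monProj F G a = g ≫ monProj F G a) : f = g :=
  monoidalHomObj_ext h

lemma eId_monProj (F : SymmetricMonoidalVFunctor V S C) (a : S) :
    eId V F ≫ monProj F F a = eId V (F.functor.obj a) :=
  monoidalLift_proj F F _ (IsGradedVNatural.id F.functor) (IsGradedMonoidal.id F) a

lemma eComp_monProj (F G H : SymmetricMonoidalVFunctor V S C) (a : S) :
    eComp V F G H ≫ monProj F H a = (monProj F G a ⊗ₘ monProj G H a) ≫ eComp V _ _ _ :=
  monoidalLift_proj F H _ ((monoidalProj_natural F G).comp (monoidalProj_natural G H))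
    ((monoidalProj_monoidal F G).comp (monoidalProj_monoidal G H)) a

variable (V S C) in
/-- The `V`-functor forgetting the symmetric monoidal structures. -/
def forgetMonoidalV :
    EnrichedFunctor V (SymmetricMonoidalVFunctor V S C) (EnrichedFunctor V S C) where
  obj F := F.functor
  map F G := monι F G
  map_id F := nat_ext fun a => by
    rw [eId_natProj, Category.assoc, monι_natProj, eId_monProj]
  map_comp F G H := nat_ext fun a => by
    rw [Category.assoc, monι_natProj, eComp_monProj, Category.assoc, eComp_natProj,
      MonoidalCategory.tensorHom_comp_tensorHom_assoc, monι_natProj, monι_natProj]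

lemma IsGradedVNatural.ordinary_map {F G : EnrichedFunctor V T C} {X : V}
    {α : ∀ a : T, X ⟶ (F.obj a ⟶[V] G.obj a)} (h : IsGradedVNatural V F G α) {a b : T}
    (f : a ⟶ b) :
    α b ≫ eHomWhiskerRight V ((ordinary F).map f) _ =
      α a ≫ eHomWhiskerLeft V _ ((ordinary G).map f) := by
  have h1 := congrArg (fun k => (λ_ X).inv ≫ (eHomEquiv V f ▷ X) ≫ k) (h a b)
  rw [MonoidalCategory.whiskerRight_comp_tensorHom_assoc, ← eHomEquiv_ordinary_map,
    eHomEquiv_tensor_eComp, Iso.inv_hom_id_assoc,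
    BraidedCategory.braiding_naturality_left_assoc,
    MonoidalCategory.whiskerLeft_comp_tensorHom_assoc, ← eHomEquiv_ordinary_map,
    tensor_eHomEquiv_eComp] at h1
  rw [h1]
  simp

lemma IsGradedMonoidal.whisker_unit (τ : SymmetricMonoidalVFunctor V S T)
    {F G : SymmetricMonoidalVFunctor V T C} {X : V}
    {α : ∀ a : T, X ⟶ (F.functor.obj a ⟶[V] G.functor.obj a)}
    (hn : IsGradedVNatural V F.functor G.functor α) (h : IsGradedMonoidal F G α) :
    α (τ.functor.obj (𝟙_ S)) ≫ eHomWhiskerRight V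
        (ε (ordinary F.functor) ≫ (ordinary F.functor).map (ε (ordinary τ.functor))) _ =
      counit X ≫ eHomEquiv V
        (ε (ordinary G.functor) ≫ (ordinary G.functor).map (ε (ordinary τ.functor))) := by
  have h1 := hn.ordinary_map (ε (ordinary τ.functor))
  rw [eHomWhiskerRight_comp, reassoc_of% h1, eHom_whisker_exchange, reassoc_of% h.unit,
    eHomEquiv_comp_left]

lemma IsGradedMonoidal.whisker_tensor (τ : SymmetricMonoidalVFunctor V S T)
    {F G : SymmetricMonoidalVFunctor V T C} {X : V}
    {α : ∀ a : T, X ⟶ (F.functor.obj a ⟶[V] G.functor.obj a)}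
    (hn : IsGradedVNatural V F.functor G.functor α) (h : IsGradedMonoidal F G α) (a b : S) :
    α (τ.functor.obj (a ⊗ b)) ≫ eHomWhiskerRight V
        (μ (ordinary F.functor) (τ.functor.obj a) (τ.functor.obj b) ≫
          (ordinary F.functor).map (μ (ordinary τ.functor) a b)) _ =
      diag X ≫ (α (τ.functor.obj a) ⊗ₘ α (τ.functor.obj b)) ≫ tensorMap _ _ _ _ ≫
        eHomWhiskerLeft V _ (μ (ordinary G.functor) (τ.functor.obj a) (τ.functor.obj b) ≫
          (ordinary G.functor).map (μ (ordinary τ.functor) a b)) := by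
  have h1 := hn.ordinary_map (μ (ordinary τ.functor) a b)
  rw [eHomWhiskerRight_comp, reassoc_of% h1, eHom_whisker_exchange, reassoc_of% h.tensor,
    eHomWhiskerLeft_comp]

lemma IsGradedMonoidal.whisker (τ : SymmetricMonoidalVFunctor V S T)
    {F G : SymmetricMonoidalVFunctor V T C} {X : V}
    {α : ∀ a : T, X ⟶ (F.functor.obj a ⟶[V] G.functor.obj a)}
    (hn : IsGradedVNatural V F.functor G.functor α) (h : IsGradedMonoidal F G α) :
    IsGradedMonoidal (τ.comp F) (τ.comp G) (fun a => α (τ.functor.obj a)) where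
  unit := by
    refine Eq.trans ?_ ((h.whisker_unit τ hn).trans ?_)
    · exact congrArg (fun k => α (τ.functor.obj (𝟙_ S)) ≫ eHomWhiskerRight V k _)
        (braidedComp_ε τ.functor F.functor)
    · exact congrArg (fun k => counit X ≫ eHomEquiv V k)
        (braidedComp_ε τ.functor G.functor).symm
  tensor a b := by
    refine Eq.trans ?_ ((h.whisker_tensor τ hn a b).trans ?_)
    · exact congrArg (fun k => α (τ.functor.obj (a ⊗ b)) ≫ eHomWhiskerRight V k _)
        (braidedComp_μ τ.functor F.functor a b)
    · exact congrArg (fun k => diag X ≫ (α (τ.functor.obj a) ⊗ₘ α (τ.functor.obj b)) ≫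
          tensorMap _ _ _ _ ≫ eHomWhiskerLeft V _ k)
        (braidedComp_μ τ.functor G.functor a b).symm

/-- The map `(F ⟶[V] G) ⟶ (F ∘ τ ⟶[V] G ∘ τ)` given by restriction along `τ`. -/
def restrictionMonoidalMap (τ : SymmetricMonoidalVFunctor V S T)
    (F G : SymmetricMonoidalVFunctor V T C) : (F ⟶[V] G) ⟶ (τ.comp F ⟶[V] τ.comp G) :=
  monoidalLift (τ.comp F) (τ.comp G) (fun a => monProj F G (τ.functor.obj a))
    ((monoidalProj_natural F G).whisker τ.functor)
    ((monoidalProj_monoidal F G).whisker τ (monoidalProj_natural F G))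

lemma restrictionMonoidalMap_monProj (τ : SymmetricMonoidalVFunctor V S T)
    (F G : SymmetricMonoidalVFunctor V T C) (a : S) :
    restrictionMonoidalMap τ F G ≫ monProj (τ.comp F) (τ.comp G) a =
      monProj F G (τ.functor.obj a) :=
  monoidalLift_proj (τ.comp F) (τ.comp G) (fun a => monProj F G (τ.functor.obj a))
    ((monoidalProj_natural F G).whisker τ.functor)
    ((monoidalProj_monoidal F G).whisker τ (monoidalProj_natural F G)) a

variable (C) in
/-- Restriction along a symmetric monoidal `V`-functor `τ`, as a `V`-functor between `V`-categories
of symmetric monoidal `V`-functors. -/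
def restrictionMonoidalV (τ : SymmetricMonoidalVFunctor V S T) :
    EnrichedFunctor V (SymmetricMonoidalVFunctor V T C) (SymmetricMonoidalVFunctor V S C) where
  obj F := τ.comp F
  map F G := restrictionMonoidalMap τ F G
  map_id F := mon_ext fun a => by
    rw [Category.assoc, restrictionMonoidalMap_monProj, eId_monProj]
    exact eId_monProj F (τ.functor.obj a)
  map_comp F G H := mon_ext fun a => by
    rw [Category.assoc, restrictionMonoidalMap_monProj, Category.assoc, eComp_monProj,
      MonoidalCategory.tensorHom_comp_tensorHom_assoc, restrictionMonoidalMap_monProj,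
      restrictionMonoidalMap_monProj]
    exact eComp_monProj F G H (τ.functor.obj a)

end

end Cartesian

/-! ### Presheaves, weighted colimits and adjunctions -/

section Presheaf

open MonoidalClosed

variable (V : Type v) [Category.{w} V] [MonoidalCategory V] [SymmetricCategory V]
  [MonoidalClosed V]

/-- `V`-presheaves on a `V`-category `A`, i.e. `V`-functors `Aᵒᵖ ⟶ V`. -/
abbrev Presheaf (A : Type u₁) [EnrichedCategory V A] := EnrichedFunctor V Aᵒᵖ V

variable {V}

/-- The contravariant action `A(a, a') ⊗ P a' ⟶ P a` on a presheaf `P`. -/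
def Presheaf.act {A : Type u₁} [EnrichedCategory V A] (P : Presheaf V A) (a a' : A) :
    (a ⟶[V] a') ⊗ P.obj (op a') ⟶ P.obj (op a) :=
  (β_ _ _).hom ≫ MonoidalClosed.uncurry (P.map (op a') (op a))

/-- The `V`-functor `Aᵒᵖ ⟶ Bᵒᵖ` induced by a `V`-functor `A ⟶ B`. -/
def opVFunctor {A : Type u₁} [EnrichedCategory V A] {B : Type u₂} [EnrichedCategory V B]
    (F : EnrichedFunctor V A B) : EnrichedFunctor V Aᵒᵖ Bᵒᵖ where
  obj a := op (F.obj a.unop)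
  map a b := F.map b.unop a.unop
  map_id a := F.map_id a.unop
  map_comp a b c := by
    rw [eComp_op_eq, eComp_op_eq, Category.assoc, F.map_comp]
    exact (BraidedCategory.braiding_naturality_assoc _ _ _).symm

lemma whiskerLeft_curry_tensor_compTranspose {P Y Z X' Y' : V} (f : P ⊗ X' ⟶ Y)
    (g : Y ⊗ Y' ⟶ Z) :
    P ◁ (MonoidalClosed.curry f ⊗ₘ MonoidalClosed.curry g) ≫
        MonoidalClosed.compTranspose P Y Z =
      (α_ P X' Y').inv ≫ f ▷ Y' ≫ g := by
  rw [MonoidalClosed.compTranspose_eq, ← MonoidalCategory.id_tensorHom,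
    associator_inv_naturality_assoc, MonoidalCategory.id_tensorHom,
    MonoidalCategory.tensorHom_comp_whiskerRight_assoc,
    MonoidalClosed.whiskerLeft_curry_ihom_ev_app, MonoidalCategory.tensorHom_def, Category.assoc]
  exact congrArg (fun k => (α_ P X' Y').inv ≫ f ▷ Y' ≫ k)
    (MonoidalClosed.whiskerLeft_curry_ihom_ev_app _ _ _)

lemma braiding_eComp {A : Type u₁} [EnrichedCategory V A] (a a' a'' b : A) :
    (a ⟶[V] b) ◁ ((β_ (a' ⟶[V] a) (a'' ⟶[V] a')).hom ≫ eComp V a'' a' a) ≫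
        (β_ (a ⟶[V] b) (a'' ⟶[V] a)).hom ≫ eComp V a'' a b =
      (α_ _ _ _).inv ≫ ((β_ (a ⟶[V] b) (a' ⟶[V] a)).hom ≫ eComp V a' a b) ▷ (a'' ⟶[V] a') ≫
        (β_ (a' ⟶[V] b) (a'' ⟶[V] a')).hom ≫ eComp V a'' a' b := by
  rw [MonoidalCategory.whiskerLeft_comp, MonoidalCategory.comp_whiskerRight, Category.assoc,
    Category.assoc, BraidedCategory.braiding_naturality_right_assoc,
    BraidedCategory.braiding_naturality_left_assoc, ← e_assoc,
    BraidedCategory.braiding_tensor_right_hom, BraidedCategory.braiding_tensor_left_hom]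
  have h := BraidedCategory.yang_baxter (a ⟶[V] b) (a' ⟶[V] a) (a'' ⟶[V] a')
  simp only [Category.assoc, Iso.hom_inv_id_assoc]
  rw [← reassoc_of% h, Iso.hom_inv_id_assoc]

/-- The representable presheaf `A(-, b)`. -/
def representable {A : Type u₁} [EnrichedCategory V A] (b : A) : Presheaf V A where
  obj a := a.unop ⟶[V] b
  map a a' := MonoidalClosed.curry ((β_ _ _).hom ≫ eComp V a'.unop a.unop b)
  map_id a := by
    have h : (a.unop ⟶[V] b) ◁ eId V a.unop ≫ (β_ _ _).hom ≫ eComp V a.unop a.unop b =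
        (ρ_ (a.unop ⟶[V] b)).hom := by
      rw [BraidedCategory.braiding_naturality_right_assoc, braiding_tensorUnit_right,
        Category.assoc, e_id_comp, Category.comp_id]
    change eId V a.unop ≫ _ = MonoidalClosed.id _
    rw [← MonoidalClosed.curry_natural_left]
    exact congrArg MonoidalClosed.curry h
  map_comp a a' a'' := by
    change ((β_ _ _).hom ≫ eComp V a''.unop a'.unop a.unop) ≫ _ = _ ≫ MonoidalClosed.comp _ _ _
    rw [MonoidalClosed.comp_eq, ← MonoidalClosed.curry_natural_left,
      ← MonoidalClosed.curry_natural_left]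
    refine congrArg MonoidalClosed.curry ?_
    exact (braiding_eComp a.unop a'.unop a''.unop b).trans
      (whiskerLeft_curry_tensor_compTranspose _ _).symm

/-- Restriction of presheaves along a `V`-functor. -/
abbrev Presheaf.restrict {A : Type u₁} [EnrichedCategory V A] {B : Type u₂} [EnrichedCategory V B]
    (F : EnrichedFunctor V A B) (P : Presheaf V B) : Presheaf V A :=
  (opVFunctor F).comp V P

lemma Presheaf.restrict_act {A : Type u₁} [EnrichedCategory V A] {B : Type u₂}
    [EnrichedCategory V B] (F : EnrichedFunctor V A B) (P : Presheaf V B) (a a' : A) :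
    (P.restrict F).act a a' = (F.map a a' ▷ _) ≫ P.act (F.obj a) (F.obj a') := by
  change (β_ _ _).hom ≫ MonoidalClosed.uncurry (F.map a a' ≫ P.map _ _) =
    _ ≫ (β_ _ _).hom ≫ MonoidalClosed.uncurry (P.map _ _)
  rw [MonoidalClosed.uncurry_natural_left, ← BraidedCategory.braiding_naturality_left_assoc]
  rfl

/-- The family of maps `φ j : W j ⊗ Z ⟶ C(G j, X)` is `V`-natural in `j`. -/
def IsGradedCocone {J : Type u₁} [EnrichedCategory V J] {C : Type u₂} [EnrichedCategory V C]
    (W : Presheaf V J) (G : EnrichedFunctor V J C) (Z : V) (X : C)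
    (φ : ∀ j : J, W.obj (op j) ⊗ Z ⟶ (G.obj j ⟶[V] X)) : Prop :=
  ∀ j j' : J, (W.act j j' ▷ Z) ≫ φ j =
    (α_ _ _ _).hom ≫ (G.map j j' ⊗ₘ φ j') ≫ eComp V _ _ _

/-- The maps `ι j : W j ⟶ C(G j, L)` exhibit `L` as the colimit `∫^j W j ⊗ G j` of `G` weighted
by `W`: they are `V`-natural, and for all `X` they exhibit `C(L, X)` as the `V`-object
`∫ j, [W j, C(G j, X)]` of `V`-natural transformations. -/
structure IsWeightedColimit {J : Type u₁} [EnrichedCategory V J] {C : Type u₂}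
    [EnrichedCategory V C] (W : Presheaf V J) (G : EnrichedFunctor V J C) (L : C)
    (ι : ∀ j : J, W.obj (op j) ⟶ (G.obj j ⟶[V] L)) : Prop where
  natural (j j' : J) : W.act j j' ≫ ι j = (G.map j j' ⊗ₘ ι j') ≫ eComp V _ _ _
  existsUnique (Z : V) (X : C) (φ : ∀ j : J, W.obj (op j) ⊗ Z ⟶ (G.obj j ⟶[V] X))
    (hφ : IsGradedCocone W G Z X φ) :
    ∃! u : Z ⟶ (L ⟶[V] X), ∀ j, (ι j ⊗ₘ u) ≫ eComp V _ _ _ = φ j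

variable (V) in
/-- `C` has all colimits weighted by presheaves on small `V`-categories. -/
def IsCocomplete (C : Type u₂) [EnrichedCategory V C] : Prop :=
  ∀ (J : Type w) [EnrichedCategory V J] (W : Presheaf V J) (G : EnrichedFunctor V J C),
    ∃ (L : C) (ι : ∀ j : J, W.obj (op j) ⟶ (G.obj j ⟶[V] L)), IsWeightedColimit W G L ι

/-- The `V`-functor `F` preserves all colimits weighted by presheaves on small `V`-categories. -/
def PreservesWeightedColimits {C : Type u₁} [EnrichedCategory V C] {D : Type u₂}
    [EnrichedCategory V D] (F : EnrichedFunctor V C D) : Prop :=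
  ∀ (J : Type w) [EnrichedCategory V J] (W : Presheaf V J) (G : EnrichedFunctor V J C)
    (L : C) (ι : ∀ j : J, W.obj (op j) ⟶ (G.obj j ⟶[V] L)), IsWeightedColimit W G L ι →
      IsWeightedColimit W (G.comp V F) (F.obj L) (fun j => ι j ≫ F.map (G.obj j) L)

/-- The maps `η a : G a ⟶ K (τ a)` exhibit `K` as the pointwise left Kan extension of `G` along
`τ`, that is `K b = ∫^a T(τ a, b) ⊗ G a` for all `b`. -/
def IsPointwiseLeftKan {S : Type u₁} [EnrichedCategory V S] {T : Type u₂} [EnrichedCategory V T]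
    {C : Type u} [Category.{v₃} C] [EnrichedOrdinaryCategory V C] (τ : EnrichedFunctor V S T)
    (G : EnrichedFunctor V S C) (K : EnrichedFunctor V T C)
    (η : ∀ a : S, G.obj a ⟶ K.obj (τ.obj a)) : Prop :=
  ∀ b : T, IsWeightedColimit ((representable b).restrict τ) G (K.obj b)
    (fun a => K.map (τ.obj a) b ≫ eHomWhiskerRight V (η a) (K.obj b))

end Presheaf

section Adjunction

variable {V : Type v} [Category.{w} V] [MonoidalCategory V]

/-- A `V`-adjunction `L ⊣ R`: an adjunction between the underlying functors whose unit and counit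
are `V`-natural. -/
structure VAdjunction {X : Type u₁} [EnrichedCategory V X] {Y : Type u₂} [EnrichedCategory V Y]
    (L : EnrichedFunctor V X Y) (R : EnrichedFunctor V Y X) where
  /-- The underlying adjunction. -/
  adj : L.forget ⊣ R.forget
  unit_vnatural : IsVNatural V (EnrichedFunctor.id V X) (L.comp V R)
    (fun x => ForgetEnrichment.homTo V (adj.unit.app (ForgetEnrichment.of V x)))
  counit_vnatural : IsVNatural V (R.comp V L) (EnrichedFunctor.id V Y)
    (fun y => ForgetEnrichment.homTo V (adj.counit.app (ForgetEnrichment.of V y)))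

end Adjunction

/-! ### Patterns -/

section Pattern

open MonoidalClosed SymmetricMonoidalEnriched Functor.LaxMonoidal Functor.OplaxMonoidal

variable {V : Type v} [Category.{w} V] [MonoidalCategory V] [SymmetricCategory V]

section

variable {C : Type u} [Category.{v₃} C] [EnrichedOrdinaryCategory V C]
    [MonoidalCategory C] [SymmetricCategory C] [SymmetricMonoidalEnriched V C]

/-- The `V`-functor `A ⊗ -`. -/
def tensorLeftV (A : C) : EnrichedFunctor V C C where
  obj X := A ⊗ X
  map X Y := (λ_ _).inv ≫ (eId V A ▷ _) ≫ tensorMap A A X Y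
  map_id X := by
    rw [MonoidalCategory.leftUnitor_inv_naturality_assoc,
      ← reassoc_of% MonoidalCategory.tensorHom_def', ← eHomEquiv_id, ← eHomEquiv_id,
      tensorMap_homEquiv, MonoidalCategory.id_tensorHom_id, eHomEquiv_id]
  map_comp X Y Z := by
    have h1 : (eId V A ⊗ₘ eId V A) ≫ eComp V A A A = (λ_ (𝟙_ V)).hom ≫ eId V A :=
      eId_tensor_eComp _
    have h2 := leftUnitor_monoidal (X ⟶[V] Y) (Y ⟶[V] Z)
    have h3 : ((λ_ (X ⟶[V] Y)).inv ⊗ₘ (λ_ (Y ⟶[V] Z)).inv) ≫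
        tensorμ (𝟙_ V) (X ⟶[V] Y) (𝟙_ V) (Y ⟶[V] Z) ≫ ((λ_ (𝟙_ V)).hom ▷ _) =
          (λ_ _).inv := by
      rw [← cancel_mono (λ_ _).hom, Category.assoc, Category.assoc, ← h2,
        MonoidalCategory.tensorHom_comp_tensorHom]
      simp
    simp only [← MonoidalCategory.tensorHom_comp_tensorHom, Category.assoc]
    rw [tensorMap_comp, ← MonoidalCategory.tensorHom_id, ← MonoidalCategory.tensorHom_id,
      ← MonoidalCategory.tensorHom_id,
      reassoc_of% tensorμ_natural, MonoidalCategory.tensorHom_comp_tensorHom_assoc, h1,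
      MonoidalCategory.id_tensorHom_id, Category.id_comp,
      ← MonoidalCategory.whiskerRight_comp_tensorHom, Category.assoc, reassoc_of% h3,
      MonoidalCategory.leftUnitor_inv_naturality_assoc,
      MonoidalCategory.whiskerLeft_comp_tensorHom_assoc, Category.comp_id]

/-- The `V`-functor `- ⊗ A`. -/
def tensorRightV (A : C) : EnrichedFunctor V C C where
  obj X := X ⊗ A
  map X Y := (ρ_ _).inv ≫ (_ ◁ eId V A) ≫ tensorMap X Y A A
  map_id X := by
    rw [MonoidalCategory.rightUnitor_inv_naturality_assoc,
      ← reassoc_of% MonoidalCategory.tensorHom_def, ← eHomEquiv_id, ← eHomEquiv_id,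
      ← unitors_inv_equal, tensorMap_homEquiv, MonoidalCategory.id_tensorHom_id, eHomEquiv_id]
  map_comp X Y Z := by
    have h1 : (eId V A ⊗ₘ eId V A) ≫ eComp V A A A = (λ_ (𝟙_ V)).hom ≫ eId V A :=
      eId_tensor_eComp _
    have h2 := rightUnitor_monoidal (X ⟶[V] Y) (Y ⟶[V] Z)
    have h3 : ((ρ_ (X ⟶[V] Y)).inv ⊗ₘ (ρ_ (Y ⟶[V] Z)).inv) ≫
        tensorμ (X ⟶[V] Y) (𝟙_ V) (Y ⟶[V] Z) (𝟙_ V) ≫ (_ ◁ (λ_ (𝟙_ V)).hom) =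
          (ρ_ _).inv := by
      rw [← cancel_mono (ρ_ _).hom, Category.assoc, Category.assoc, ← h2,
        MonoidalCategory.tensorHom_comp_tensorHom]
      simp
    simp only [← MonoidalCategory.tensorHom_comp_tensorHom, Category.assoc]
    rw [tensorMap_comp, ← MonoidalCategory.id_tensorHom, ← MonoidalCategory.id_tensorHom,
      ← MonoidalCategory.id_tensorHom,
      reassoc_of% tensorμ_natural, MonoidalCategory.tensorHom_comp_tensorHom_assoc, h1,
      MonoidalCategory.id_tensorHom_id, Category.id_comp,
      ← MonoidalCategory.whiskerLeft_comp_tensorHom, Category.assoc, reassoc_of% h3,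
      MonoidalCategory.rightUnitor_inv_naturality_assoc,
      MonoidalCategory.whiskerRight_comp_tensorHom_assoc, Category.comp_id]

end

variable [MonoidalClosed V] [HasColimits V]

section

variable {A : Type w} [Category.{v₁} A] [EnrichedOrdinaryCategory V A]
    [MonoidalCategory A] [SymmetricCategory A] [SymmetricMonoidalEnriched V A]

/-- The two families of maps whose joint coequalizer is the coend
`∫^(a, b) A(c, a ⊗ b) ⊗ (P a ⊗ Q b)`. -/
def dayIndex (P Q : Presheaf V A) (c : A) :
    MultispanIndex
      ({ L := (A × A) × (A × A), R := A × A, fst := Prod.fst, snd := Prod.snd } :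
        MultispanShape.{w, w}) V where
  left p := (c ⟶[V] (p.1.1 ⊗ p.1.2 : A)) ⊗
    (((p.1.1 ⟶[V] p.2.1) ⊗ (p.1.2 ⟶[V] p.2.2)) ⊗ (P.obj (op p.2.1) ⊗ Q.obj (op p.2.2)))
  right p := (c ⟶[V] (p.1 ⊗ p.2 : A)) ⊗ (P.obj (op p.1) ⊗ Q.obj (op p.2))
  fst p := _ ◁ (tensorμ _ _ _ _ ≫ (P.act p.1.1 p.2.1 ⊗ₘ Q.act p.1.2 p.2.2))
  snd p := (α_ _ _ _).inv ≫ (((_ ◁ tensorMap p.1.1 p.2.1 p.1.2 p.2.2) ≫ eComp V _ _ _) ▷ _)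

/-- The value at `c` of the convolution `P ∗ Q = ∫^(a, b) A(-, a ⊗ b) ⊗ P a ⊗ Q b` of the
presheaves `P` and `Q`. -/
def convolution (P Q : Presheaf V A) (c : A) : V := multicoequalizer (dayIndex P Q c)

/-- The coprojection `A(c, a ⊗ b) ⊗ (P a ⊗ Q b) ⟶ (P ∗ Q) c`. -/
def convolutionπ (P Q : Presheaf V A) (c a b : A) :
    (c ⟶[V] (a ⊗ b : A)) ⊗ (P.obj (op a) ⊗ Q.obj (op b)) ⟶ convolution P Q c :=
  Multicoequalizer.π (dayIndex P Q c) (a, b)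

lemma convolution_condition (P Q : Presheaf V A) (c a b a' b' : A) :
    (_ ◁ (tensorμ _ _ _ _ ≫ (P.act a a' ⊗ₘ Q.act b b'))) ≫ convolutionπ P Q c a b =
      (α_ _ _ _).inv ≫ (((_ ◁ tensorMap a a' b b') ≫ eComp V _ _ _) ▷ _) ≫
        convolutionπ P Q c a' b' := by
  have h := Multicoequalizer.condition (dayIndex P Q c) ((a, b), (a', b'))
  refine h.trans ?_
  exact Category.assoc _ _ _

end

variable {S : Type w} [Category.{v₁} S] [EnrichedOrdinaryCategory V S]
    [MonoidalCategory S] [SymmetricCategory S] [SymmetricMonoidalEnriched V S]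
  {T : Type w} [Category.{v₂} T] [EnrichedOrdinaryCategory V T]
    [MonoidalCategory T] [SymmetricCategory T] [SymmetricMonoidalEnriched V T]

/-- The map `S(c, a ⊗ b) ⊗ (P (τ a) ⊗ Q (τ b)) ⟶ T(τ c, τ a ⊗ τ b) ⊗ (P (τ a) ⊗ Q (τ b))`
followed by the coprojection to `(P ∗ Q) (τ c)`. -/
def comparisonAux (τ : SymmetricMonoidalVFunctor V S T) (P Q : Presheaf V T) (c a b : S) :
    (c ⟶[V] (a ⊗ b : S)) ⊗ (P.obj (op (τ.functor.obj a)) ⊗ Q.obj (op (τ.functor.obj b))) ⟶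
      convolution P Q (τ.functor.obj c) :=
  ((τ.functor.map c (a ⊗ b) ≫ eHomWhiskerLeft V _ (δ (ordinary τ.functor) a b)) ▷ _) ≫
    convolutionπ P Q (τ.functor.obj c) (τ.functor.obj a) (τ.functor.obj b)

lemma tensorμ_whiskerRight_comp {A A' B B' X Y X' Y' : V} (f : A ⟶ A') (g : B ⟶ B')
    (p : A' ⊗ X ⟶ X') (q : B' ⊗ Y ⟶ Y') :
    tensorμ A B X Y ≫ ((f ▷ X ≫ p) ⊗ₘ (g ▷ Y ≫ q)) =
      ((f ⊗ₘ g) ▷ (X ⊗ Y)) ≫ tensorμ A' B' X Y ≫ (p ⊗ₘ q) := by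
  rw [← MonoidalCategory.tensorHom_comp_tensorHom, tensorμ_natural_left_assoc]

lemma whisker_comparison {H H' L L' W W₀ E E' Z : V} (k : H ⟶ H') (f : L ⟶ L')
    (act : L' ⊗ W ⟶ W₀) (m' : H' ⊗ L' ⟶ E') (π₀ : H' ⊗ W₀ ⟶ Z) (π₁ : E' ⊗ W ⟶ Z)
    (m : H ⊗ L ⟶ E) (k' : E ⟶ E') (cond : H' ◁ act ≫ π₀ = (α_ _ _ _).inv ≫ m' ▷ W ≫ π₁)
    (core : (k ⊗ₘ f) ≫ m' = m ≫ k') :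
    H ◁ (f ▷ W ≫ act) ≫ k ▷ W₀ ≫ π₀ = ((α_ _ _ _).inv ≫ m ▷ W) ≫ k' ▷ W ≫ π₁ := by
  rw [Category.assoc, ← MonoidalCategory.comp_whiskerRight_assoc m, ← core,
    MonoidalCategory.comp_whiskerRight_assoc, MonoidalCategory.whiskerLeft_comp,
    Category.assoc, MonoidalCategory.whisker_exchange_assoc, cond,
    MonoidalCategory.tensorHom_def']
  simp

lemma map_tensorMap_δ (τ : SymmetricMonoidalVFunctor V S T) (a b a' b' : S) :
    (τ.functor.map a a' ⊗ₘ τ.functor.map b b') ≫ tensorMap _ _ _ _ ≫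
        eHomWhiskerRight V (δ (ordinary τ.functor) a b) _ =
      tensorMap a a' b b' ≫ τ.functor.map _ _ ≫
        eHomWhiskerLeft V _ (δ (ordinary τ.functor) a' b') := by
  have h := τ.str.μ_natural a a' b b'
  have h' := congrArg (fun k => k ≫ eHomWhiskerLeft V _ (δ (ordinary τ.functor) a' b') ≫
    eHomWhiskerRight V (δ (ordinary τ.functor) a b) _) h
  simp only [Category.assoc] at h'
  rw [← eHomWhiskerLeft_comp_assoc, Functor.Monoidal.μ_δ, eHomWhiskerLeft_id, Category.id_comp,
    eHom_whisker_exchange, ← eHomWhiskerRight_comp_assoc, Functor.Monoidal.δ_μ,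
    eHomWhiskerRight_id, Category.id_comp] at h'
  exact h'

lemma comparisonAux_condition (τ : SymmetricMonoidalVFunctor V S T) (P Q : Presheaf V T)
    (c a b a' b' : S) :
    (_ ◁ (tensorμ _ _ _ _ ≫
      ((P.restrict τ.functor).act a a' ⊗ₘ (Q.restrict τ.functor).act b b'))) ≫
        comparisonAux τ P Q c a b =
      ((α_ _ _ _).inv ≫ (((_ ◁ tensorMap a a' b b') ≫ eComp V _ _ _) ▷ _)) ≫
        comparisonAux τ P Q c a' b' := by
  have core : ((τ.functor.map c (a ⊗ b) ≫ eHomWhiskerLeft V _ (δ (ordinary τ.functor) a b)) ⊗ₘ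
        ((τ.functor.map a a' ⊗ₘ τ.functor.map b b') ≫ tensorMap _ _ _ _)) ≫ eComp V _ _ _ =
      (_ ◁ tensorMap a a' b b') ≫ eComp V c (a ⊗ b) (a' ⊗ b') ≫ τ.functor.map c (a' ⊗ b') ≫
        eHomWhiskerLeft V _ (δ (ordinary τ.functor) a' b') := by
    rw [tensor_eComp_middle, Category.assoc, map_tensorMap_δ, reassoc_of% τ.functor.map_comp,
      eComp_eHomWhiskerLeft, MonoidalCategory.tensorHom_comp_whiskerLeft_assoc,
      MonoidalCategory.whiskerLeft_comp_tensorHom_assoc]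
  have core' := (MonoidalCategory.tensorHom_comp_whiskerLeft_assoc (τ.functor.map c (a ⊗ b) ≫
    eHomWhiskerLeft V _ (δ (ordinary τ.functor) a b)) (τ.functor.map a a' ⊗ₘ τ.functor.map b b')
      (tensorMap (τ.functor.obj a) (τ.functor.obj a') (τ.functor.obj b) (τ.functor.obj b'))
        (eComp V _ _ _)).trans core
  have hact : tensorμ (a ⟶[V] a') (b ⟶[V] b') _ _ ≫
      ((P.restrict τ.functor).act a a' ⊗ₘ (Q.restrict τ.functor).act b b') =
      ((τ.functor.map a a' ⊗ₘ τ.functor.map b b') ▷ _) ≫ tensorμ _ _ _ _ ≫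
        (P.act (τ.functor.obj a) (τ.functor.obj a') ⊗ₘ
          Q.act (τ.functor.obj b) (τ.functor.obj b')) :=
    (congrArg₂ (fun x y => tensorμ (a ⟶[V] a') (b ⟶[V] b') _ _ ≫ (x ⊗ₘ y))
      (P.restrict_act τ.functor a a') (Q.restrict_act τ.functor b b')).trans
        (tensorμ_whiskerRight_comp _ _ _ _)
  have hcond := convolution_condition P Q (τ.functor.obj c) (τ.functor.obj a) (τ.functor.obj b)
    (τ.functor.obj a') (τ.functor.obj b')
  refine (congrArg (fun k => _ ◁ k ≫ comparisonAux τ P Q c a b) hact).trans ?_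
  exact whisker_comparison _ _ _ _ _ _ _ _ hcond (core'.trans (Category.assoc _ _ _).symm)

/-- The component at `c` of the canonical map `τ^P ∗ τ^Q ⟶ τ^(P ∗ Q)` that makes restriction of
presheaves along `τ` a lax symmetric monoidal functor. -/
def comparison (τ : SymmetricMonoidalVFunctor V S T) (P Q : Presheaf V T) (c : S) :
    convolution (P.restrict τ.functor) (Q.restrict τ.functor) c ⟶
      convolution P Q (τ.functor.obj c) :=
  Multicoequalizer.desc (dayIndex (P.restrict τ.functor) (Q.restrict τ.functor) c) _
    (fun p => comparisonAux τ P Q c p.1 p.2)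
    (fun p => comparisonAux_condition τ P Q c p.1.1 p.1.2 p.2.1 p.2.2)

/-- The component at `c` of the canonical map `S(-, 𝟙) ⟶ T(τ -, 𝟙)` between the units for
convolution that makes restriction of presheaves along `τ` a lax symmetric monoidal functor. -/
def comparisonUnit (τ : SymmetricMonoidalVFunctor V S T) (c : S) :
    (c ⟶[V] 𝟙_ S) ⟶ (τ.functor.obj c ⟶[V] 𝟙_ T) :=
  τ.functor.map c (𝟙_ S) ≫ eHomWhiskerLeft V _ (η (ordinary τ.functor))

/-- A symmetric monoidal `V`-functor `τ` between small symmetric monoidal `V`-categories is a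
`V`-pattern if restriction of presheaves along `τ`, with its canonical lax symmetric monoidal
structure for the convolution products, is (strong) symmetric monoidal. -/
structure IsPattern (τ : SymmetricMonoidalVFunctor V S T) : Prop where
  isIso_comparison (P Q : Presheaf V T) (c : S) : IsIso (comparison τ P Q c)
  isIso_comparisonUnit (c : S) : IsIso (comparisonUnit τ c)

end Pattern

/-! ### Adjunctions between symmetric monoidal `V`-functors -/

section InducedAdjunction

open Functor.LaxMonoidal

variable {V : Type v} [Category.{w} V] [MonoidalCategory V] [SymmetricCategory V]

/-- A family of maps `F a ⟶ G a` is compatible with the symmetric monoidal structures of `F`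
and `G`. -/
structure IsMonoidalFamily {S : Type u₁} [Category.{v₁} S] [EnrichedOrdinaryCategory V S]
    [MonoidalCategory S] [SymmetricCategory S] [SymmetricMonoidalEnriched V S]
    {C : Type u} [Category.{v₃} C] [EnrichedOrdinaryCategory V C]
    [MonoidalCategory C] [SymmetricCategory C] [SymmetricMonoidalEnriched V C]
    (F G : SymmetricMonoidalVFunctor V S C) (φ : ∀ a : S, F.functor.obj a ⟶ G.functor.obj a) :
    Prop where
  unit : ε (ordinary F.functor) ≫ φ (𝟙_ S) = ε (ordinary G.functor)
  tensor (a b : S) : μ (ordinary F.functor) a b ≫ φ (a ⊗ b) =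
    (φ a ⊗ₘ φ b) ≫ μ (ordinary G.functor) a b

variable [MonoidalClosed V] [HasLimits V]
  {S : Type w} [Category.{v₁} S] [EnrichedOrdinaryCategory V S]
    [MonoidalCategory S] [SymmetricCategory S] [SymmetricMonoidalEnriched V S]
  {T : Type w} [Category.{v₂} T] [EnrichedOrdinaryCategory V T]
    [MonoidalCategory T] [SymmetricCategory T] [SymmetricMonoidalEnriched V T]
  {C : Type u} [Category.{v₃} C] [EnrichedOrdinaryCategory V C]
    [MonoidalCategory C] [SymmetricCategory C] [SymmetricMonoidalEnriched V C]

/-- The component at `a` of the unit `G ⟶ τ^* (τ_* G)` of a `V`-adjunction `τ_* ⊣ τ^*`. -/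
def unitComponent {τ : EnrichedFunctor V S T}
    {L : EnrichedFunctor V (EnrichedFunctor V S C) (EnrichedFunctor V T C)}
    (adj : VAdjunction L (restriction τ C)) (G : EnrichedFunctor V S C) (a : S) :
    G.obj a ⟶ (L.obj G).obj (τ.obj a) :=
  (eHomEquiv V).symm
    (ForgetEnrichment.homTo V (adj.adj.unit.app (ForgetEnrichment.of V G)) ≫
      natProj G (τ.comp V (L.obj G)) a)

/-- The adjunction `adj₀ : L₀ ⊣ τ^*` between `[S, C]` and `[T, C]` induces an adjunction between
the ordinary categories of symmetric monoidal `V`-functors: there are an adjunction `L ⊣ τ^*`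
between these and an isomorphism between `L` and `L₀` on the underlying `V`-functors, through
which the unit and the counit of `L ⊣ τ^*` are given by those of `adj₀`. -/
def InducesAdjunction (τ : SymmetricMonoidalVFunctor V S T)
    (L₀ : EnrichedFunctor V (EnrichedFunctor V S C) (EnrichedFunctor V T C))
    (adj₀ : VAdjunction L₀ (restriction τ.functor C)) : Prop :=
  ∃ (L : SymmetricMonoidalVFunctor V S C ⥤ SymmetricMonoidalVFunctor V T C)
    (adj : L ⊣ restrictionMonoidal C τ)
    (e : L ⋙ forgetMonoidal T C ≅ forgetMonoidal S C ⋙ L₀.forget),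
    (∀ G : SymmetricMonoidalVFunctor V S C,
      (forgetMonoidal S C).map (adj.unit.app G) ≫
        (restriction τ.functor C).forget.map (e.hom.app G) =
          adj₀.adj.unit.app (ForgetEnrichment.of V G.functor)) ∧
    (∀ H : SymmetricMonoidalVFunctor V T C,
      e.hom.app (τ.comp H) ≫ adj₀.adj.counit.app (ForgetEnrichment.of V H.functor) =
        (forgetMonoidal T C).map (adj.counit.app H))

/-- For cartesian `V`, the `V`-adjunction `adj₀ : L₀ ⊣ τ^*` between `[S, C]` and `[T, C]` induces
a `V`-adjunction between the `V`-categories of symmetric monoidal `V`-functors: there are a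
`V`-adjunction `L ⊣ τ^*` between these and a `V`-natural isomorphism between `L` and `L₀` on the
underlying `V`-functors, through which the unit and the counit of `L ⊣ τ^*` are given by those of
`adj₀`. -/
def InducesVAdjunction [IsCartesianMonoidal V] (τ : SymmetricMonoidalVFunctor V S T)
    (L₀ : EnrichedFunctor V (EnrichedFunctor V S C) (EnrichedFunctor V T C))
    (adj₀ : VAdjunction L₀ (restriction τ.functor C)) : Prop :=
  ∃ (L : EnrichedFunctor V (SymmetricMonoidalVFunctor V S C) (SymmetricMonoidalVFunctor V T C))
    (adj : VAdjunction L (restrictionMonoidalV C τ))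
    (e : L.forget ⋙ (forgetMonoidalV V T C).forget ≅ (forgetMonoidalV V S C).forget ⋙ L₀.forget),
    IsVNatural V (L.comp V (forgetMonoidalV V T C)) ((forgetMonoidalV V S C).comp V L₀)
      (fun G => ForgetEnrichment.homTo V (e.hom.app (ForgetEnrichment.of V G))) ∧
    (∀ G : SymmetricMonoidalVFunctor V S C,
      (forgetMonoidalV V S C).forget.map (adj.adj.unit.app (ForgetEnrichment.of V G)) ≫
        (restriction τ.functor C).forget.map (e.hom.app (ForgetEnrichment.of V G)) =
          adj₀.adj.unit.app (ForgetEnrichment.of V G.functor)) ∧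
    (∀ H : SymmetricMonoidalVFunctor V T C,
      e.hom.app (ForgetEnrichment.of V (τ.comp H)) ≫
          adj₀.adj.counit.app (ForgetEnrichment.of V H.functor) =
        (forgetMonoidalV V T C).forget.map (adj.adj.counit.app (ForgetEnrichment.of V H)))

end InducedAdjunction

end EnrichedPattern

end

open EnrichedPattern

/-!
Call a map `P ⟶ (x ⟶[V] y)` in `V` a `P`-graded morphism `x ⟶ y`. Graded morphisms are composed
(`⋆ᵍ`) and tensored (`⊠ᵍ`) like ordinary ones, so that universal properties in the `V`-category `C`
can be stated and used by testing on coprojections. For a left Kan extension `K` of `G` along `τ`,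
with unit `η`, the coprojections are the graded morphisms `kanι η a b : G a ⟶ K b` of degree
`T(τ a, b)`. They are jointly epic, and remain so after applying cocontinuous `V`-functors; hence
so are the `kanι η a b ⊠ᵍ kanι η a' b'` into `K b ⊗ K b'` (`IsStablyEpic.tensor`).

Cocompleteness of `C` provides pointwise left Kan extensions, and these are universal arrows to
restriction in the graded sense (`isUniversalArrow_of_isPointwiseLeftKan`), from which the
`V`-adjunction follows formally (`IsUniversalArrow.vAdjunction`).

Let `G` be symmetric monoidal. As `K b ⊗ K b'` is a colimit in two variables, tensoring maps out of
`τ a` and `τ a'` and applying the structure of `G` induces maps `K b ⊗ K b' ⟶ K (b ⊗ b')`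
(`exists_isTensorator`), with `𝟙 ⟶ G 𝟙 ⟶ K (τ 𝟙) ⟶ K 𝟙` as the unit (`kanUnit`). The unit `η` is
monoidal for a structure on `K` exactly if it consists of these maps (`isMonoidalFamily_comp_iff`),
which gives uniqueness; the axioms hold because the coprojections are jointly epic. Only
invertibility needs that `τ` is a pattern. The convolution of the presheaves represented by `b` and
`b'` is represented by `b ⊗ b'`, so the pattern condition for these two presheaves says that
`T(τ c, b ⊗ b')` is the coend of `S(c, a ⊗ a') ⊗ (T(τ a, b) ⊗ T(τ a', b'))`
(`IsPattern.exists_desc`, `IsPattern.hom_ext`). Thus `K (b ⊗ b')`, the colimit of `G c` weighted by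
`T(τ c, b ⊗ b')`, is the colimit of `G (a ⊗ a') ≅ G a ⊗ G a'` weighted by `T(τ a, b) ⊗ T(τ a', b')`,
which is `K b ⊗ K b'` (`IsTensorator.isIso`). The unit is treated in the same way
(`isIso_kanUnit`).

Finally, a transformation out of `K` is monoidal as soon as its restriction along `η` is
(`IsComonoidalFamily.of_restrict`). This is proved for graded transformations with respect to an
arbitrary comultiplication and counit on the degree, which covers both the ordinary adjunction and,
with the diagonal, the enriched one for cartesian `V`. So `η` is a universal arrow between symmetric
monoidal `V`-functors as well. The resulting adjunction has the same unit as the one between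
`V`-functors, and an adjunction is determined by its unit (`exists_iso_of_unit`).
-/

noncomputable section

namespace EnrichedPattern

open MonoidalClosed SymmetricMonoidalEnriched Functor.LaxMonoidal Functor.OplaxMonoidal

/-! ### Graded morphisms -/

section GradedMorphisms

variable {V : Type v} [Category.{w} V] [MonoidalCategory V]

/-- The composite of a `P`-graded morphism `x ⟶ y` (a map `P ⟶ (x ⟶[V] y)` in `V`) and a `Q`-graded
morphism `y ⟶ z`, as a `P ⊗ Q`-graded morphism `x ⟶ z`. -/
def gradedComp {C : Type u₁} [EnrichedCategory V C] {P Q : V} {x y z : C}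
    (f : P ⟶ (x ⟶[V] y)) (g : Q ⟶ (y ⟶[V] z)) : P ⊗ Q ⟶ (x ⟶[V] z) :=
  (f ⊗ₘ g) ≫ eComp V _ _ _

infixr:81 " ⋆ᵍ " => gradedComp

section

variable {C : Type u₁} [EnrichedCategory V C] {P P' Q Q' R : V} {x y z t : C}

lemma comp_gradedComp_comp (p : P' ⟶ P) (q : Q' ⟶ Q) (f : P ⟶ (x ⟶[V] y)) (g : Q ⟶ (y ⟶[V] z)) :
    (p ≫ f) ⋆ᵍ (q ≫ g) = (p ⊗ₘ q) ≫ f ⋆ᵍ g := by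
  simp [gradedComp]

lemma comp_gradedComp (p : P' ⟶ P) (f : P ⟶ (x ⟶[V] y)) (g : Q ⟶ (y ⟶[V] z)) :
    (p ≫ f) ⋆ᵍ g = p ▷ Q ≫ f ⋆ᵍ g := by
  rw [gradedComp, gradedComp, MonoidalCategory.whiskerRight_comp_tensorHom_assoc]

lemma gradedComp_comp (q : Q' ⟶ Q) (f : P ⟶ (x ⟶[V] y)) (g : Q ⟶ (y ⟶[V] z)) :
    f ⋆ᵍ (q ≫ g) = P ◁ q ≫ f ⋆ᵍ g := by
  rw [gradedComp, gradedComp, MonoidalCategory.whiskerLeft_comp_tensorHom_assoc]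

lemma gradedComp_eq_whiskerRight (f : P ⟶ (x ⟶[V] y)) :
    f ⋆ᵍ 𝟙 (y ⟶[V] z) = f ▷ _ ≫ eComp V _ _ _ := by
  simp [gradedComp]

lemma id_gradedComp_id : 𝟙 (x ⟶[V] y) ⋆ᵍ 𝟙 (y ⟶[V] z) = eComp V _ _ _ := by
  simp [gradedComp]

variable [SymmetricCategory V]

lemma gradedComp_assoc (f : P ⟶ (x ⟶[V] y)) (g : Q ⟶ (y ⟶[V] z)) (h : R ⟶ (z ⟶[V] t)) :
    (f ⋆ᵍ g) ⋆ᵍ h = (α_ _ _ _).hom ≫ f ⋆ᵍ g ⋆ᵍ h :=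
  tensor_eComp_assoc f g h

lemma gradedComp_assoc' (f : P ⟶ (x ⟶[V] y)) (g : Q ⟶ (y ⟶[V] z)) (h : R ⟶ (z ⟶[V] t)) :
    f ⋆ᵍ g ⋆ᵍ h = (α_ _ _ _).inv ≫ (f ⋆ᵍ g) ⋆ᵍ h := by
  rw [gradedComp_assoc, Iso.inv_hom_id_assoc]

lemma eId_gradedComp (f : P ⟶ (x ⟶[V] y)) : eId V x ⋆ᵍ f = (λ_ P).hom ≫ f :=
  eId_tensor_eComp f

lemma gradedComp_eId (f : P ⟶ (x ⟶[V] y)) : f ⋆ᵍ eId V y = (ρ_ P).hom ≫ f :=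
  tensor_eId_eComp f

lemma gradedComp_map {D : Type u₂} [EnrichedCategory V D] (F : EnrichedFunctor V C D)
    (f : P ⟶ (x ⟶[V] y)) (g : Q ⟶ (y ⟶[V] z)) :
    (f ⋆ᵍ g) ≫ F.map _ _ = (f ≫ F.map _ _) ⋆ᵍ (g ≫ F.map _ _) := by
  simp [gradedComp]

end

section

variable [SymmetricCategory V] {C : Type u₁} [Category.{v₁} C] [EnrichedOrdinaryCategory V C]
  {P P' Q Q' R : V} {x y z t : C}

lemma gradedComp_post (f : P ⟶ (x ⟶[V] y)) (g : Q ⟶ (y ⟶[V] z)) (h : z ⟶ t) :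
    f ⋆ᵍ (g ≫ eHomWhiskerLeft V _ h) = f ⋆ᵍ g ≫ eHomWhiskerLeft V _ h := by
  rw [gradedComp, gradedComp, Category.assoc, eComp_eHomWhiskerLeft,
    MonoidalCategory.tensorHom_comp_whiskerLeft_assoc]

lemma pre_gradedComp (h : t ⟶ x) (f : P ⟶ (x ⟶[V] y)) (g : Q ⟶ (y ⟶[V] z)) :
    (f ≫ eHomWhiskerRight V h _) ⋆ᵍ g = f ⋆ᵍ g ≫ eHomWhiskerRight V h _ := by
  rw [gradedComp, gradedComp, Category.assoc, eComp_eHomWhiskerRight,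
    MonoidalCategory.tensorHom_comp_whiskerRight_assoc]

lemma post_gradedComp (f : P ⟶ (x ⟶[V] y)) (h : y ⟶ z) (g : Q ⟶ (z ⟶[V] t)) :
    (f ≫ eHomWhiskerLeft V _ h) ⋆ᵍ g = f ⋆ᵍ (g ≫ eHomWhiskerRight V h _) :=
  tensor_eComp_middle f h g

lemma eHomEquiv_gradedComp (f : x ⟶ y) (g : P ⟶ (y ⟶[V] z)) :
    eHomEquiv V f ⋆ᵍ g = (λ_ P).hom ≫ g ≫ eHomWhiskerRight V f _ :=
  eHomEquiv_tensor_eComp f g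

lemma gradedComp_eHomEquiv (g : P ⟶ (x ⟶[V] y)) (f : y ⟶ z) :
    g ⋆ᵍ eHomEquiv V f = (ρ_ P).hom ≫ g ≫ eHomWhiskerLeft V _ f :=
  tensor_eHomEquiv_eComp g f

end

section

variable [SymmetricCategory V] {C : Type u₁} [Category.{v₁} C] [EnrichedOrdinaryCategory V C]
  [MonoidalCategory C] [SymmetricCategory C] [SymmetricMonoidalEnriched V C]
  {P P' Q Q' R R' : V} {x x' x'' y y' y'' z z' : C}

/-- The tensor product of a `P`-graded morphism `x ⟶ x'` and a `Q`-graded morphism `y ⟶ y'`, as a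
`P ⊗ Q`-graded morphism `x ⊗ y ⟶ x' ⊗ y'`. -/
def gradedTensor (f : P ⟶ (x ⟶[V] x')) (g : Q ⟶ (y ⟶[V] y')) :
    P ⊗ Q ⟶ ((x ⊗ y : C) ⟶[V] (x' ⊗ y' : C)) :=
  (f ⊗ₘ g) ≫ tensorMap _ _ _ _

infixr:81 " ⊠ᵍ " => gradedTensor

lemma comp_gradedTensor_comp (p : P' ⟶ P) (q : Q' ⟶ Q) (f : P ⟶ (x ⟶[V] x'))
    (g : Q ⟶ (y ⟶[V] y')) : (p ≫ f) ⊠ᵍ (q ≫ g) = (p ⊗ₘ q) ≫ f ⊠ᵍ g := by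
  simp [gradedTensor]

lemma comp_gradedTensor (p : P' ⟶ P) (f : P ⟶ (x ⟶[V] x')) (g : Q ⟶ (y ⟶[V] y')) :
    (p ≫ f) ⊠ᵍ g = p ▷ Q ≫ f ⊠ᵍ g := by
  rw [gradedTensor, gradedTensor, MonoidalCategory.whiskerRight_comp_tensorHom_assoc]

lemma gradedTensor_comp (q : Q' ⟶ Q) (f : P ⟶ (x ⟶[V] x')) (g : Q ⟶ (y ⟶[V] y')) :
    f ⊠ᵍ (q ≫ g) = P ◁ q ≫ f ⊠ᵍ g := by
  rw [gradedTensor, gradedTensor, MonoidalCategory.whiskerLeft_comp_tensorHom_assoc]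

lemma id_gradedTensor_id : 𝟙 (x ⟶[V] x') ⊠ᵍ 𝟙 (y ⟶[V] y') = tensorMap _ _ _ _ := by
  simp [gradedTensor]

/-- The interchange law. -/
lemma gradedTensor_gradedComp (f : P ⟶ (x ⟶[V] x')) (g : Q ⟶ (y ⟶[V] y'))
    (f' : P' ⟶ (x' ⟶[V] x'')) (g' : Q' ⟶ (y' ⟶[V] y'')) :
    (f ⊠ᵍ g) ⋆ᵍ (f' ⊠ᵍ g') = tensorμ P Q P' Q' ≫ (f ⋆ᵍ f') ⊠ᵍ (g ⋆ᵍ g') := by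
  simp only [gradedTensor, gradedComp]
  rw [← MonoidalCategory.tensorHom_comp_tensorHom, Category.assoc, tensorMap_comp,
    reassoc_of% tensorμ_natural, MonoidalCategory.tensorHom_comp_tensorHom_assoc]

lemma gradedTensor_eHomEquiv (f : x ⟶ x') (g : y ⟶ y') :
    eHomEquiv V f ⊠ᵍ eHomEquiv V g = (λ_ _).hom ≫ eHomEquiv V (f ⊗ₘ g) := by
  rw [← tensorMap_homEquiv, Iso.hom_inv_id_assoc, gradedTensor]

instance (W X Y Z : V) : IsIso (tensorμ W X Y Z) :=
  ⟨tensorδ W X Y Z, tensorμ_tensorδ W X Y Z, tensorδ_tensorμ W X Y Z⟩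

lemma gradedTensor_post (f : P ⟶ (x ⟶[V] x')) (g : Q ⟶ (y ⟶[V] y')) (h : x' ⟶ x'')
    (k : y' ⟶ y'') :
    (f ≫ eHomWhiskerLeft V _ h) ⊠ᵍ (g ≫ eHomWhiskerLeft V _ k) =
      f ⊠ᵍ g ≫ eHomWhiskerLeft V _ (h ⊗ₘ k) := by
  have e := gradedTensor_gradedComp f g (eHomEquiv V h) (eHomEquiv V k)
  rw [gradedTensor_eHomEquiv, gradedComp_comp, gradedComp_eHomEquiv, gradedComp_eHomEquiv,
    gradedComp_eHomEquiv, comp_gradedTensor_comp, tensor_right_unitality, Category.assoc,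
    Category.assoc, MonoidalCategory.whiskerLeft_hom_inv_assoc] at e
  exact (cancel_epi _).1 ((cancel_epi _).1 e).symm

lemma gradedTensor_pre (f : P ⟶ (x' ⟶[V] x'')) (g : Q ⟶ (y' ⟶[V] y'')) (h : x ⟶ x')
    (k : y ⟶ y') :
    (f ≫ eHomWhiskerRight V h _) ⊠ᵍ (g ≫ eHomWhiskerRight V k _) =
      f ⊠ᵍ g ≫ eHomWhiskerRight V (h ⊗ₘ k) _ := by
  have e := gradedTensor_gradedComp (eHomEquiv V h) (eHomEquiv V k) f g
  rw [gradedTensor_eHomEquiv, comp_gradedComp, eHomEquiv_gradedComp, eHomEquiv_gradedComp,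
    eHomEquiv_gradedComp, comp_gradedTensor_comp, tensor_left_unitality, Category.assoc,
    Category.assoc, MonoidalCategory.hom_inv_whiskerRight_assoc] at e
  exact (cancel_epi _).1 ((cancel_epi _).1 e).symm

lemma gradedTensor_post_left (f : P ⟶ (x ⟶[V] x')) (g : Q ⟶ (y ⟶[V] y')) (h : x' ⟶ x'') :
    (f ≫ eHomWhiskerLeft V _ h) ⊠ᵍ g = f ⊠ᵍ g ≫ eHomWhiskerLeft V _ (h ▷ y') := by
  rw [← MonoidalCategory.tensorHom_id, ← gradedTensor_post, eHomWhiskerLeft_id, Category.comp_id]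

lemma gradedTensor_post_right (f : P ⟶ (x ⟶[V] x')) (g : Q ⟶ (y ⟶[V] y')) (k : y' ⟶ y'') :
    f ⊠ᵍ (g ≫ eHomWhiskerLeft V _ k) = f ⊠ᵍ g ≫ eHomWhiskerLeft V _ (x' ◁ k) := by
  rw [← MonoidalCategory.id_tensorHom, ← gradedTensor_post, eHomWhiskerLeft_id, Category.comp_id]

lemma gradedTensor_pre_left (f : P ⟶ (x' ⟶[V] x'')) (g : Q ⟶ (y ⟶[V] y')) (h : x ⟶ x') :
    (f ≫ eHomWhiskerRight V h _) ⊠ᵍ g = f ⊠ᵍ g ≫ eHomWhiskerRight V (h ▷ y) _ := by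
  rw [← MonoidalCategory.tensorHom_id, ← gradedTensor_pre, eHomWhiskerRight_id, Category.comp_id]

lemma gradedTensor_pre_right (f : P ⟶ (x ⟶[V] x')) (g : Q ⟶ (y' ⟶[V] y'')) (k : y ⟶ y') :
    f ⊠ᵍ (g ≫ eHomWhiskerRight V k _) = f ⊠ᵍ g ≫ eHomWhiskerRight V (x ◁ k) _ := by
  rw [← MonoidalCategory.id_tensorHom, ← gradedTensor_pre, eHomWhiskerRight_id, Category.comp_id]

lemma gradedTensor_braiding (f : P ⟶ (x ⟶[V] x')) (g : Q ⟶ (y ⟶[V] y')) :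
    f ⊠ᵍ g ≫ eHomWhiskerLeft V _ (β_ x' y').hom =
      (β_ P Q).hom ≫ g ⊠ᵍ f ≫ eHomWhiskerRight V (β_ x y).hom _ := by
  rw [gradedTensor, Category.assoc, braiding_natural, gradedTensor, Category.assoc,
    BraidedCategory.braiding_naturality_assoc]

lemma gradedTensor_associator (f : P ⟶ (x ⟶[V] x')) (g : Q ⟶ (y ⟶[V] y'))
    (h : R ⟶ (z ⟶[V] z')) :
    (f ⊠ᵍ g) ⊠ᵍ h ≫ eHomWhiskerLeft V _ (α_ x' y' z').hom =
      (α_ P Q R).hom ≫ f ⊠ᵍ (g ⊠ᵍ h) ≫ eHomWhiskerRight V (α_ x y z).hom _ := by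
  have e := associator_natural (V := V) x x' y y' z z'
  simp only [gradedTensor, Category.assoc]
  rw [← MonoidalCategory.tensorHom_comp_whiskerRight_assoc, e,
    ← MonoidalCategory.tensorHom_comp_whiskerLeft_assoc,
    MonoidalCategory.associator_naturality_assoc]

lemma eId_gradedTensor_leftUnitor (f : P ⟶ (x ⟶[V] x')) :
    eId V (𝟙_ C) ⊠ᵍ f ≫ eHomWhiskerLeft V _ (λ_ x').hom =
      (λ_ P).hom ≫ f ≫ eHomWhiskerRight V (λ_ x).hom _ := by
  have e := leftUnitor_natural (V := V) x x'
  rw [← e, MonoidalCategory.leftUnitor_inv_naturality_assoc, Iso.hom_inv_id_assoc, gradedTensor,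
    MonoidalCategory.tensorHom_def', Category.assoc, Category.assoc]

/-- The tensor product of the object `x` and a graded morphism `y ⟶ y'`. -/
def gradedWhiskerLeft (x : C) (g : Q ⟶ (y ⟶[V] y')) :
    Q ⟶ ((x ⊗ y : C) ⟶[V] (x ⊗ y' : C)) :=
  (λ_ Q).inv ≫ eId V x ⊠ᵍ g

/-- The tensor product of a graded morphism `x ⟶ x'` and the object `y`. -/
def gradedWhiskerRight (f : P ⟶ (x ⟶[V] x')) (y : C) :
    P ⟶ ((x ⊗ y : C) ⟶[V] (x' ⊗ y : C)) :=
  (ρ_ P).inv ≫ f ⊠ᵍ eId V y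

lemma comp_tensorLeftV_map (x : C) (g : Q ⟶ (y ⟶[V] y')) :
    g ≫ (tensorLeftV x).map y y' = gradedWhiskerLeft x g := by
  dsimp only [tensorLeftV, gradedWhiskerLeft]
  rw [MonoidalCategory.leftUnitor_inv_naturality_assoc, gradedTensor,
    MonoidalCategory.tensorHom_def', Category.assoc]

lemma comp_tensorRightV_map (y : C) (f : P ⟶ (x ⟶[V] x')) :
    f ≫ (tensorRightV y).map x x' = gradedWhiskerRight f y := by
  dsimp only [tensorRightV, gradedWhiskerRight]
  rw [MonoidalCategory.rightUnitor_inv_naturality_assoc, gradedTensor,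
    MonoidalCategory.tensorHom_def, Category.assoc]

lemma tensorμ_unit_unit (P Q : V) : tensorμ P (𝟙_ V) (𝟙_ V) Q = 𝟙 _ := by
  simp [tensorμ, ← unitors_equal]

lemma tensorμ_unit_swap (P Q : V) : tensorμ (𝟙_ V) Q P (𝟙_ V) =
    ((λ_ Q).hom ⊗ₘ (ρ_ P).hom) ≫ (β_ Q P).hom ≫ ((λ_ P).inv ⊗ₘ (ρ_ Q).inv) := by
  rw [tensorμ]
  monoidal

lemma gradedWhiskerRight_gradedComp_gradedWhiskerLeft (f : P ⟶ (x ⟶[V] x'))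
    (g : Q ⟶ (y ⟶[V] y')) : gradedWhiskerRight f y ⋆ᵍ gradedWhiskerLeft x' g = f ⊠ᵍ g := by
  rw [gradedWhiskerLeft, gradedWhiskerRight, comp_gradedComp_comp, gradedTensor_gradedComp,
    gradedComp_eId, eId_gradedComp, comp_gradedTensor_comp,
    tensorμ_unit_unit, Category.id_comp, MonoidalCategory.tensorHom_comp_tensorHom_assoc]
  simp

lemma gradedWhiskerLeft_gradedComp_gradedWhiskerRight (f : P ⟶ (x ⟶[V] x'))
    (g : Q ⟶ (y ⟶[V] y')) :
    gradedWhiskerLeft x g ⋆ᵍ gradedWhiskerRight f y' = (β_ Q P).hom ≫ f ⊠ᵍ g := by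
  rw [gradedWhiskerLeft, gradedWhiskerRight, comp_gradedComp_comp, gradedTensor_gradedComp,
    gradedComp_eId, eId_gradedComp, comp_gradedTensor_comp,
    tensorμ_unit_swap, Category.assoc, Category.assoc,
    MonoidalCategory.tensorHom_comp_tensorHom_assoc,
    MonoidalCategory.tensorHom_comp_tensorHom_assoc]
  simp

end

end GradedMorphisms

/-! ### Weighted colimits -/

section WeightedColimits

variable {V : Type v} [Category.{w} V] [MonoidalCategory V] [SymmetricCategory V]

/-- The graded morphisms `ι j : D j ⟶ L` detect equality of graded morphisms out of `L`. -/
def JointlyEpic {J : Type u₁} {C : Type u₂} [EnrichedCategory V C] {W : J → V} {D : J → C} {L : C}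
    (ι : ∀ j, W j ⟶ (D j ⟶[V] L)) : Prop :=
  ∀ ⦃Z : V⦄ ⦃X : C⦄ (f g : Z ⟶ (L ⟶[V] X)), (∀ j, ι j ⋆ᵍ f = ι j ⋆ᵍ g) → f = g

lemma JointlyEpic.hom_ext {J : Type u₁} {C : Type u₂} [Category.{v₂} C]
    [EnrichedOrdinaryCategory V C] {W : J → V} {D : J → C} {L : C}
    {ι : ∀ j, W j ⟶ (D j ⟶[V] L)} (h : JointlyEpic ι) {X : C} {f g : L ⟶ X}
    (e : ∀ j, ι j ≫ eHomWhiskerLeft V _ f = ι j ≫ eHomWhiskerLeft V _ g) : f = g := by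
  apply (eHomEquiv V).injective
  refine h _ _ fun j => ?_
  rw [gradedComp_eHomEquiv, gradedComp_eHomEquiv, e]

lemma JointlyEpic.comp {J : Type u₁} {J' : Type u₃} {C : Type u₂} [EnrichedCategory V C]
    {W : J → V} {D : J → C} {L : C} {ι : ∀ j, W j ⟶ (D j ⟶[V] L)} (h : JointlyEpic ι)
    {W' : J → J' → V} {D' : J → J' → C} {κ : ∀ j k, W' j k ⟶ (D' j k ⟶[V] D j)}
    (h' : ∀ j, JointlyEpic (κ j)) :
    JointlyEpic (fun p : J × J' => κ p.1 p.2 ⋆ᵍ ι p.1) := by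
  intro Z X f g e
  refine h _ _ fun j => h' j _ _ fun k => ?_
  rw [gradedComp_assoc', gradedComp_assoc', e (j, k)]

lemma JointlyEpic.of_epi_comp {J : Type u₁} {C : Type u₂} [EnrichedCategory V C]
    {W W' : J → V} {D : J → C} {L : C} {ι : ∀ j, W j ⟶ (D j ⟶[V] L)} (p : ∀ j, W' j ⟶ W j)
    (h : JointlyEpic (fun j => p j ≫ ι j)) : JointlyEpic ι := by
  intro Z X f g e
  refine h _ _ fun j => ?_
  rw [comp_gradedComp, comp_gradedComp, e]

variable [MonoidalClosed V]

lemma IsWeightedColimit.jointlyEpic {J : Type u₁} [EnrichedCategory V J] {C : Type u₂}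
    [EnrichedCategory V C] {W : Presheaf V J} {G : EnrichedFunctor V J C} {L : C}
    {ι : ∀ j : J, W.obj (op j) ⟶ (G.obj j ⟶[V] L)} (h : IsWeightedColimit W G L ι) :
    JointlyEpic ι := by
  intro Z X f g e
  refine (h.existsUnique Z X (fun j => ι j ⋆ᵍ f) fun j j' => ?_).unique (fun j => rfl)
    (fun j => (e j).symm)
  have h1 := h.natural j j'
  have h2 : W.act j j' ≫ ι j = G.map j j' ⋆ᵍ ι j' := h1
  rw [← comp_gradedComp, h2, gradedComp_assoc]
  rfl

lemma representable_act {A : Type u₁} [EnrichedCategory V A] (b a a' : A) :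
    (representable b : Presheaf V A).act a a' = eComp V a a' b := by
  dsimp only [Presheaf.act, representable]
  refine (congrArg ((β_ _ _).hom ≫ ·) (MonoidalClosed.uncurry_curry _)).trans ?_
  exact SymmetricCategory.symmetry_assoc _ _ _

lemma restrict_representable_act {A : Type u₁} [EnrichedCategory V A] {B : Type u₂}
    [EnrichedCategory V B] (τ : EnrichedFunctor V A B) (b : B) (a a' : A) :
    ((representable b : Presheaf V B).restrict τ).act a a' =
      τ.map a a' ⋆ᵍ 𝟙 (τ.obj a' ⟶[V] b) := by
  rw [gradedComp_eq_whiskerRight, ← representable_act]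
  exact Presheaf.restrict_act τ _ a a'

end WeightedColimits

/-! ### Pointwise left Kan extensions -/

section KanExtension

variable {V : Type v} [Category.{w} V] [MonoidalCategory V] [SymmetricCategory V]
  {S : Type u₁} [EnrichedCategory V S] {T : Type u₂} [EnrichedCategory V T]
  {C : Type u} [Category.{v₃} C] [EnrichedOrdinaryCategory V C]
  {τ : EnrichedFunctor V S T} {G : EnrichedFunctor V S C} {K : EnrichedFunctor V T C}

/-- The graded morphism `G a ⟶ K b`, of degree `T(τ a, b)`, induced by `η a : G a ⟶ K (τ a)`. -/
def kanι (η : ∀ a : S, G.obj a ⟶ K.obj (τ.obj a)) (a : S) (b : T) :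
    (τ.obj a ⟶[V] b) ⟶ (G.obj a ⟶[V] K.obj b) :=
  K.map (τ.obj a) b ≫ eHomWhiskerRight V (η a) (K.obj b)

variable {η : ∀ a : S, G.obj a ⟶ K.obj (τ.obj a)}

lemma comp_kanι_gradedComp {P Q : V} {a : S} {b b' : T} (f : P ⟶ (τ.obj a ⟶[V] b))
    (g : Q ⟶ (b ⟶[V] b')) :
    (f ≫ kanι η a b) ⋆ᵍ (g ≫ K.map b b') = (f ⋆ᵍ g) ≫ kanι η a b' := by
  rw [kanι, kanι, ← Category.assoc, pre_gradedComp, reassoc_of% gradedComp_map]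

lemma kanι_gradedComp_map {a : S} {b b' : T} :
    kanι η a b ⋆ᵍ K.map b b' = eComp V _ _ _ ≫ kanι η a b' := by
  have h := comp_kanι_gradedComp (η := η) (𝟙 (τ.obj a ⟶[V] b)) (𝟙 (b ⟶[V] b'))
  rwa [Category.id_comp, Category.id_comp, id_gradedComp_id] at h

lemma eId_kanι (a : S) : eId V (τ.obj a) ≫ kanι η a (τ.obj a) = eHomEquiv V (η a) := by
  rw [kanι, K.map_id_assoc, ← eHomEquiv_id, ← eHomEquiv_comp_right, Category.comp_id]

variable [MonoidalClosed V]

lemma IsPointwiseLeftKan.jointlyEpic (hK : IsPointwiseLeftKan τ G K η) (b : T) :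
    JointlyEpic (fun a => kanι η a b) :=
  (hK b).jointlyEpic

lemma IsPointwiseLeftKan.comp_kanι (hK : IsPointwiseLeftKan τ G K η) {P Q : V} {a a' : S} {b : T}
    (f : P ⟶ (a ⟶[V] a')) (g : Q ⟶ (τ.obj a' ⟶[V] b)) :
    ((f ≫ τ.map a a') ⋆ᵍ g) ≫ kanι η a b = (f ≫ G.map a a') ⋆ᵍ (g ≫ kanι η a' b) := by
  have h : (τ.map a a' ⋆ᵍ 𝟙 (τ.obj a' ⟶[V] b)) ≫ kanι η a b = G.map a a' ⋆ᵍ kanι η a' b := by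
    rw [← restrict_representable_act]
    exact (hK b).natural a a'
  rw [comp_gradedComp_comp, ← h, ← Category.assoc, ← comp_gradedComp_comp, Category.comp_id]

/-- The universal property of the value of a pointwise left Kan extension. -/
lemma IsPointwiseLeftKan.exists_desc (hK : IsPointwiseLeftKan τ G K η) (b : T) {Z : V} {X : C}
    (φ : ∀ a : S, (τ.obj a ⟶[V] b) ⊗ Z ⟶ (G.obj a ⟶[V] X))
    (hφ : ∀ a a', (τ.map a a' ⋆ᵍ 𝟙 (τ.obj a' ⟶[V] b)) ▷ Z ≫ φ a =
      (α_ _ _ _).hom ≫ G.map a a' ⋆ᵍ φ a') :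
    ∃ u : Z ⟶ (K.obj b ⟶[V] X), ∀ a, kanι η a b ⋆ᵍ u = φ a := by
  refine ((hK b).existsUnique Z X φ fun a a' => ?_).exists
  rw [restrict_representable_act]
  exact hφ a a'

lemma IsPointwiseLeftKan.exists_hom (hK : IsPointwiseLeftKan τ G K η) (b : T) {X : C}
    (φ : ∀ a : S, (τ.obj a ⟶[V] b) ⟶ (G.obj a ⟶[V] X))
    (hφ : ∀ a a', (τ.map a a' ⋆ᵍ 𝟙 (τ.obj a' ⟶[V] b)) ≫ φ a = G.map a a' ⋆ᵍ φ a') :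
    ∃ f : K.obj b ⟶ X, ∀ a, kanι η a b ≫ eHomWhiskerLeft V _ f = φ a := by
  obtain ⟨u, hu⟩ := hK.exists_desc b (Z := 𝟙_ V) (fun a => (ρ_ _).hom ≫ φ a) fun a a' => by
    rw [MonoidalCategory.rightUnitor_naturality_assoc, hφ, gradedComp_comp]
    simp
  refine ⟨(eHomEquiv V).symm u, fun a => ?_⟩
  have h := gradedComp_eHomEquiv (kanι η a b) ((eHomEquiv V).symm u)
  rw [Equiv.apply_symm_apply, hu, cancel_epi] at h
  exact h.symm

/-- A graded transformation out of a left Kan extension is computed, on the coprojections, by its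
restriction along the unit. -/
lemma kanι_gradedComp_natural
    {H : EnrichedFunctor V T C} {X : V} {β : ∀ b, X ⟶ (K.obj b ⟶[V] H.obj b)}
    (hβ : IsGradedVNatural V K H β) (a : S) (b : T) :
    kanι η a b ⋆ᵍ β b = (β_ _ _).hom ≫
      (β (τ.obj a) ≫ eHomWhiskerRight V (η a) _) ⋆ᵍ H.map (τ.obj a) b := by
  have h : K.map (τ.obj a) b ⋆ᵍ β b = (β_ _ _).hom ≫ β (τ.obj a) ⋆ᵍ H.map (τ.obj a) b :=
    hβ (τ.obj a) b
  rw [pre_gradedComp, ← reassoc_of% h, ← pre_gradedComp, kanι]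

lemma IsPointwiseLeftKan.graded_ext (hK : IsPointwiseLeftKan τ G K η)
    {H : EnrichedFunctor V T C} {X : V} {β γ : ∀ b, X ⟶ (K.obj b ⟶[V] H.obj b)}
    (hβ : IsGradedVNatural V K H β) (hγ : IsGradedVNatural V K H γ)
    (h : ∀ a, β (τ.obj a) ≫ eHomWhiskerRight V (η a) _ =
      γ (τ.obj a) ≫ eHomWhiskerRight V (η a) _) : β = γ := by
  funext b
  refine hK.jointlyEpic b _ _ fun a => ?_
  rw [kanι_gradedComp_natural hβ, kanι_gradedComp_natural hγ, h]

/-- The universal property of the pointwise left Kan extension among `V`-functors, for graded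
`V`-natural transformations. -/
lemma IsPointwiseLeftKan.exists_graded (hK : IsPointwiseLeftKan τ G K η)
    {H : EnrichedFunctor V T C} {X : V} (α : ∀ a, X ⟶ (G.obj a ⟶[V] H.obj (τ.obj a)))
    (hα : IsGradedVNatural V G (τ.comp V H) α) :
    ∃ β : ∀ b, X ⟶ (K.obj b ⟶[V] H.obj b), IsGradedVNatural V K H β ∧
      ∀ a, β (τ.obj a) ≫ eHomWhiskerRight V (η a) _ = α a := by
  have hα' : ∀ a a', G.map a a' ⋆ᵍ α a' =
      (β_ _ _).hom ≫ α a ⋆ᵍ (τ.map a a' ≫ H.map _ _) := hα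
  have hu : ∀ b, ∃ u : X ⟶ (K.obj b ⟶[V] H.obj b), ∀ a,
      kanι η a b ⋆ᵍ u = (β_ _ _).hom ≫ α a ⋆ᵍ H.map (τ.obj a) b := fun b => by
    refine hK.exists_desc b _ fun a a' => ?_
    rw [BraidedCategory.braiding_naturality_left_assoc, ← gradedComp_comp, gradedComp_map,
      Category.id_comp, gradedComp_assoc', gradedComp_comp (β_ _ _).hom, gradedComp_assoc', hα',
      comp_gradedComp (β_ _ _).hom, BraidedCategory.braiding_tensor_left_hom]
    simp
  choose β hβ using hu
  refine ⟨β, fun b b' => ?_, fun a => ?_⟩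
  · refine hK.jointlyEpic b _ _ fun a => ?_
    change kanι η a b ⋆ᵍ K.map b b' ⋆ᵍ β b' = kanι η a b ⋆ᵍ ((β_ _ _).hom ≫ β b ⋆ᵍ H.map b b')
    rw [gradedComp_assoc', kanι_gradedComp_map, comp_gradedComp, hβ,
      BraidedCategory.braiding_naturality_left_assoc, ← gradedComp_comp, ← id_gradedComp_id,
      gradedComp_map, Category.id_comp, Category.id_comp, gradedComp_comp (β_ _ _).hom,
      gradedComp_assoc' (kanι η a b), hβ, comp_gradedComp, gradedComp_assoc,
      BraidedCategory.braiding_tensor_left_hom]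
    simp
  · have h := congrArg (fun k => (λ_ X).inv ≫ eId V (τ.obj a) ▷ X ≫ k) (hβ (τ.obj a) a)
    rw [← comp_gradedComp, eId_kanι, eHomEquiv_gradedComp, Iso.inv_hom_id_assoc] at h
    rw [h, BraidedCategory.braiding_naturality_left_assoc, ← gradedComp_comp, H.map_id,
      gradedComp_eId]
    simp

/-- Cocomplete `V`-categories admit pointwise left Kan extensions along `V`-functors between small
`V`-categories. -/
lemma exists_isPointwiseLeftKan {S : Type w} [EnrichedCategory V S] {T : Type u₂}
    [EnrichedCategory V T] (hC : IsCocomplete V C) (τ : EnrichedFunctor V S T)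
    (G : EnrichedFunctor V S C) :
    ∃ (K : EnrichedFunctor V T C) (η : ∀ a : S, G.obj a ⟶ K.obj (τ.obj a)),
      IsPointwiseLeftKan τ G K η := by
  obtain ⟨L, ι, h⟩ : ∃ (L : T → C) (ι : ∀ b a, (τ.obj a ⟶[V] b) ⟶ (G.obj a ⟶[V] L b)),
      ∀ b, IsWeightedColimit ((representable b).restrict τ) G (L b) (ι b) := by
    choose L ι h using fun b => hC S ((representable b).restrict τ) G
    exact ⟨L, ι, h⟩
  have hepi : ∀ b, JointlyEpic (W := fun a => (τ.obj a ⟶[V] b)) (ι b) := fun b =>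
    (h b).jointlyEpic
  have hnat : ∀ a a' b, (τ.map a a' ⋆ᵍ 𝟙 (τ.obj a' ⟶[V] b)) ≫ ι b a = G.map a a' ⋆ᵍ ι b a' := by
    intro a a' b
    rw [← restrict_representable_act]
    exact (h b).natural a a'
  have hm : ∀ b b' : T, ∃ u : (b ⟶[V] b') ⟶ (L b ⟶[V] L b'),
      ∀ a, ι b a ⋆ᵍ u = eComp V (τ.obj a) b b' ≫ ι b' a := fun b b' => by
    refine ((h b).existsUnique _ (L b') (fun a => eComp V (τ.obj a) b b' ≫ ι b' a)
      fun a a' => ?_).exists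
    rw [restrict_representable_act]
    change (τ.map a a' ⋆ᵍ 𝟙 (τ.obj a' ⟶[V] b)) ▷ _ ≫ eComp V (τ.obj a) b b' ≫ ι b' a =
      (α_ _ _ _).hom ≫ G.map a a' ⋆ᵍ (eComp V (τ.obj a') b b' ≫ ι b' a')
    rw [gradedComp_comp, ← hnat, ← reassoc_of% gradedComp_eq_whiskerRight, gradedComp_assoc,
      Category.assoc, id_gradedComp_id, ← reassoc_of% gradedComp_comp, Category.comp_id]
  choose m hm using hm
  let K : EnrichedFunctor V T C :=
    { obj := L
      map := m
      map_id := fun b => hepi b _ _ fun a => by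
        have e := e_comp_id V (τ.obj a) b
        have e' : (τ.obj a ⟶[V] b) ◁ eId V b ≫ eComp V (τ.obj a) b b = (ρ_ _).hom := by
          rw [← cancel_epi (ρ_ _).inv, e, Iso.inv_hom_id]
        rw [gradedComp_comp, hm, gradedComp_eId]
        exact (reassoc_of% e') _
      map_comp := fun b b' b'' => hepi b _ _ fun a => by
        rw [gradedComp_comp, hm]
        change _ = ι b a ⋆ᵍ m b b' ⋆ᵍ m b' b''
        rw [gradedComp_assoc', hm, comp_gradedComp, hm, ← reassoc_of% e_assoc] }
  refine ⟨K, fun a => (eHomEquiv V).symm (eId V (τ.obj a) ≫ ι (τ.obj a) a), fun b => ?_⟩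
  -- The coprojections recovered from the unit are the given ones.
  have hι : ∀ a, kanι (K := K) (fun a => (eHomEquiv V).symm (eId V (τ.obj a) ≫ ι (τ.obj a) a)) a b
      = ι b a := fun a => by
    have e := eHomEquiv_gradedComp ((eHomEquiv V).symm (eId V (τ.obj a) ≫ ι (τ.obj a) a))
      (m (τ.obj a) b)
    rw [Equiv.apply_symm_apply, comp_gradedComp, hm] at e
    rw [← cancel_epi (λ_ _).hom]
    refine e.symm.trans ?_
    have e1 := e_id_comp V (τ.obj a) b
    rw [Iso.inv_comp_eq, Category.comp_id] at e1
    exact (reassoc_of% e1) _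
  have hι' := funext hι
  exact hι' ▸ h b

end KanExtension

/-! ### Adjunctions from universal arrows -/

section UniversalArrows

open ForgetEnrichment

variable {V : Type v} [Category.{w} V] [MonoidalCategory V] [SymmetricCategory V]
  {X : Type u₁} [EnrichedCategory V X] {Y : Type u₂} [EnrichedCategory V Y]

lemma homTo_comp_eq {a b c : ForgetEnrichment V X} (f : a ⟶ b) (g : b ⟶ c) :
    homTo V (f ≫ g) = (λ_ _).inv ≫ homTo V f ⋆ᵍ homTo V g := by
  rw [homTo_comp, Category.assoc, gradedComp]

lemma forget_ext {a b : ForgetEnrichment V X} {f g : a ⟶ b} (h : homTo V f = homTo V g) :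
    f = g := h

/-- The elements `u x : x ⟶ R (L x)` are universal arrows to the `V`-functor `R`, in the graded
sense: composition with `u x` is an isomorphism `Y(L x, y) ≅ X(x, R y)` in `V`. -/
def IsUniversalArrow (R : EnrichedFunctor V Y X) (L : X → Y)
    (u : ∀ x, 𝟙_ V ⟶ (x ⟶[V] R.obj (L x))) : Prop :=
  ∀ (x : X) (y : Y) (Z : V) (f : Z ⟶ (x ⟶[V] R.obj y)), ∃! g : Z ⟶ (L x ⟶[V] y),
    u x ⋆ᵍ (g ≫ R.map (L x) y) = (λ_ Z).hom ≫ f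

namespace IsUniversalArrow

variable {R : EnrichedFunctor V Y X} {L : X → Y} {u : ∀ x, 𝟙_ V ⟶ (x ⟶[V] R.obj (L x))}

lemma hom_ext (h : IsUniversalArrow R L u) {x : X} {y : Y} {Z : V} {f g : Z ⟶ (L x ⟶[V] y)}
    (e : u x ⋆ᵍ (f ≫ R.map (L x) y) = u x ⋆ᵍ (g ≫ R.map (L x) y)) : f = g :=
  (h x y Z ((λ_ Z).inv ≫ u x ⋆ᵍ (f ≫ R.map (L x) y))).unique (by simp) (by simp [e])

/-- The morphism out of `L x` that corresponds to a graded morphism `x ⟶ R y`. -/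
def desc (h : IsUniversalArrow R L u) {x : X} {y : Y} {Z : V} (f : Z ⟶ (x ⟶[V] R.obj y)) :
    Z ⟶ (L x ⟶[V] y) :=
  (h x y Z f).choose

lemma desc_spec (h : IsUniversalArrow R L u) {x : X} {y : Y} {Z : V}
    (f : Z ⟶ (x ⟶[V] R.obj y)) : u x ⋆ᵍ (h.desc f ≫ R.map (L x) y) = (λ_ Z).hom ≫ f :=
  (h x y Z f).choose_spec.1

/-- The action of the left adjoint on morphisms. -/
def leftMap (h : IsUniversalArrow R L u) (x x' : X) : (x ⟶[V] x') ⟶ (L x ⟶[V] L x') :=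
  h.desc ((ρ_ _).inv ≫ 𝟙 (x ⟶[V] x') ⋆ᵍ u x')

lemma comp_leftMap_map (h : IsUniversalArrow R L u) {x x' : X} {P : V} (f : P ⟶ (x ⟶[V] x')) :
    u x ⋆ᵍ (f ≫ h.leftMap x x' ≫ R.map (L x) (L x')) = (λ_ P).hom ≫ (ρ_ P).inv ≫ f ⋆ᵍ u x' := by
  rw [gradedComp_comp, leftMap, desc_spec, MonoidalCategory.leftUnitor_naturality_assoc,
    MonoidalCategory.rightUnitor_inv_naturality_assoc, ← comp_gradedComp, Category.comp_id]

/-- The left adjoint of a `V`-functor, constructed from universal arrows. -/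
def leftAdjoint (h : IsUniversalArrow R L u) : EnrichedFunctor V X Y where
  obj := L
  map := h.leftMap
  map_id x := h.hom_ext (by
    rw [Category.assoc, comp_leftMap_map, R.map_id, gradedComp_eId, eId_gradedComp,
      unitors_equal, Iso.inv_hom_id_assoc])
  map_comp x x' x'' := h.hom_ext (by
    change _ = u x ⋆ᵍ ((h.leftMap x x' ⋆ᵍ h.leftMap x' x'') ≫ R.map (L x) (L x''))
    have e := h.comp_leftMap_map (𝟙 (x ⟶[V] x'))
    have e' := h.comp_leftMap_map (𝟙 (x' ⟶[V] x''))
    rw [Category.id_comp] at e e'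
    rw [Category.assoc, comp_leftMap_map, gradedComp_map, gradedComp_assoc', e, comp_gradedComp,
      comp_gradedComp, gradedComp_assoc, e', gradedComp_comp, gradedComp_comp, ← id_gradedComp_id,
      gradedComp_assoc]
    simp)

/-- The counit of the adjunction constructed from universal arrows. -/
def counit (h : IsUniversalArrow R L u) (y : Y) : 𝟙_ V ⟶ (L (R.obj y) ⟶[V] y) :=
  h.desc (eId V (R.obj y))

lemma counit_spec (h : IsUniversalArrow R L u) (y : Y) :
    u (R.obj y) ⋆ᵍ (h.counit y ≫ R.map _ _) = (λ_ _).hom ≫ eId V (R.obj y) :=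
  h.desc_spec _

lemma counit_natural (h : IsUniversalArrow R L u) {y y' : Y} {P : V} (f : P ⟶ (y ⟶[V] y')) :
    h.counit y ⋆ᵍ f = (λ_ P).hom ≫ (ρ_ P).inv ≫
      (f ≫ R.map _ _ ≫ h.leftMap _ _) ⋆ᵍ h.counit y' := by
  have e := h.comp_leftMap_map (f ≫ R.map y y')
  apply h.hom_ext
  rw [gradedComp_map, gradedComp_assoc', counit_spec, comp_gradedComp, eId_gradedComp,
    Category.assoc, Category.assoc, gradedComp_map, gradedComp_comp, gradedComp_comp,
    gradedComp_assoc', Category.assoc, Category.assoc, ← Category.assoc f, e, comp_gradedComp,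
    comp_gradedComp, gradedComp_assoc, counit_spec, gradedComp_comp, gradedComp_eId]
  simp

/-- The `V`-adjunction constructed from universal arrows. -/
def vAdjunction (h : IsUniversalArrow R L u) : VAdjunction h.leftAdjoint R where
  adj :=
    { unit :=
        { app x := homOf V (u (ForgetEnrichment.to V x))
          naturality x x' f := forget_ext (by
            refine (homTo_comp_eq _ _).trans (Eq.trans ?_ (homTo_comp_eq _ _).symm)
            change (λ_ _).inv ≫ homTo V f ⋆ᵍ u (ForgetEnrichment.to V x') =
              (λ_ _).inv ≫ u (ForgetEnrichment.to V x) ⋆ᵍ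
                ((homTo V f ≫ h.leftMap _ _) ≫ R.map _ _)
            rw [Category.assoc, comp_leftMap_map, unitors_equal, Iso.hom_inv_id_assoc]) }
      counit :=
        { app y := homOf V (h.counit (ForgetEnrichment.to V y))
          naturality y y' f := forget_ext (by
            refine (homTo_comp_eq _ _).trans (Eq.trans ?_ (homTo_comp_eq _ _).symm)
            change (λ_ _).inv ≫ ((homTo V f ≫ R.map _ _) ≫ h.leftMap _ _) ⋆ᵍ
              h.counit (ForgetEnrichment.to V y') =
                (λ_ _).inv ≫ h.counit (ForgetEnrichment.to V y) ⋆ᵍ homTo V f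
            rw [Category.assoc, counit_natural, unitors_equal, Iso.hom_inv_id_assoc]) }
      left_triangle_components x := forget_ext (by
        rw [homTo_comp_eq, homTo_id]
        change (λ_ _).inv ≫ (u (ForgetEnrichment.to V x) ≫ h.leftMap _ _) ⋆ᵍ
          h.counit (L (ForgetEnrichment.to V x)) = eId V (L (ForgetEnrichment.to V x))
        apply h.hom_ext
        rw [Category.assoc, gradedComp_map, gradedComp_comp, gradedComp_assoc', Category.assoc,
          comp_leftMap_map, comp_gradedComp, comp_gradedComp, gradedComp_assoc, counit_spec,
          gradedComp_comp, gradedComp_eId, R.map_id, gradedComp_eId]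
        simp [unitors_equal, unitors_inv_equal])
      right_triangle_components y := forget_ext (by
        rw [homTo_comp_eq, homTo_id]
        change (λ_ _).inv ≫ u (R.obj (ForgetEnrichment.to V y)) ⋆ᵍ
          (h.counit (ForgetEnrichment.to V y) ≫ R.map _ _) = eId V (R.obj (ForgetEnrichment.to V y))
        rw [counit_spec, Iso.inv_hom_id_assoc]) }
  unit_vnatural x x' := by
    change (ρ_ (x ⟶[V] x')).inv ≫ 𝟙 (x ⟶[V] x') ⋆ᵍ u x' =
      (λ_ (x ⟶[V] x')).inv ≫ u x ⋆ᵍ (h.leftMap x x' ≫ R.map (L x) (L x'))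
    have e := h.comp_leftMap_map (𝟙 (x ⟶[V] x'))
    rw [Category.id_comp] at e
    rw [e, Iso.inv_hom_id_assoc]
  counit_vnatural y y' := by
    change (ρ_ (y ⟶[V] y')).inv ≫ (R.map y y' ≫ h.leftMap _ _) ⋆ᵍ h.counit y' =
      (λ_ (y ⟶[V] y')).inv ≫ h.counit y ⋆ᵍ 𝟙 (y ⟶[V] y')
    rw [counit_natural, Iso.inv_hom_id_assoc, Category.id_comp]

end IsUniversalArrow

/-- The left adjoint of a functor between ordinary categories, constructed from universal arrows. -/
def leftAdjointOfUniversal {X : Type u₁} [Category.{v₁} X] {Y : Type u₂} [Category.{v₂} Y]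
    {R : Y ⥤ X} {L : X → Y} {u : ∀ x, x ⟶ R.obj (L x)}
    (h : ∀ x y (f : x ⟶ R.obj y), ∃! g : L x ⟶ y, u x ≫ R.map g = f) : X ⥤ Y :=
  Adjunction.leftAdjointOfEquiv (G := R) (F_obj := L)
    (fun x y => Equiv.ofBijective (fun g => u x ≫ R.map g)
      (Function.bijective_iff_existsUnique _ |>.2 (h x y)))
    (fun x y y' g f => by simp)

/-- The adjunction constructed from universal arrows, for ordinary categories. -/
def adjunctionOfUniversal {X : Type u₁} [Category.{v₁} X] {Y : Type u₂} [Category.{v₂} Y]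
    {R : Y ⥤ X} {L : X → Y} {u : ∀ x, x ⟶ R.obj (L x)}
    (h : ∀ x y (f : x ⟶ R.obj y), ∃! g : L x ⟶ y, u x ≫ R.map g = f) :
    leftAdjointOfUniversal h ⊣ R :=
  Adjunction.adjunctionOfEquivLeft _ _

lemma adjunctionOfUniversal_unit {X : Type u₁} [Category.{v₁} X] {Y : Type u₂} [Category.{v₂} Y]
    {R : Y ⥤ X} {L : X → Y} {u : ∀ x, x ⟶ R.obj (L x)}
    (h : ∀ x y (f : x ⟶ R.obj y), ∃! g : L x ⟶ y, u x ≫ R.map g = f) (x : X) :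
    (adjunctionOfUniversal h).unit.app x = u x := by
  have e : u x ≫ R.map (𝟙 (L x)) = u x := by rw [R.map_id, Category.comp_id]
  exact e

end UniversalArrows

/-! ### Left Kan extension as a `V`-adjoint to restriction -/

section KanAdjunction

variable {V : Type v} [Category.{w} V] [MonoidalCategory V] [SymmetricCategory V]
  [MonoidalClosed V]

lemma IsPointwiseLeftKan.unit_natural {S : Type u₁} [EnrichedCategory V S] {T : Type u₂}
    [EnrichedCategory V T] {C : Type u} [Category.{v₃} C] [EnrichedOrdinaryCategory V C]
    {τ : EnrichedFunctor V S T} {G : EnrichedFunctor V S C} {K : EnrichedFunctor V T C}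
    {η : ∀ a : S, G.obj a ⟶ K.obj (τ.obj a)} (hK : IsPointwiseLeftKan τ G K η) :
    IsGradedVNatural V G (τ.comp V K) (fun a => eHomEquiv V (η a)) := by
  intro a a'
  have h := hK.comp_kanι (𝟙 (a ⟶[V] a')) (eId V (τ.obj a'))
  rw [Category.id_comp, Category.id_comp, gradedComp_eId, eId_kanι, kanι] at h
  refine h.symm.trans ?_
  change _ = (β_ _ _).hom ≫ eHomEquiv V (η a) ⋆ᵍ (τ.map a a' ≫ K.map _ _)
  rw [eHomEquiv_gradedComp]
  simp

variable [HasLimits V] {S : Type w} [EnrichedCategory V S] {T : Type w} [EnrichedCategory V T]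
  {C : Type u} [Category.{v₃} C] [EnrichedOrdinaryCategory V C] {τ : EnrichedFunctor V S T}

/-- A factorization through the unit of a left Kan extension can be checked on components. -/
lemma eHomEquiv_natLift_gradedComp_eq_iff {G : EnrichedFunctor V S C} {K H : EnrichedFunctor V T C}
    {v : 𝟙_ V ⟶ (G ⟶[V] τ.comp V K)} {η : ∀ a : S, G.obj a ⟶ K.obj (τ.obj a)}
    (hv : ∀ a, v ≫ natProj G (τ.comp V K) a = eHomEquiv V (η a)) {Z : V} (g : Z ⟶ (K ⟶[V] H))
    (f : Z ⟶ (G ⟶[V] τ.comp V H)) :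
    v ⋆ᵍ (g ≫ restrictionMap τ K H) = (λ_ Z).hom ≫ f ↔
      ∀ a, (g ≫ natProj K H (τ.obj a)) ≫ eHomWhiskerRight V (η a) _ =
        f ≫ natProj G (τ.comp V H) a := by
  have e : ∀ a, (v ⋆ᵍ (g ≫ restrictionMap τ K H)) ≫ natProj G (τ.comp V H) a =
      (λ_ Z).hom ≫ (g ≫ natProj K H (τ.obj a)) ≫ eHomWhiskerRight V (η a) _ := fun a => by
    rw [gradedComp, Category.assoc, eComp_natProj,
      MonoidalCategory.tensorHom_comp_tensorHom_assoc, hv, Category.assoc, restrictionMap_natProj]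
    exact eHomEquiv_gradedComp _ _
  constructor
  · intro h a
    have h' := e a
    rw [h, Category.assoc] at h'
    exact ((cancel_epi _).1 h').symm
  · intro h
    refine nat_ext fun a => ?_
    rw [e, h, Category.assoc]
    rfl

/-- Pointwise left Kan extensions provide universal arrows to the `V`-functor given by
restriction. -/
lemma isUniversalArrow_of_isPointwiseLeftKan
    {K : EnrichedFunctor V S C → EnrichedFunctor V T C}
    {η : ∀ (G : EnrichedFunctor V S C) (a : S), G.obj a ⟶ (K G).obj (τ.obj a)}
    (hK : ∀ G, IsPointwiseLeftKan τ G (K G) (η G)) :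
    IsUniversalArrow (restriction τ C) K
      (fun G => natLift G (τ.comp V (K G)) _ (hK G).unit_natural) := by
  intro G H Z f
  have key : ∀ g : Z ⟶ (K G ⟶[V] H), _ ↔ _ := fun g =>
    eHomEquiv_natLift_gradedComp_eq_iff (natLift_proj _ _ _ (hK G).unit_natural) g f
  obtain ⟨β, hβ, hβ'⟩ := (hK G).exists_graded _ ((natProj_natural G (τ.comp V H)).precomp f)
  refine ⟨natLift _ _ β hβ, (key _).2 fun a => ?_, fun g hg => ?_⟩
  · rw [natLift_proj]
    exact hβ' a
  · refine nat_ext fun b => ?_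
    rw [natLift_proj]
    refine congrFun ((hK G).graded_ext ((natProj_natural _ _).precomp g) hβ fun a => ?_) b
    exact ((key g).1 hg a).trans (hβ' a).symm

end KanAdjunction

section Existence

variable {V : Type v} [Category.{w} V] [MonoidalCategory V] [SymmetricCategory V]
  [MonoidalClosed V] [HasLimits V]
  {S : Type w} [Category.{v₁} S] [EnrichedOrdinaryCategory V S]
  [MonoidalCategory S] [SymmetricCategory S] [SymmetricMonoidalEnriched V S]
  {T : Type w} [Category.{v₂} T] [EnrichedOrdinaryCategory V T]
  [MonoidalCategory T] [SymmetricCategory T] [SymmetricMonoidalEnriched V T]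
  {C : Type u} [Category.{v₃} C] [EnrichedOrdinaryCategory V C]
  [MonoidalCategory C] [SymmetricCategory C] [SymmetricMonoidalEnriched V C]

/-- Restriction along `τ` has a left `V`-adjoint, given by pointwise left Kan extensions whose unit
is the unit of the adjunction. -/
lemma exists_vAdjunction_isPointwiseLeftKan (hC : IsCocomplete V C) (τ : EnrichedFunctor V S T) :
    ∃ (L₀ : EnrichedFunctor V (EnrichedFunctor V S C) (EnrichedFunctor V T C))
      (adj₀ : VAdjunction L₀ (restriction τ C)),
      ∀ G : EnrichedFunctor V S C,
        IsPointwiseLeftKan τ G (L₀.obj G) (unitComponent adj₀ G) := by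
  choose K η hK using exists_isPointwiseLeftKan (C := C) hC τ
  refine ⟨_, (isUniversalArrow_of_isPointwiseLeftKan hK).vAdjunction, fun G => ?_⟩
  have h : unitComponent (isUniversalArrow_of_isPointwiseLeftKan hK).vAdjunction G = η G := by
    funext a
    dsimp only [unitComponent]
    exact (Equiv.symm_apply_eq _).2 (natLift_proj _ _ _ (hK G).unit_natural a)
  rw [h]
  exact hK G

end Existence

/-! ### Tensor products of weighted colimits -/

section TensorColimits

variable {V : Type v} [Category.{w} V] [MonoidalCategory V] [SymmetricCategory V]
  [MonoidalClosed V]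

lemma IsWeightedColimit.congr_map {J : Type u₁} [EnrichedCategory V J] {C : Type u₂}
    [EnrichedCategory V C] {W : Presheaf V J} {F : J → C}
    {m m' : ∀ j j' : J, (j ⟶[V] j') ⟶ (F j ⟶[V] F j')} (hm : m = m') {h₁ h₂ h₁' h₂'} {L : C}
    {ι : ∀ j : J, W.obj (op j) ⟶ (F j ⟶[V] L)} (h : IsWeightedColimit W ⟨F, m, h₁, h₂⟩ L ι) :
    IsWeightedColimit W ⟨F, m', h₁', h₂'⟩ L ι := by
  subst hm
  exact h

lemma PreservesWeightedColimits.id (C : Type u₁) [EnrichedCategory V C] :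
    PreservesWeightedColimits (EnrichedFunctor.id V C) := by
  intro J _ W G L ι h
  have e : (fun j => ι j ≫ (EnrichedFunctor.id V C).map (G.obj j) L) = ι :=
    funext fun j => Category.comp_id _
  exact e.symm ▸ h.congr_map (funext₂ fun _ _ => (Category.comp_id _).symm)

lemma PreservesWeightedColimits.comp {C : Type u₁} [EnrichedCategory V C] {D : Type u₂}
    [EnrichedCategory V D] {E : Type u₃} [EnrichedCategory V E] {F : EnrichedFunctor V C D}
    {F' : EnrichedFunctor V D E} (hF : PreservesWeightedColimits F)
    (hF' : PreservesWeightedColimits F') : PreservesWeightedColimits (F.comp V F') := by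
  intro J _ W G L ι h
  have e : (fun j => ι j ≫ (F.comp V F').map (G.obj j) L) =
      fun j => (ι j ≫ F.map (G.obj j) L) ≫ F'.map _ _ :=
    funext fun j => (Category.assoc _ _ _).symm
  exact e.symm ▸ (hF' J W _ _ _ (hF J W _ _ _ h)).congr_map
    (funext₂ fun _ _ => Category.assoc _ _ _)

/-- The graded morphisms `ι j : D j ⟶ L` remain jointly epic after any cocontinuous `V`-functor. -/
def IsStablyEpic {J : Type u₁} {C : Type u₂} [EnrichedCategory V C] {W : J → V} {D : J → C} {L : C}
    (ι : ∀ j, W j ⟶ (D j ⟶[V] L)) : Prop :=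
  ∀ E : EnrichedFunctor V C C, PreservesWeightedColimits E →
    JointlyEpic (fun j => ι j ≫ E.map (D j) L)

lemma IsStablyEpic.jointlyEpic {J : Type u₁} {C : Type u₂} [EnrichedCategory V C]
    {W : J → V} {D : J → C} {L : C} {ι : ∀ j, W j ⟶ (D j ⟶[V] L)} (h : IsStablyEpic ι) :
    JointlyEpic ι := by
  have e : (fun j => ι j ≫ (EnrichedFunctor.id V C).map (D j) L) = ι :=
    funext fun j => Category.comp_id _
  have h' := h _ (PreservesWeightedColimits.id C)
  exact e ▸ h'

variable {C : Type u} [Category.{v₃} C] [EnrichedOrdinaryCategory V C]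
  [MonoidalCategory C] [SymmetricCategory C] [SymmetricMonoidalEnriched V C]

/-- Tensor products of stably epic families are stably epic. Stability is what lets the argument
treat one tensor factor at a time, inside the cocontinuous functors `- ⊗ L'` and `D j ⊗ -`. -/
lemma IsStablyEpic.tensor (hleft : ∀ A : C, PreservesWeightedColimits (V := V) (tensorLeftV A))
    (hright : ∀ A : C, PreservesWeightedColimits (V := V) (tensorRightV A))
    {J : Type u₁} {W : J → V} {D : J → C} {L : C} {ι : ∀ j, W j ⟶ (D j ⟶[V] L)}
    (h : IsStablyEpic ι) {J' : Type u₂} {W' : J' → V} {D' : J' → C} {L' : C}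
    {ι' : ∀ j, W' j ⟶ (D' j ⟶[V] L')} (h' : IsStablyEpic ι') :
    IsStablyEpic (fun p : J × J' => ι p.1 ⊠ᵍ ι' p.2) := by
  intro E hE
  have e : JointlyEpic (fun j => gradedWhiskerRight (ι j) L' ≫ E.map (D j ⊗ L') (L ⊗ L')) := by
    have := h _ ((hright L').comp hE)
    have e : (fun j => ι j ≫ ((tensorRightV L').comp V E).map (D j) L) =
        fun j => gradedWhiskerRight (ι j) L' ≫ E.map _ _ := funext fun j => by
      rw [← comp_tensorRightV_map]
      exact (Category.assoc _ _ _).symm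
    exact e ▸ this
  have e' : ∀ j, JointlyEpic
      (fun k => gradedWhiskerLeft (D j) (ι' k) ≫ E.map (D j ⊗ D' k) (D j ⊗ L')) := fun j => by
    have := h' _ ((hleft (D j)).comp hE)
    have e : (fun k => ι' k ≫ ((tensorLeftV (D j)).comp V E).map (D' k) L') =
        fun k => gradedWhiskerLeft (D j) (ι' k) ≫ E.map _ _ := funext fun k => by
      rw [← comp_tensorLeftV_map]
      exact (Category.assoc _ _ _).symm
    exact e ▸ this
  refine JointlyEpic.of_epi_comp (fun p => (β_ (W' p.2) (W p.1)).hom) ?_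
  have := e.comp e'
  simp only [← gradedComp_map, gradedWhiskerLeft_gradedComp_gradedWhiskerRight,
    Category.assoc] at this
  exact this

variable {S : Type w} [EnrichedCategory V S] {T : Type u₂} [EnrichedCategory V T]
  {τ : EnrichedFunctor V S T} {G : EnrichedFunctor V S C} {K : EnrichedFunctor V T C}
  {η : ∀ a : S, G.obj a ⟶ K.obj (τ.obj a)}

lemma IsPointwiseLeftKan.isStablyEpic (hK : IsPointwiseLeftKan τ G K η) (b : T) :
    IsStablyEpic (fun a => kanι η a b) :=
  fun _ hE => (hE S _ _ _ _ (hK b)).jointlyEpic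

/-- The universal property of `x ⊗ K b`, which is a weighted colimit as `x ⊗ -` is cocontinuous. -/
lemma IsPointwiseLeftKan.exists_desc_tensorLeft
    (hleft : ∀ A : C, PreservesWeightedColimits (V := V) (tensorLeftV A))
    (hK : IsPointwiseLeftKan τ G K η) (b : T) {Z : V} {x X : C}
    (φ : ∀ a : S, (τ.obj a ⟶[V] b) ⊗ Z ⟶ ((x ⊗ G.obj a : C) ⟶[V] X))
    (hφ : ∀ a a', (τ.map a a' ⋆ᵍ 𝟙 (τ.obj a' ⟶[V] b)) ▷ Z ≫ φ a =
      (α_ _ _ _).hom ≫ gradedWhiskerLeft x (G.map a a') ⋆ᵍ φ a') :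
    ∃ u : Z ⟶ ((x ⊗ K.obj b : C) ⟶[V] X), ∀ a, gradedWhiskerLeft x (kanι η a b) ⋆ᵍ u = φ a := by
  simp only [← comp_tensorLeftV_map] at hφ ⊢
  refine ((hleft x S _ _ _ _ (hK b)).existsUnique Z X φ fun a a' => ?_).exists
  rw [restrict_representable_act]
  exact hφ a a'

/-- The universal property of `K b ⊗ y`, which is a weighted colimit as `- ⊗ y` is cocontinuous. -/
lemma IsPointwiseLeftKan.exists_hom_tensorRight
    (hright : ∀ A : C, PreservesWeightedColimits (V := V) (tensorRightV A))
    (hK : IsPointwiseLeftKan τ G K η) (b : T) {y X : C}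
    (φ : ∀ a : S, (τ.obj a ⟶[V] b) ⟶ ((G.obj a ⊗ y : C) ⟶[V] X))
    (hφ : ∀ a a', (τ.map a a' ⋆ᵍ 𝟙 (τ.obj a' ⟶[V] b)) ≫ φ a =
      gradedWhiskerRight (G.map a a') y ⋆ᵍ φ a') :
    ∃ f : K.obj b ⊗ y ⟶ X, ∀ a,
      gradedWhiskerRight (kanι η a b) y ≫ eHomWhiskerLeft V _ f = φ a := by
  have h : ∃ u : 𝟙_ V ⟶ ((K.obj b ⊗ y : C) ⟶[V] X), ∀ a,
      gradedWhiskerRight (kanι η a b) y ⋆ᵍ u = (ρ_ _).hom ≫ φ a := by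
    have hφ' : ∀ a a', (τ.map a a' ⋆ᵍ 𝟙 (τ.obj a' ⟶[V] b)) ▷ 𝟙_ V ≫ (ρ_ _).hom ≫ φ a =
        (α_ _ _ _).hom ≫ gradedWhiskerRight (G.map a a') y ⋆ᵍ ((ρ_ _).hom ≫ φ a') := by
      intro a a'
      rw [MonoidalCategory.rightUnitor_naturality_assoc, hφ, gradedComp_comp]
      simp
    simp only [← comp_tensorRightV_map] at hφ' ⊢
    refine ((hright y S _ _ _ _ (hK b)).existsUnique (𝟙_ V) X
      (fun a => (ρ_ _).hom ≫ φ a) fun a a' => ?_).exists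
    rw [restrict_representable_act]
    exact hφ' a a'
  obtain ⟨u, hu⟩ := h
  refine ⟨(eHomEquiv V).symm u, fun a => ?_⟩
  have h := gradedComp_eHomEquiv (gradedWhiskerRight (kanι η a b) y) ((eHomEquiv V).symm u)
  rw [Equiv.apply_symm_apply, hu, cancel_epi] at h
  exact h.symm

/-- The universal property of `K b ⊗ K b'`, as a colimit in two variables. -/
lemma IsPointwiseLeftKan.exists_hom_tensor
    (hleft : ∀ A : C, PreservesWeightedColimits (V := V) (tensorLeftV A))
    (hright : ∀ A : C, PreservesWeightedColimits (V := V) (tensorRightV A))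
    (hK : IsPointwiseLeftKan τ G K η) (b b' : T) {X : C}
    (φ : ∀ a a' : S, (τ.obj a ⟶[V] b) ⊗ (τ.obj a' ⟶[V] b') ⟶
      ((G.obj a ⊗ G.obj a' : C) ⟶[V] X))
    (h₁ : ∀ a₁ a₂ a', (τ.map a₁ a₂ ⋆ᵍ 𝟙 (τ.obj a₂ ⟶[V] b)) ▷ _ ≫ φ a₁ a' =
      (α_ _ _ _).hom ≫ gradedWhiskerRight (G.map a₁ a₂) (G.obj a') ⋆ᵍ φ a₂ a')
    (h₂ : ∀ a a₁ a₂, _ ◁ (τ.map a₁ a₂ ⋆ᵍ 𝟙 (τ.obj a₂ ⟶[V] b')) ≫ φ a a₁ =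
      (α_ _ _ _).inv ≫ (β_ _ _).hom ▷ _ ≫ (α_ _ _ _).hom ≫
        gradedWhiskerLeft (G.obj a) (G.map a₁ a₂) ⋆ᵍ φ a a₂) :
    ∃ f : K.obj b ⊗ K.obj b' ⟶ X, ∀ a a',
      kanι η a b ⊠ᵍ kanι η a' b' ≫ eHomWhiskerLeft V _ f = φ a a' := by
  -- Extend `φ a` along the second variable to a map out of `G a ⊗ K b'`, then along the first.
  have h : ∀ a, ∃ u : (τ.obj a ⟶[V] b) ⟶ ((G.obj a ⊗ K.obj b' : C) ⟶[V] X), ∀ a',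
      gradedWhiskerLeft (G.obj a) (kanι η a' b') ⋆ᵍ u = (β_ _ _).hom ≫ φ a a' := fun a => by
    refine hK.exists_desc_tensorLeft hleft b' _ fun a₁ a₂ => ?_
    rw [BraidedCategory.braiding_naturality_left_assoc, h₂, gradedComp_comp,
      BraidedCategory.braiding_tensor_left_hom]
    simp only [Category.assoc, Iso.hom_inv_id_assoc]
    rw [← MonoidalCategory.comp_whiskerRight_assoc, SymmetricCategory.symmetry]
    simp
  choose u hu using h
  obtain ⟨f, hf⟩ := hK.exists_hom_tensorRight hright b u fun a₁ a₂ => by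
    have hepi : JointlyEpic
      (fun k => gradedWhiskerLeft (G.obj a₁) (kanι η k b')) := by
      have := hK.isStablyEpic b' _ (hleft (G.obj a₁))
      simp only [comp_tensorLeftV_map] at this
      exact this
    refine hepi _ _ fun a' => ?_
    rw [gradedComp_comp, hu, BraidedCategory.braiding_naturality_right_assoc, h₁,
      gradedComp_assoc', gradedWhiskerLeft_gradedComp_gradedWhiskerRight,
      ← gradedWhiskerRight_gradedComp_gradedWhiskerLeft, comp_gradedComp, gradedComp_assoc,
      hu, gradedComp_comp, BraidedCategory.braiding_tensor_right_hom]
    simp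
  refine ⟨f, fun a a' => ?_⟩
  have h := hu a a'
  rw [← hf, gradedComp_post, gradedWhiskerLeft_gradedComp_gradedWhiskerRight,
    Category.assoc, cancel_epi] at h
  exact h

end TensorColimits

/-! ### The tensorator of a left Kan extension -/

section TensorProductOfMaps

variable {V : Type v} [Category.{w} V] [MonoidalCategory V] [SymmetricCategory V]
  {S : Type u₁} [Category.{v₁} S] [EnrichedOrdinaryCategory V S]
  [MonoidalCategory S] [SymmetricCategory S] [SymmetricMonoidalEnriched V S]
  {T : Type u₂} [Category.{v₂} T] [EnrichedOrdinaryCategory V T]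
  [MonoidalCategory T] [SymmetricCategory T] [SymmetricMonoidalEnriched V T]
  {C : Type u} [Category.{v₃} C] [EnrichedOrdinaryCategory V C]
  [MonoidalCategory C] [SymmetricCategory C] [SymmetricMonoidalEnriched V C]

lemma SymmetricMonoidalVFunctor.gradedTensor_map_μ (F : SymmetricMonoidalVFunctor V S C)
    {P Q : V} {x x' y y' : S} (f : P ⟶ (x ⟶[V] x')) (g : Q ⟶ (y ⟶[V] y')) :
    ((f ≫ F.functor.map x x') ⊠ᵍ (g ≫ F.functor.map y y')) ≫
        eHomWhiskerLeft V _ (μ (ordinary F.functor) x' y') =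
      f ⊠ᵍ g ≫ F.functor.map _ _ ≫ eHomWhiskerRight V (μ (ordinary F.functor) x y) _ := by
  have h := F.str.μ_natural x x' y y'
  rw [comp_gradedTensor_comp, gradedTensor, gradedTensor, Category.assoc, Category.assoc, h,
    Category.assoc]

lemma SymmetricMonoidalVFunctor.gradedTensor_map_δ (F : SymmetricMonoidalVFunctor V S C)
    {P Q : V} {x x' y y' : S} (f : P ⟶ (x ⟶[V] x')) (g : Q ⟶ (y ⟶[V] y')) :
    ((f ≫ F.functor.map x x') ⊠ᵍ (g ≫ F.functor.map y y')) ≫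
        eHomWhiskerRight V (δ (ordinary F.functor) x y) _ =
      f ⊠ᵍ g ≫ F.functor.map _ _ ≫ eHomWhiskerLeft V _ (δ (ordinary F.functor) x' y') := by
  have h := congrArg (fun k => k ≫ eHomWhiskerLeft V _ (δ (ordinary F.functor) x' y') ≫
    eHomWhiskerRight V (δ (ordinary F.functor) x y) _) (F.gradedTensor_map_μ f g)
  simp only [Category.assoc] at h
  rw [← eHomWhiskerLeft_comp_assoc, Functor.Monoidal.μ_δ, eHomWhiskerLeft_id, Category.id_comp,
    eHom_whisker_exchange, ← eHomWhiskerRight_comp_assoc, Functor.Monoidal.δ_μ,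
    eHomWhiskerRight_id, Category.id_comp] at h
  exact h

variable (τ : SymmetricMonoidalVFunctor V S T)

/-- The tensor product of maps out of `τ a` and `τ a'`, as a map out of `τ (a ⊗ a')`. -/
def dayMap (a a' : S) (b b' : T) :
    (τ.functor.obj a ⟶[V] b) ⊗ (τ.functor.obj a' ⟶[V] b') ⟶
      (τ.functor.obj (a ⊗ a') ⟶[V] (b ⊗ b' : T)) :=
  tensorMap _ _ _ _ ≫ eHomWhiskerRight V (δ (ordinary τ.functor) a a') _

variable {τ}

lemma comp_dayMap {P Q : V} {a a' : S} {b b' : T} (f : P ⟶ (τ.functor.obj a ⟶[V] b))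
    (g : Q ⟶ (τ.functor.obj a' ⟶[V] b')) :
    (f ⊗ₘ g) ≫ dayMap τ a a' b b' =
      f ⊠ᵍ g ≫ eHomWhiskerRight V (δ (ordinary τ.functor) a a') _ := by
  rw [dayMap, gradedTensor, Category.assoc]

lemma dayMap_eq (a a' : S) (b b' : T) : dayMap τ a a' b b' =
    𝟙 (τ.functor.obj a ⟶[V] b) ⊠ᵍ 𝟙 (τ.functor.obj a' ⟶[V] b') ≫
      eHomWhiskerRight V (δ (ordinary τ.functor) a a') _ := by
  rw [id_gradedTensor_id, dayMap]

lemma dayMap_natural {P P' Q Q' : V} {a₁ a₁' a₂ a₂' : S} {b₁ b₂ : T} (f₁ : P ⟶ (a₁ ⟶[V] a₁'))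
    (f₂ : Q ⟶ (a₂ ⟶[V] a₂')) (g₁ : P' ⟶ (τ.functor.obj a₁' ⟶[V] b₁))
    (g₂ : Q' ⟶ (τ.functor.obj a₂' ⟶[V] b₂)) :
    tensorμ P Q P' Q' ≫ ((f₁ ≫ τ.functor.map _ _) ⋆ᵍ g₁ ⊗ₘ (f₂ ≫ τ.functor.map _ _) ⋆ᵍ g₂) ≫
        dayMap τ a₁ a₂ b₁ b₂ =
      ((f₁ ⊠ᵍ f₂) ≫ τ.functor.map _ _) ⋆ᵍ ((g₁ ⊗ₘ g₂) ≫ dayMap τ a₁' a₂' b₁ b₂) := by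
  rw [comp_dayMap, comp_dayMap, ← post_gradedComp, Category.assoc, ← τ.gradedTensor_map_δ,
    pre_gradedComp, gradedTensor_gradedComp, Category.assoc]

lemma dayMap_gradedComp_tensorMap (a a' : S) (b b' c c' : T) :
    dayMap τ a a' b b' ⋆ᵍ tensorMap (V := V) b c b' c' =
      tensorμ _ _ _ _ ≫ (eComp V _ _ _ ⊗ₘ eComp V _ _ _) ≫ dayMap τ a a' c c' := by
  rw [dayMap_eq, pre_gradedComp, ← id_gradedTensor_id, gradedTensor_gradedComp, comp_dayMap,
    id_gradedComp_id, id_gradedComp_id, Category.assoc]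

lemma dayMap_braiding (a a' : S) (b b' : T) :
    dayMap τ a a' b b' ≫ eHomWhiskerLeft V _ (β_ b b').hom =
      (β_ _ _).hom ≫ dayMap τ a' a b' b ≫
        eHomWhiskerRight V ((ordinary τ.functor).map (β_ a a').hom) _ := by
  rw [dayMap_eq, dayMap_eq, Category.assoc, ← eHom_whisker_exchange,
    reassoc_of% gradedTensor_braiding, Category.assoc, ← eHomWhiskerRight_comp,
    ← eHomWhiskerRight_comp, Functor.map_braiding]
  simp

lemma dayMap_associator (a₁ a₂ a₃ : S) (b₁ b₂ b₃ : T) :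
    dayMap τ a₁ a₂ b₁ b₂ ▷ (τ.functor.obj a₃ ⟶[V] b₃) ≫ dayMap τ (a₁ ⊗ a₂) a₃ (b₁ ⊗ b₂) b₃ ≫
        eHomWhiskerLeft V _ (α_ b₁ b₂ b₃).hom =
      (α_ _ _ _).hom ≫ (τ.functor.obj a₁ ⟶[V] b₁) ◁ dayMap τ a₂ a₃ b₂ b₃ ≫
        dayMap τ a₁ (a₂ ⊗ a₃) b₁ (b₂ ⊗ b₃) ≫
          eHomWhiskerRight V ((ordinary τ.functor).map (α_ a₁ a₂ a₃).hom) _ := by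
  rw [← MonoidalCategory.tensorHom_id, reassoc_of% comp_dayMap, ← MonoidalCategory.id_tensorHom,
    reassoc_of% comp_dayMap, dayMap_eq, dayMap_eq, gradedTensor_pre_left, gradedTensor_pre_right,
    Category.assoc, Category.assoc, ← eHom_whisker_exchange, ← eHom_whisker_exchange_assoc,
    reassoc_of% gradedTensor_associator]
  simp only [← eHomWhiskerRight_comp]
  refine congrArg (fun k => (α_ _ _ _).hom ≫ _ ≫ eHomWhiskerRight V k (b₁ ⊗ b₂ ⊗ b₃)) ?_
  exact (Category.assoc _ _ _).trans ((Functor.OplaxMonoidal.associativity (F := ordinary τ.functor)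
    a₁ a₂ a₃).trans (Category.assoc _ _ _).symm)

lemma dayMap_leftUnitor (a : S) (b : T) :
    eHomEquiv V (Functor.OplaxMonoidal.η (ordinary τ.functor)) ▷ (τ.functor.obj a ⟶[V] b) ≫
      dayMap τ (𝟙_ S) a (𝟙_ T) b ≫ eHomWhiskerLeft V _ (λ_ b).hom ≫
        eHomWhiskerRight V ((ordinary τ.functor).map (λ_ a).inv) _ = (λ_ _).hom := by
  have h : eHomEquiv V (Functor.OplaxMonoidal.η (ordinary τ.functor)) =
    eId V _ ≫ eHomWhiskerRight V (Functor.OplaxMonoidal.η (ordinary τ.functor)) _ := by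
      rw [← eHomEquiv_id, ← eHomEquiv_comp_right, Category.comp_id]
  rw [← MonoidalCategory.tensorHom_id, reassoc_of% comp_dayMap, h, gradedTensor_pre_left,
    Category.assoc, ← eHom_whisker_exchange_assoc, ← eHom_whisker_exchange_assoc,
    reassoc_of% eId_gradedTensor_leftUnitor]
  have e : (((ordinary τ.functor).map (λ_ a).inv ≫ δ (ordinary τ.functor) (𝟙_ S) a) ≫
      Functor.OplaxMonoidal.η (ordinary τ.functor) ▷ τ.functor.obj a) ≫
        (λ_ (τ.functor.obj a)).hom = 𝟙 _ := by
    have h := Functor.OplaxMonoidal.left_unitality (F := ordinary τ.functor) a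
    rw [Category.assoc _ (δ _ _ _)]
    exact (congrArg (· ≫ (λ_ (τ.functor.obj a)).hom) h.symm).trans (Iso.inv_hom_id _)
  rw [← eHomWhiskerRight_comp, ← eHomWhiskerRight_comp, ← eHomWhiskerRight_comp, e,
    eHomWhiskerRight_id, Category.comp_id, Category.comp_id]

end TensorProductOfMaps

section Tensorator

variable {V : Type v} [Category.{w} V] [MonoidalCategory V] [SymmetricCategory V]
  [MonoidalClosed V]
  {S : Type w} [Category.{v₁} S] [EnrichedOrdinaryCategory V S]
  [MonoidalCategory S] [SymmetricCategory S] [SymmetricMonoidalEnriched V S]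
  {T : Type u₂} [Category.{v₂} T] [EnrichedOrdinaryCategory V T]
  [MonoidalCategory T] [SymmetricCategory T] [SymmetricMonoidalEnriched V T]
  {C : Type u} [Category.{v₃} C] [EnrichedOrdinaryCategory V C]
  [MonoidalCategory C] [SymmetricCategory C] [SymmetricMonoidalEnriched V C]
  {τ : SymmetricMonoidalVFunctor V S T} {G : SymmetricMonoidalVFunctor V S C}
  {K : EnrichedFunctor V T C} {η : ∀ a : S, G.functor.obj a ⟶ K.obj (τ.functor.obj a)}

lemma kanι_post (a : S) {b b' : T} (f : b ⟶ b') :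
    kanι η a b ≫ eHomWhiskerLeft V _ ((ordinary K).map f) =
      eHomWhiskerLeft V _ f ≫ kanι η a b' := by
  rw [kanι, kanι, Category.assoc, ← eHom_whisker_exchange, ← reassoc_of% eHomWhiskerLeft_map]

lemma IsPointwiseLeftKan.kanι_pre (hK : IsPointwiseLeftKan τ.functor G.functor K η) {a a' : S}
    (b : T) (s : a ⟶ a') :
    kanι η a' b ≫ eHomWhiskerRight V ((ordinary G.functor).map s) _ =
      eHomWhiskerRight V ((ordinary τ.functor).map s) _ ≫ kanι η a b := by
  have h := hK.comp_kanι (eHomEquiv V s) (𝟙 (τ.functor.obj a' ⟶[V] b))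
  rw [← eHomEquiv_ordinary_map, ← eHomEquiv_ordinary_map, eHomEquiv_gradedComp,
    eHomEquiv_gradedComp, Category.id_comp, Category.id_comp, Category.assoc, cancel_epi] at h
  exact h.symm

lemma post_leftUnitor_inv {P : V} {x x' : C} (f : P ⟶ (x ⟶[V] x')) :
    f ≫ eHomWhiskerLeft V _ (λ_ x').inv =
      (λ_ P).inv ≫ eId V (𝟙_ C) ⊠ᵍ f ≫ eHomWhiskerRight V (λ_ x).inv _ := by
  have h := congrArg (fun k => (λ_ P).inv ≫ k ≫ eHomWhiskerLeft V _ (λ_ x').inv ≫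
    eHomWhiskerRight V (λ_ x).inv _) (eId_gradedTensor_leftUnitor f)
  simp only [Category.assoc, Iso.inv_hom_id_assoc] at h
  rw [← eHomWhiskerLeft_comp_assoc, Iso.hom_inv_id, eHomWhiskerLeft_id, Category.id_comp,
    eHom_whisker_exchange, ← eHomWhiskerRight_comp_assoc, Iso.inv_hom_id, eHomWhiskerRight_id,
    Category.id_comp] at h
  exact h.symm

lemma tensorμ_unit_second (P P' Q' : V) : tensorμ P (𝟙_ V) P' Q' =
    (ρ_ P).hom ▷ _ ≫ (α_ _ _ _).inv ≫ _ ◁ (λ_ Q').inv := by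
  rw [tensorμ, braiding_tensorUnit_left]
  monoidal

lemma tensorμ_unit_first (Q P' Q' : V) : tensorμ (𝟙_ V) Q P' Q' =
    (λ_ Q).hom ▷ _ ≫ (α_ _ _ _).inv ≫ (β_ Q P').hom ▷ _ ≫ (α_ _ _ _).hom ≫
      (λ_ P').inv ▷ _ := by
  rw [tensorμ]
  monoidal

/-- The maps `m b b' : K b ⊗ K b' ⟶ K (b ⊗ b')` are induced by the symmetric monoidal structures
of `τ` and `G`, for `K` the left Kan extension of `G` along `τ`. -/
def IsTensorator (τ : SymmetricMonoidalVFunctor V S T) (G : SymmetricMonoidalVFunctor V S C)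
    (η : ∀ a : S, G.functor.obj a ⟶ K.obj (τ.functor.obj a))
    (m : ∀ b b' : T, K.obj b ⊗ K.obj b' ⟶ K.obj (b ⊗ b')) : Prop :=
  ∀ a a' b b', kanι η a b ⊠ᵍ kanι η a' b' ≫ eHomWhiskerLeft V _ (m b b') =
    dayMap τ a a' b b' ≫ kanι η (a ⊗ a') (b ⊗ b') ≫
      eHomWhiskerRight V (μ (ordinary G.functor) a a') _

/-- The coprojections of `K (b ⊗ b')` at the objects `a ⊗ a'` form a cocone for the colimit in two
variables `K b ⊗ K b'`, which induces the tensorator. -/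
lemma exists_isTensorator
    (hleft : ∀ A : C, PreservesWeightedColimits (V := V) (tensorLeftV A))
    (hright : ∀ A : C, PreservesWeightedColimits (V := V) (tensorRightV A))
    (hK : IsPointwiseLeftKan τ.functor G.functor K η) :
    ∃ m : ∀ b b' : T, K.obj b ⊗ K.obj b' ⟶ K.obj (b ⊗ b'), IsTensorator τ G η m := by
  -- Naturality in both variables at once; the two conditions are the cases where one of `f₁` and
  -- `f₂` is an identity.
  have key : ∀ {P P' Q Q' : V} {a₁ a₁' a₂ a₂' : S} {b₁ b₂ : T} (f₁ : P ⟶ (a₁ ⟶[V] a₁'))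
    (f₂ : Q ⟶ (a₂ ⟶[V] a₂')) (g₁ : P' ⟶ (τ.functor.obj a₁' ⟶[V] b₁))
    (g₂ : Q' ⟶ (τ.functor.obj a₂' ⟶[V] b₂)),
      tensorμ P Q P' Q' ≫ ((f₁ ≫ τ.functor.map _ _) ⋆ᵍ g₁ ⊗ₘ (f₂ ≫ τ.functor.map _ _) ⋆ᵍ g₂) ≫
        dayMap τ a₁ a₂ b₁ b₂ ≫ kanι η (a₁ ⊗ a₂) (b₁ ⊗ b₂) ≫
          eHomWhiskerRight V (μ (ordinary G.functor) a₁ a₂) _ =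
      ((f₁ ≫ G.functor.map _ _) ⊠ᵍ (f₂ ≫ G.functor.map _ _)) ⋆ᵍ
        ((g₁ ⊗ₘ g₂) ≫ dayMap τ a₁' a₂' b₁ b₂ ≫ kanι η (a₁' ⊗ a₂') (b₁ ⊗ b₂) ≫
          eHomWhiskerRight V (μ (ordinary G.functor) a₁' a₂') _) := by
    intro P P' Q Q' a₁ a₁' a₂ a₂' b₁ b₂ f₁ f₂ g₁ g₂
    rw [reassoc_of% dayMap_natural, reassoc_of% hK.comp_kanι, ← pre_gradedComp, Category.assoc,
      ← G.gradedTensor_map_μ, post_gradedComp]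
    simp only [Category.assoc]
  choose m hm using fun b b' => hK.exists_hom_tensor hleft hright b b'
    (fun a a' => dayMap τ a a' b b' ≫ kanι η (a ⊗ a') (b ⊗ b') ≫
      eHomWhiskerRight V (μ (ordinary G.functor) a a') _)
    (fun a₁ a₂ a' => by
      have h := key (𝟙 (a₁ ⟶[V] a₂)) (eId V a') (𝟙 (τ.functor.obj a₂ ⟶[V] b))
        (𝟙 (τ.functor.obj a' ⟶[V] b'))
      rw [Category.id_comp, Category.id_comp, τ.functor.map_id, G.functor.map_id, eId_gradedComp,
        Category.comp_id, MonoidalCategory.id_tensorHom_id, Category.id_comp, tensorμ_unit_second,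
        ← Iso.hom_inv_id_assoc (ρ_ _) (G.functor.map a₁ a₂ ⊠ᵍ _), ← gradedWhiskerRight,
        comp_gradedComp] at h
      rw [← Iso.inv_comp_eq, ← cancel_epi ((ρ_ (a₁ ⟶[V] a₂)).hom ▷ _), ← h,
        MonoidalCategory.tensorHom_def']
      simp)
    (fun a a₁ a₂ => by
      have h := key (eId V a) (𝟙 (a₁ ⟶[V] a₂)) (𝟙 (τ.functor.obj a ⟶[V] b))
        (𝟙 (τ.functor.obj a₂ ⟶[V] b'))
      rw [Category.id_comp, Category.id_comp, τ.functor.map_id, G.functor.map_id, eId_gradedComp,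
        Category.comp_id, MonoidalCategory.id_tensorHom_id, Category.id_comp, tensorμ_unit_first,
        ← Iso.hom_inv_id_assoc (λ_ _) (_ ⊠ᵍ G.functor.map a₁ a₂), ← gradedWhiskerLeft,
        comp_gradedComp] at h
      rw [← cancel_epi ((α_ _ _ _).inv ≫ (β_ _ _).hom ▷ _ ≫ (α_ _ _ _).hom),
        ← cancel_epi ((λ_ (a₁ ⟶[V] a₂)).hom ▷ _)]
      simp only [Category.assoc, Iso.hom_inv_id_assoc]
      rw [← MonoidalCategory.comp_whiskerRight_assoc, SymmetricCategory.symmetry,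
        MonoidalCategory.id_whiskerRight, Category.id_comp, Iso.inv_hom_id_assoc, ← h,
        MonoidalCategory.tensorHom_def]
      simp)
  exact ⟨m, fun a a' b b' => hm b b' a a'⟩

/-- The unit `𝟙 ⟶ K 𝟙` of the left Kan extension `K` of `G` along `τ`. -/
def kanUnit (τ : SymmetricMonoidalVFunctor V S T)
    (G : SymmetricMonoidalVFunctor V S C)
    (η : ∀ a : S, G.functor.obj a ⟶ K.obj (τ.functor.obj a)) : 𝟙_ C ⟶ K.obj (𝟙_ T) :=
  ε (ordinary G.functor) ≫ η (𝟙_ S) ≫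
    (ordinary K).map (Functor.OplaxMonoidal.η (ordinary τ.functor))

lemma eHomEquiv_kanUnit : eHomEquiv V (kanUnit τ G η) =
    eHomEquiv V (Functor.OplaxMonoidal.η (ordinary τ.functor)) ≫ kanι η (𝟙_ S) (𝟙_ T) ≫
      eHomWhiskerRight V (ε (ordinary G.functor)) _ := by
  rw [kanUnit, eHomEquiv_comp_right, eHomEquiv_comp_right, eHomEquiv_ordinary_map, kanι]
  simp only [Category.assoc]

namespace IsTensorator

variable {m : ∀ b b' : T, K.obj b ⊗ K.obj b' ⟶ K.obj (b ⊗ b')}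

lemma jointlyEpic_tensor
    (hleft : ∀ A : C, PreservesWeightedColimits (V := V) (tensorLeftV A))
    (hright : ∀ A : C, PreservesWeightedColimits (V := V) (tensorRightV A))
    (hK : IsPointwiseLeftKan τ.functor G.functor K η) (b b' : T) :
    JointlyEpic (fun p : S × S => kanι η p.1 b ⊠ᵍ kanι η p.2 b') :=
  ((hK.isStablyEpic b).tensor hleft hright (hK.isStablyEpic b')).jointlyEpic

lemma unique (hleft : ∀ A : C, PreservesWeightedColimits (V := V) (tensorLeftV A))
    (hright : ∀ A : C, PreservesWeightedColimits (V := V) (tensorRightV A))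
    (hK : IsPointwiseLeftKan τ.functor G.functor K η) (hm : IsTensorator τ G η m)
    {m' : ∀ b b' : T, K.obj b ⊗ K.obj b' ⟶ K.obj (b ⊗ b')} (hm' : IsTensorator τ G η m')
    (b b' : T) : m b b' = m' b b' :=
  (jointlyEpic_tensor hleft hright hK b b').hom_ext fun p => by rw [hm, hm']

lemma natural (hleft : ∀ A : C, PreservesWeightedColimits (V := V) (tensorLeftV A))
    (hright : ∀ A : C, PreservesWeightedColimits (V := V) (tensorRightV A))
    (hK : IsPointwiseLeftKan τ.functor G.functor K η) (hm : IsTensorator τ G η m)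
    (b c b' c' : T) :
    K.map b c ⊠ᵍ K.map b' c' ≫ eHomWhiskerLeft V _ (m c c') =
      tensorMap b c b' c' ≫ K.map _ _ ≫ eHomWhiskerRight V (m b b') _ := by
  refine jointlyEpic_tensor hleft hright hK b b' _ _ fun p => ?_
  rw [gradedComp_post, gradedTensor_gradedComp, kanι_gradedComp_map, kanι_gradedComp_map,
    comp_gradedTensor_comp, Category.assoc, Category.assoc, hm, ← Category.assoc _ (K.map _ _),
    ← post_gradedComp, hm, ← Category.assoc (dayMap τ p.1 p.2 b b'), pre_gradedComp,
    comp_kanι_gradedComp, dayMap_gradedComp_tensorMap]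
  simp only [Category.assoc]

lemma braided (hleft : ∀ A : C, PreservesWeightedColimits (V := V) (tensorLeftV A))
    (hright : ∀ A : C, PreservesWeightedColimits (V := V) (tensorRightV A))
    (hK : IsPointwiseLeftKan τ.functor G.functor K η) (hm : IsTensorator τ G η m) (b b' : T) :
    m b b' ≫ (ordinary K).map (β_ b b').hom = (β_ _ _).hom ≫ m b' b := by
  refine (jointlyEpic_tensor hleft hright hK b b').hom_ext fun p => ?_
  rw [eHomWhiskerLeft_comp, eHomWhiskerLeft_comp, reassoc_of% hm, ← eHom_whisker_exchange,
    reassoc_of% kanι_post, reassoc_of% dayMap_braiding, reassoc_of% gradedTensor_braiding,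
    ← eHom_whisker_exchange, reassoc_of% hm, ← eHomWhiskerRight_comp,
    ← reassoc_of% hK.kanι_pre, ← eHomWhiskerRight_comp, Functor.LaxBraided.braided]

lemma associativity (hleft : ∀ A : C, PreservesWeightedColimits (V := V) (tensorLeftV A))
    (hright : ∀ A : C, PreservesWeightedColimits (V := V) (tensorRightV A))
    (hK : IsPointwiseLeftKan τ.functor G.functor K η) (hm : IsTensorator τ G η m)
    (b₁ b₂ b₃ : T) :
    m b₁ b₂ ▷ K.obj b₃ ≫ m (b₁ ⊗ b₂) b₃ ≫ (ordinary K).map (α_ b₁ b₂ b₃).hom =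
      (α_ _ _ _).hom ≫ K.obj b₁ ◁ m b₂ b₃ ≫ m b₁ (b₂ ⊗ b₃) := by
  refine (((hK.isStablyEpic b₁).tensor hleft hright (hK.isStablyEpic b₂)).tensor hleft hright
    (hK.isStablyEpic b₃)).jointlyEpic.hom_ext ?_
  rintro ⟨⟨a₁, a₂⟩, a₃⟩
  have e₁ : (kanι η a₁ b₁ ⊠ᵍ kanι η a₂ b₂) ⊠ᵍ kanι η a₃ b₃ ≫ eHomWhiskerLeft V _
      (m b₁ b₂ ▷ K.obj b₃) = dayMap τ a₁ a₂ b₁ b₂ ▷ _ ≫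
        kanι η (a₁ ⊗ a₂) (b₁ ⊗ b₂) ⊠ᵍ kanι η a₃ b₃ ≫
          eHomWhiskerRight V (μ (ordinary G.functor) a₁ a₂ ▷ _) _ := by
    rw [← gradedTensor_post_left, hm, comp_gradedTensor, gradedTensor_pre_left]
  have e₂ : kanι η a₁ b₁ ⊠ᵍ (kanι η a₂ b₂ ⊠ᵍ kanι η a₃ b₃) ≫ eHomWhiskerLeft V _
      (K.obj b₁ ◁ m b₂ b₃) = _ ◁ dayMap τ a₂ a₃ b₂ b₃ ≫
        kanι η a₁ b₁ ⊠ᵍ kanι η (a₂ ⊗ a₃) (b₂ ⊗ b₃) ≫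
          eHomWhiskerRight V (_ ◁ μ (ordinary G.functor) a₂ a₃) _ := by
    rw [← gradedTensor_post_right, hm, gradedTensor_comp, gradedTensor_pre_right]
  simp only [eHomWhiskerLeft_comp]
  rw [reassoc_of% e₁, ← eHom_whisker_exchange_assoc, reassoc_of% hm, ← eHom_whisker_exchange,
    ← eHom_whisker_exchange_assoc, reassoc_of% kanι_post, reassoc_of% dayMap_associator,
    reassoc_of% gradedTensor_associator, ← eHom_whisker_exchange_assoc, reassoc_of% e₂,
    ← eHom_whisker_exchange, ← eHom_whisker_exchange_assoc, reassoc_of% hm,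
    ← reassoc_of% hK.kanι_pre]
  simp only [← eHomWhiskerRight_comp, Category.assoc]
  have e := Functor.LaxMonoidal.associativity (F := ordinary G.functor) a₁ a₂ a₃
  exact congrArg (fun k => (α_ _ _ _).hom ≫ _ ◁ dayMap τ a₂ a₃ b₂ b₃ ≫ dayMap τ a₁ _ b₁ _ ≫
    kanι η _ (b₁ ⊗ b₂ ⊗ b₃) ≫ eHomWhiskerRight V k _) e

lemma left_unitality (hK : IsPointwiseLeftKan τ.functor G.functor K η)
    (hm : IsTensorator τ G η m) (b : T) :
    (λ_ (K.obj b)).hom = kanUnit τ G η ▷ K.obj b ≫ m (𝟙_ T) b ≫ (ordinary K).map (λ_ b).hom := by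
  rw [← cancel_epi (λ_ (K.obj b)).inv, Iso.inv_hom_id]
  refine (hK.jointlyEpic b).hom_ext fun a => ?_
  have e₂ := post_leftUnitor_inv (kanι η a b)
  have e₃ : eId V (𝟙_ C) ≫ eHomWhiskerLeft V _ (kanUnit τ G η) =
      eHomEquiv V (kanUnit τ G η) := by
    rw [← eHomEquiv_id, ← eHomEquiv_comp_left, Category.id_comp]
  have e₄ : (λ_ (G.functor.obj a)).inv ≫ ε (ordinary G.functor) ▷ G.functor.obj a ≫
      μ (ordinary G.functor) (𝟙_ S) a = (ordinary G.functor).map (λ_ a).inv :=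
    Functor.LaxMonoidal.left_unitality_inv (F := ordinary G.functor) a
  rw [eHomWhiskerLeft_comp, eHomWhiskerLeft_comp, eHomWhiskerLeft_comp, reassoc_of% e₂,
    ← eHom_whisker_exchange_assoc, ← eHom_whisker_exchange_assoc, ← eHom_whisker_exchange,
    ← reassoc_of% gradedTensor_post_left, e₃, eHomEquiv_kanUnit, comp_gradedTensor,
    gradedTensor_pre_left, Category.assoc, Category.assoc, ← eHom_whisker_exchange_assoc,
    reassoc_of% hm, ← eHom_whisker_exchange_assoc, ← eHom_whisker_exchange_assoc,
    reassoc_of% kanι_post, ← eHomWhiskerRight_comp, ← eHomWhiskerRight_comp, Category.assoc, e₄]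
  have e₅ := hK.kanι_pre b (λ_ a).inv
  have e₆ := reassoc_of% dayMap_leftUnitor (τ := τ) a b
  rw [e₅, e₆, Iso.inv_hom_id_assoc, eHomWhiskerLeft_id, Category.comp_id]

end IsTensorator

end Tensorator

/-! ### Convolution of representable presheaves -/

section Convolution

variable {V : Type v} [Category.{w} V] [MonoidalCategory V] [SymmetricCategory V]
  [MonoidalClosed V] [HasColimits V]
  {T : Type w} [Category.{v₂} T] [EnrichedOrdinaryCategory V T]
  [MonoidalCategory T] [SymmetricCategory T] [SymmetricMonoidalEnriched V T]

/-- The coprojection to the convolution of the presheaves represented by `b₁` and `b₂`. -/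
def representableπ (b₁ b₂ t a₁ a₂ : T) :
    (t ⟶[V] (a₁ ⊗ a₂ : T)) ⊗ ((a₁ ⟶[V] b₁) ⊗ (a₂ ⟶[V] b₂)) ⟶
      convolution (representable b₁ : Presheaf V T) (representable b₂) t :=
  convolutionπ (representable b₁ : Presheaf V T) (representable b₂) t a₁ a₂

lemma representableπ_condition (b₁ b₂ t a₁ a₂ a₁' a₂' : T) :
    (_ ◁ (tensorμ _ _ _ _ ≫ (eComp V a₁ a₁' b₁ ⊗ₘ eComp V a₂ a₂' b₂))) ≫
        representableπ b₁ b₂ t a₁ a₂ =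
      (α_ _ _ _).inv ≫ ((_ ◁ tensorMap a₁ a₁' a₂ a₂') ≫ eComp V t _ _) ▷ _ ≫
        representableπ b₁ b₂ t a₁' a₂' := by
  have h := convolution_condition (representable b₁ : Presheaf V T) (representable b₂)
    t a₁ a₂ a₁' a₂'
  rw [representable_act, representable_act] at h
  exact h

/-- The component at `t` of the canonical map from the convolution of the presheaves represented
by `b₁` and `b₂` to the presheaf represented by `b₁ ⊗ b₂`. -/
def convolutionRepresentable (b₁ b₂ t : T) :
    convolution (representable b₁ : Presheaf V T) (representable b₂) t ⟶ (t ⟶[V] (b₁ ⊗ b₂ : T)) :=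
  Multicoequalizer.desc (dayIndex (representable b₁ : Presheaf V T) (representable b₂) t) _
    (fun p => 𝟙 (t ⟶[V] (p.1 ⊗ p.2 : T)) ⋆ᵍ tensorMap p.1 b₁ p.2 b₂)
    (fun p => by
      have h : (_ ◁ (tensorμ _ _ _ _ ≫ (eComp V p.1.1 p.2.1 b₁ ⊗ₘ eComp V p.1.2 p.2.2 b₂))) ≫
          𝟙 (t ⟶[V] (p.1.1 ⊗ p.1.2 : T)) ⋆ᵍ tensorMap p.1.1 b₁ p.1.2 b₂ =
        ((α_ _ _ _).inv ≫ ((_ ◁ tensorMap p.1.1 p.2.1 p.1.2 p.2.2) ≫ eComp V t _ _) ▷ _) ≫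
          𝟙 (t ⟶[V] (p.2.1 ⊗ p.2.2 : T)) ⋆ᵍ tensorMap p.2.1 b₁ p.2.2 b₂ := by
        rw [← MonoidalCategory.id_tensorHom _ (tensorMap p.1.1 p.2.1 p.1.2 p.2.2), ← gradedComp,
          ← gradedComp_comp, Category.assoc, Category.assoc, ← tensorMap_comp, ← comp_gradedComp,
          Category.comp_id, gradedComp_assoc, Iso.inv_hom_id_assoc]
        rfl
      rw [← representable_act, ← representable_act] at h
      exact h)

lemma representableπ_convolutionRepresentable (b₁ b₂ t a₁ a₂ : T) :
    representableπ b₁ b₂ t a₁ a₂ ≫ convolutionRepresentable (V := V) b₁ b₂ t =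
      𝟙 (t ⟶[V] (a₁ ⊗ a₂ : T)) ⋆ᵍ tensorMap a₁ b₁ a₂ b₂ :=
  Multicoequalizer.π_desc _ _ _ _ _

/-- The convolution of representable presheaves is represented by the tensor product. The inverse
is the coprojection at `(b₁, b₂)`, evaluated at the identities. -/
instance (b₁ b₂ t : T) : IsIso (convolutionRepresentable (V := V) b₁ b₂ t) := by
  refine ⟨((ρ_ _).inv ≫ _ ◁ ((λ_ (𝟙_ V)).inv ≫ (eId V b₁ ⊗ₘ eId V b₂))) ≫
    representableπ b₁ b₂ t b₁ b₂, ?_, ?_⟩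
  · refine Multicoequalizer.hom_ext _ _ _ fun p => ?_
    obtain ⟨a₁, a₂⟩ := p
    change representableπ b₁ b₂ t a₁ a₂ ≫ _ = representableπ b₁ b₂ t a₁ a₂ ≫ _
    rw [reassoc_of% representableπ_convolutionRepresentable, Category.comp_id]
    have h := congrArg (fun k => (t ⟶[V] (a₁ ⊗ a₂ : T)) ◁ ((ρ_ _).inv ≫
      _ ◁ ((λ_ (𝟙_ V)).inv ≫ (eId V b₁ ⊗ₘ eId V b₂))) ≫ k)
        (representableπ_condition b₁ b₂ t a₁ a₂ b₁ b₂)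
    have e : ((ρ_ ((a₁ ⟶[V] b₁) ⊗ (a₂ ⟶[V] b₂))).inv ≫
        _ ◁ ((λ_ (𝟙_ V)).inv ≫ (eId V b₁ ⊗ₘ eId V b₂))) ≫
          tensorμ _ _ _ _ ≫ (eComp V a₁ b₁ b₁ ⊗ₘ eComp V a₂ b₂ b₂) = 𝟙 _ := by
      have e₁ := gradedComp_eId (𝟙 (a₁ ⟶[V] b₁))
      have e₂ := gradedComp_eId (𝟙 (a₂ ⟶[V] b₂))
      rw [gradedComp, MonoidalCategory.id_tensorHom, Category.comp_id] at e₁ e₂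
      have e₃ := tensorμ_natural_right (a₁ ⟶[V] b₁) (a₂ ⟶[V] b₂) (eId V b₁) (eId V b₂)
      rw [MonoidalCategory.whiskerLeft_comp, Category.assoc, Category.assoc, reassoc_of% e₃,
        MonoidalCategory.tensorHom_comp_tensorHom, e₁, e₂, ← tensor_right_unitality]
      simp
    rw [← MonoidalCategory.whiskerLeft_comp_assoc, e, MonoidalCategory.whiskerLeft_id,
      Category.id_comp] at h
    rw [h, gradedComp, MonoidalCategory.id_tensorHom]
    have e₄ : ∀ {P Q R Z : V} (f : P ⟶ Q) (k : 𝟙_ V ⟶ R) (g : Q ⊗ R ⟶ Z),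
        f ≫ ((ρ_ Q).inv ≫ Q ◁ k) ≫ g = ((ρ_ P).inv ≫ P ◁ k) ≫ f ▷ R ≫ g := by
      intro P Q R Z f k g
      simp only [Category.assoc, MonoidalCategory.whisker_exchange_assoc]
      rw [MonoidalCategory.rightUnitor_inv_naturality_assoc]
    rw [e₄]
    simp
  · rw [Category.assoc, representableπ_convolutionRepresentable, Category.assoc, ← gradedComp_comp]
    have h := tensorMap_homEquiv (V := V) (𝟙 b₁) (𝟙 b₂)
    rw [eHomEquiv_id, eHomEquiv_id, MonoidalCategory.id_tensorHom_id, eHomEquiv_id] at h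
    rw [Category.assoc, h, gradedComp_eId, Iso.inv_hom_id_assoc]

end Convolution

section Pattern

variable {V : Type v} [Category.{w} V] [MonoidalCategory V] [SymmetricCategory V]
  [MonoidalClosed V] [HasColimits V]
  {S : Type w} [Category.{v₁} S] [EnrichedOrdinaryCategory V S]
  [MonoidalCategory S] [SymmetricCategory S] [SymmetricMonoidalEnriched V S]
  {T : Type w} [Category.{v₂} T] [EnrichedOrdinaryCategory V T]
  [MonoidalCategory T] [SymmetricCategory T] [SymmetricMonoidalEnriched V T]
  {τ : SymmetricMonoidalVFunctor V S T}

/-- On representable presheaves, the comparison map is the tensor product of maps, followed by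
composition. -/
lemma convolutionπ_comparison (b₁ b₂ : T) (c a₁ a₂ : S) :
    convolutionπ ((representable b₁ : Presheaf V T).restrict τ.functor)
        ((representable b₂ : Presheaf V T).restrict τ.functor) c a₁ a₂ ≫
      comparison τ (representable b₁) (representable b₂) c ≫
        convolutionRepresentable b₁ b₂ (τ.functor.obj c) =
      τ.functor.map c (a₁ ⊗ a₂) ⋆ᵍ dayMap τ a₁ a₂ b₁ b₂ := by
  have h : convolutionπ ((representable b₁ : Presheaf V T).restrict τ.functor)
        ((representable b₂ : Presheaf V T).restrict τ.functor) c a₁ a₂ ≫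
      comparison τ (representable b₁) (representable b₂) c =
      comparisonAux τ (representable b₁) (representable b₂) c a₁ a₂ :=
    Multicoequalizer.π_desc _ _ _ _ _
  refine ((reassoc_of% h) _).trans ((Category.assoc _ _ _).trans ?_)
  have h' : ((τ.functor.map c (a₁ ⊗ a₂) ≫ eHomWhiskerLeft V _ (δ (ordinary τ.functor) a₁ a₂)) ▷ _) ≫
      representableπ b₁ b₂ (τ.functor.obj c) (τ.functor.obj a₁) (τ.functor.obj a₂) ≫
        convolutionRepresentable b₁ b₂ (τ.functor.obj c) =
      τ.functor.map c (a₁ ⊗ a₂) ⋆ᵍ dayMap τ a₁ a₂ b₁ b₂ := by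
    rw [representableπ_convolutionRepresentable, ← comp_gradedComp, Category.comp_id,
      post_gradedComp, dayMap]
  exact h'

/-- For a pattern `τ`, the object `T(τ c, b₁ ⊗ b₂)` is the coend
`∫^(a₁, a₂) S(c, a₁ ⊗ a₂) ⊗ (T(τ a₁, b₁) ⊗ T(τ a₂, b₂))`. -/
lemma IsPattern.exists_desc (hτ : IsPattern τ) (b₁ b₂ : T) (c : S) {Z : V}
    (φ : ∀ a₁ a₂ : S, (c ⟶[V] (a₁ ⊗ a₂ : S)) ⊗
      ((τ.functor.obj a₁ ⟶[V] b₁) ⊗ (τ.functor.obj a₂ ⟶[V] b₂)) ⟶ Z)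
    (hφ : ∀ a₁ a₁' a₂ a₂' : S, _ ◁ (tensorμ _ _ _ _ ≫
        (τ.functor.map a₁ a₁' ⋆ᵍ 𝟙 (τ.functor.obj a₁' ⟶[V] b₁) ⊗ₘ
          τ.functor.map a₂ a₂' ⋆ᵍ 𝟙 (τ.functor.obj a₂' ⟶[V] b₂))) ≫ φ a₁ a₂ =
      (α_ _ _ _).inv ≫
        (𝟙 (c ⟶[V] (a₁ ⊗ a₂ : S)) ⋆ᵍ tensorMap a₁ a₁' a₂ a₂') ▷ _ ≫ φ a₁' a₂') :
    ∃ ψ : (τ.functor.obj c ⟶[V] (b₁ ⊗ b₂ : T)) ⟶ Z, ∀ a₁ a₂,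
      (τ.functor.map c (a₁ ⊗ a₂) ⋆ᵍ dayMap τ a₁ a₂ b₁ b₂) ≫ ψ = φ a₁ a₂ := by
  have := hτ.isIso_comparison (representable b₁) (representable b₂) c
  let f : convolution ((representable b₁ : Presheaf V T).restrict τ.functor)
      ((representable b₂ : Presheaf V T).restrict τ.functor) c ⟶ Z :=
    Multicoequalizer.desc (dayIndex _ _ c) _ (fun p => φ p.1 p.2) (fun p => by
      have h := hφ p.1.1 p.2.1 p.1.2 p.2.2
      rw [← restrict_representable_act, ← restrict_representable_act] at h
      refine h.trans ?_
      refine Eq.trans ?_ (Category.assoc _ _ _).symm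
      rw [gradedComp, MonoidalCategory.id_tensorHom]
      rfl)
  refine ⟨inv (comparison τ (representable b₁) (representable b₂) c ≫
    convolutionRepresentable b₁ b₂ (τ.functor.obj c)) ≫ f, fun a₁ a₂ => ?_⟩
  rw [← convolutionπ_comparison]
  refine (Category.assoc _ _ _).trans ?_
  rw [IsIso.hom_inv_id_assoc]
  exact Multicoequalizer.π_desc _ _ _ _ _

/-- The coend `T(τ c, b₁ ⊗ b₂)` is preserved by `Y ⊗ -`, as `V` is closed. -/
lemma IsPattern.hom_ext (hτ : IsPattern τ) {b₁ b₂ : T} {c : S} {Y Z : V}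
    {f g : Y ⊗ (τ.functor.obj c ⟶[V] (b₁ ⊗ b₂ : T)) ⟶ Z}
    (h : ∀ a₁ a₂, Y ◁ (τ.functor.map c (a₁ ⊗ a₂) ⋆ᵍ dayMap τ a₁ a₂ b₁ b₂) ≫ f =
      Y ◁ (τ.functor.map c (a₁ ⊗ a₂) ⋆ᵍ dayMap τ a₁ a₂ b₁ b₂) ≫ g) : f = g := by
  have := hτ.isIso_comparison (representable b₁) (representable b₂) c
  apply MonoidalClosed.curry_injective
  rw [← cancel_epi (comparison τ (representable b₁) (representable b₂) c ≫
    convolutionRepresentable b₁ b₂ (τ.functor.obj c))]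
  refine Multicoequalizer.hom_ext _ _ _ fun p => ?_
  have e := congrArg MonoidalClosed.curry (h p.1 p.2)
  rw [MonoidalClosed.curry_natural_left, MonoidalClosed.curry_natural_left,
    ← convolutionπ_comparison] at e
  exact (Category.assoc _ _ _).symm.trans (e.trans (Category.assoc _ _ _))

lemma IsPattern.hom_ext' (hτ : IsPattern τ) {b₁ b₂ : T} {c : S} {Z : V}
    {f g : (τ.functor.obj c ⟶[V] (b₁ ⊗ b₂ : T)) ⟶ Z}
    (h : ∀ a₁ a₂, (τ.functor.map c (a₁ ⊗ a₂) ⋆ᵍ dayMap τ a₁ a₂ b₁ b₂) ≫ f =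
      (τ.functor.map c (a₁ ⊗ a₂) ⋆ᵍ dayMap τ a₁ a₂ b₁ b₂) ≫ g) : f = g := by
  rw [← cancel_epi (λ_ _).hom]
  refine hτ.hom_ext fun a₁ a₂ => ?_
  rw [MonoidalCategory.leftUnitor_naturality_assoc, MonoidalCategory.leftUnitor_naturality_assoc, h]

end Pattern

/-! ### Invertibility of the tensorator -/

section Invertible

variable {V : Type v} [Category.{w} V] [MonoidalCategory V] [SymmetricCategory V]
  [MonoidalClosed V] [HasColimits V]
  {S : Type w} [Category.{v₁} S] [EnrichedOrdinaryCategory V S]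
  [MonoidalCategory S] [SymmetricCategory S] [SymmetricMonoidalEnriched V S]
  {T : Type w} [Category.{v₂} T] [EnrichedOrdinaryCategory V T]
  [MonoidalCategory T] [SymmetricCategory T] [SymmetricMonoidalEnriched V T]
  {C : Type u} [Category.{v₃} C] [EnrichedOrdinaryCategory V C]
  [MonoidalCategory C] [SymmetricCategory C] [SymmetricMonoidalEnriched V C]
  {τ : SymmetricMonoidalVFunctor V S T} {G : SymmetricMonoidalVFunctor V S C}
  {K : EnrichedFunctor V T C} {η : ∀ a : S, G.functor.obj a ⟶ K.obj (τ.functor.obj a)}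

/-- The coprojection of `K b₁ ⊗ K b₂`, as a map out of `G (a₁ ⊗ a₂)`. -/
def dayι (G : SymmetricMonoidalVFunctor V S C)
    (η : ∀ a : S, G.functor.obj a ⟶ K.obj (τ.functor.obj a)) (a₁ a₂ : S) (b₁ b₂ : T) :
    (τ.functor.obj a₁ ⟶[V] b₁) ⊗ (τ.functor.obj a₂ ⟶[V] b₂) ⟶
      (G.functor.obj (a₁ ⊗ a₂) ⟶[V] (K.obj b₁ ⊗ K.obj b₂ : C)) :=
  kanι η a₁ b₁ ⊠ᵍ kanι η a₂ b₂ ≫ eHomWhiskerRight V (δ (ordinary G.functor) a₁ a₂) _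

lemma dayι_natural (hK : IsPointwiseLeftKan τ.functor G.functor K η) (a₁ a₁' a₂ a₂' : S)
    (b₁ b₂ : T) :
    tensorμ _ _ _ _ ≫ (τ.functor.map a₁ a₁' ⋆ᵍ 𝟙 (τ.functor.obj a₁' ⟶[V] b₁) ⊗ₘ
        τ.functor.map a₂ a₂' ⋆ᵍ 𝟙 (τ.functor.obj a₂' ⟶[V] b₂)) ≫ dayι G η a₁ a₂ b₁ b₂ =
      (tensorMap a₁ a₁' a₂ a₂' ≫ G.functor.map _ _) ⋆ᵍ dayι G η a₁' a₂' b₁ b₂ := by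
  have e : ∀ a a' b, τ.functor.map a a' ⋆ᵍ 𝟙 (τ.functor.obj a' ⟶[V] b) ≫ kanι η a b =
      G.functor.map a a' ⋆ᵍ kanι η a' b := fun a a' b => by
    have h := hK.comp_kanι (𝟙 (a ⟶[V] a')) (𝟙 (τ.functor.obj a' ⟶[V] b))
    rwa [Category.id_comp, Category.id_comp, Category.id_comp] at h
  have e' := G.gradedTensor_map_δ (𝟙 (a₁ ⟶[V] a₁')) (𝟙 (a₂ ⟶[V] a₂'))
  rw [Category.id_comp, Category.id_comp, id_gradedTensor_id] at e'
  rw [dayι, ← reassoc_of% comp_gradedTensor_comp, e, e, ← reassoc_of% gradedTensor_gradedComp,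
    ← pre_gradedComp, e', ← Category.assoc, post_gradedComp, dayι]

/-- The map `K (b₁ ⊗ b₂) ⟶ K b₁ ⊗ K b₂` for a left Kan extension `K` along a pattern. -/
lemma IsPattern.exists_cotensorator (hτ : IsPattern τ)
    (hK : IsPointwiseLeftKan τ.functor G.functor K η) (b₁ b₂ : T) :
    ∃ f : K.obj (b₁ ⊗ b₂) ⟶ K.obj b₁ ⊗ K.obj b₂, ∀ a₁ a₂ c,
      (τ.functor.map c (a₁ ⊗ a₂) ⋆ᵍ dayMap τ a₁ a₂ b₁ b₂) ≫ kanι η c (b₁ ⊗ b₂) ≫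
        eHomWhiskerLeft V _ f = G.functor.map c (a₁ ⊗ a₂) ⋆ᵍ dayι G η a₁ a₂ b₁ b₂ := by
  have h : ∀ c, ∃ ψ : (τ.functor.obj c ⟶[V] (b₁ ⊗ b₂ : T)) ⟶
      (G.functor.obj c ⟶[V] (K.obj b₁ ⊗ K.obj b₂ : C)), ∀ a₁ a₂,
        (τ.functor.map c (a₁ ⊗ a₂) ⋆ᵍ dayMap τ a₁ a₂ b₁ b₂) ≫ ψ =
          G.functor.map c (a₁ ⊗ a₂) ⋆ᵍ dayι G η a₁ a₂ b₁ b₂ := fun c => by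
    refine hτ.exists_desc b₁ b₂ c _ fun a₁ a₁' a₂ a₂' => ?_
    rw [← gradedComp_comp, Category.assoc, dayι_natural hK, ← comp_gradedComp, gradedComp_map,
      gradedComp_assoc, Iso.inv_hom_id_assoc, Category.id_comp]
  choose ψ hψ using h
  obtain ⟨f, hf⟩ := hK.exists_hom (b₁ ⊗ b₂) ψ fun c c' => hτ.hom_ext fun a₁ a₂ => by
    have e := gradedComp_map τ.functor (𝟙 (c ⟶[V] c')) (𝟙 (c' ⟶[V] (a₁ ⊗ a₂ : S)))
    have e' := gradedComp_map G.functor (𝟙 (c ⟶[V] c')) (𝟙 (c' ⟶[V] (a₁ ⊗ a₂ : S)))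
    rw [Category.id_comp, Category.id_comp] at e e'
    rw [← reassoc_of% gradedComp_comp, ← gradedComp_comp, hψ, Category.comp_id, gradedComp_assoc',
      gradedComp_assoc', ← e, ← e', comp_gradedComp, comp_gradedComp]
    simp only [Category.assoc]
    rw [hψ]
  exact ⟨f, fun a₁ a₂ c => by rw [hf, hψ]⟩

/-- For a pattern, the maps `K b₁ ⊗ K b₂ ⟶ K (b₁ ⊗ b₂)` are invertible: `K (b₁ ⊗ b₂)` is a
colimit of `G c` weighted by `T(τ c, b₁ ⊗ b₂)`, which is itself the coend of
`S(c, a₁ ⊗ a₂) ⊗ (T(τ a₁, b₁) ⊗ T(τ a₂, b₂))`. -/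
lemma IsTensorator.isIso (hτ : IsPattern τ)
    (hleft : ∀ A : C, PreservesWeightedColimits (V := V) (tensorLeftV A))
    (hright : ∀ A : C, PreservesWeightedColimits (V := V) (tensorRightV A))
    (hK : IsPointwiseLeftKan τ.functor G.functor K η)
    {m : ∀ b b' : T, K.obj b ⊗ K.obj b' ⟶ K.obj (b ⊗ b')} (hm : IsTensorator τ G η m)
    (b₁ b₂ : T) : IsIso (m b₁ b₂) := by
  obtain ⟨f, hf⟩ := hτ.exists_cotensorator hK b₁ b₂
  refine ⟨f, (jointlyEpic_tensor hleft hright hK b₁ b₂).hom_ext fun p => ?_,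
    (hK.jointlyEpic _).hom_ext fun c => hτ.hom_ext' fun a₁ a₂ => ?_⟩
  · have e : dayMap τ p.1 p.2 b₁ b₂ ≫ kanι η (p.1 ⊗ p.2) (b₁ ⊗ b₂) ≫ eHomWhiskerLeft V _ f =
        dayι G η p.1 p.2 b₁ b₂ := by
      have h := congrArg (fun k => eId V (p.1 ⊗ p.2) ▷ _ ≫ k) (hf p.1 p.2 (p.1 ⊗ p.2))
      rwa [← reassoc_of% comp_gradedComp, ← comp_gradedComp, τ.functor.map_id, G.functor.map_id,
        eId_gradedComp, eId_gradedComp, Category.assoc, cancel_epi] at h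
    rw [eHomWhiskerLeft_comp, reassoc_of% hm, ← eHom_whisker_exchange, reassoc_of% e, dayι,
      Category.assoc, ← eHomWhiskerRight_comp, Functor.Monoidal.μ_δ, eHomWhiskerRight_id,
      eHomWhiskerLeft_id]
  · rw [eHomWhiskerLeft_comp, reassoc_of% hf, ← gradedComp_post, dayι, Category.assoc,
      ← eHom_whisker_exchange, reassoc_of% hm, ← eHomWhiskerRight_comp, Functor.Monoidal.δ_μ,
      eHomWhiskerRight_id, eHomWhiskerLeft_id, Category.comp_id, Category.comp_id]
    have h := hK.comp_kanι (𝟙 (c ⟶[V] (a₁ ⊗ a₂ : S))) (dayMap τ a₁ a₂ b₁ b₂)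
    rw [Category.id_comp, Category.id_comp] at h
    exact h.symm

/-- For a pattern, the map `𝟙 ⟶ K 𝟙` is invertible: `K 𝟙` is a colimit of `G c` weighted by
`T(τ c, 𝟙) ≅ S(c, 𝟙)`, that is, `G 𝟙`. -/
lemma isIso_kanUnit (hτ : IsPattern τ) (hK : IsPointwiseLeftKan τ.functor G.functor K η) :
    IsIso (kanUnit τ G η) := by
  have := hτ.isIso_comparisonUnit
  have e : ∀ c c', eComp V c c' (𝟙_ S) ≫ comparisonUnit τ c =
      τ.functor.map c c' ⋆ᵍ comparisonUnit τ c' := fun c c' => by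
    rw [comparisonUnit, comparisonUnit, gradedComp_post, ← id_gradedComp_id,
      reassoc_of% gradedComp_map, Category.id_comp, Category.id_comp]
  obtain ⟨f, hf⟩ := hK.exists_hom (𝟙_ T) (fun c => inv (comparisonUnit τ c) ≫
      G.functor.map c (𝟙_ S) ≫
        eHomWhiskerLeft V _ (Functor.OplaxMonoidal.η (ordinary G.functor))) fun c c' => by
    rw [← cancel_epi (_ ◁ comparisonUnit τ c'), ← reassoc_of% gradedComp_comp,
      ← gradedComp_comp, Category.comp_id, ← e, Category.assoc, IsIso.hom_inv_id_assoc,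
      IsIso.hom_inv_id_assoc, gradedComp_post, ← id_gradedComp_id, reassoc_of% gradedComp_map,
      Category.id_comp, Category.id_comp]
  refine ⟨f, ?_, ?_⟩
  · apply (eHomEquiv V).injective
    have h : eHomEquiv V (Functor.OplaxMonoidal.η (ordinary τ.functor)) =
        eId V (𝟙_ S) ≫ comparisonUnit τ (𝟙_ S) := by
      rw [comparisonUnit, τ.functor.map_id_assoc, ← eHomEquiv_id, ← eHomEquiv_comp_left,
        Category.id_comp]
    rw [eHomEquiv_comp_left, eHomEquiv_kanUnit, Category.assoc, Category.assoc,
      ← eHom_whisker_exchange, reassoc_of% hf, h, Category.assoc, IsIso.hom_inv_id_assoc,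
      G.functor.map_id_assoc, ← eHomEquiv_id, ← reassoc_of% eHomEquiv_comp_left,
      ← eHomEquiv_comp_right, Category.id_comp, Functor.Monoidal.ε_η]
  · refine (hK.jointlyEpic _).hom_ext fun c => ?_
    rw [← cancel_epi (comparisonUnit τ c), eHomWhiskerLeft_comp, reassoc_of% hf,
      IsIso.hom_inv_id_assoc, ← eHomWhiskerLeft_comp, kanUnit, Functor.Monoidal.η_ε_assoc,
      eHomWhiskerLeft_comp, eHomWhiskerLeft_id, Category.comp_id]
    have h := hK.comp_kanι (𝟙 (c ⟶[V] 𝟙_ S)) (eId V (τ.functor.obj (𝟙_ S)))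
    rw [Category.id_comp, Category.id_comp, gradedComp_eId, eId_kanι, gradedComp_eHomEquiv,
      Category.assoc, cancel_epi] at h
    rw [← reassoc_of% h, kanι_post, comparisonUnit, Category.assoc]

end Invertible

/-! ### The symmetric monoidal structure of a left Kan extension -/

section MonoidalStructure

variable {V : Type v} [Category.{w} V] [MonoidalCategory V] [SymmetricCategory V]

/-- A strong braided monoidal structure on a functor is determined by its lax part. -/
lemma braided_ext {C : Type u₁} [Category.{v₁} C] [MonoidalCategory C] [BraidedCategory C]
    {D : Type u₂} [Category.{v₂} D] [MonoidalCategory D] [BraidedCategory D] {F : C ⥤ D}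
    {h h' : F.Braided} (hε : h.ε = h'.ε) (hμ : h.μ = h'.μ) : h = h' := by
  apply Functor.Braided.toMonoidal_injective
  refine Functor.Monoidal.ext hε hμ ?_ (funext₂ fun X Y => ?_)
  · calc h.η = h.η ≫ h'.ε ≫ h'.η :=
          ((congrArg (h.η ≫ ·) h'.ε_η).trans (Category.comp_id _)).symm
      _ = (h.η ≫ h.ε) ≫ h'.η := by rw [hε, Category.assoc]
      _ = h'.η := (congrArg (· ≫ h'.η) h.η_ε).trans (Category.id_comp _)
  · calc h.δ X Y = h.δ X Y ≫ h'.μ X Y ≫ h'.δ X Y :=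
          ((congrArg (h.δ X Y ≫ ·) (h'.μ_δ X Y)).trans (Category.comp_id _)).symm
      _ = (h.δ X Y ≫ h.μ X Y) ≫ h'.δ X Y := by rw [hμ, Category.assoc]
      _ = h'.δ X Y := (congrArg (· ≫ h'.δ X Y) (h.δ_μ X Y)).trans (Category.id_comp _)

lemma SymmetricMonoidalStructure.ext {C : Type u₁} [Category.{v₁} C] [EnrichedOrdinaryCategory V C]
    [MonoidalCategory C] [SymmetricCategory C] [SymmetricMonoidalEnriched V C]
    {D : Type u₂} [Category.{v₂} D] [EnrichedOrdinaryCategory V D]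
    [MonoidalCategory D] [SymmetricCategory D] [SymmetricMonoidalEnriched V D]
    {F : EnrichedFunctor V C D} {M M' : SymmetricMonoidalStructure F}
    (hε : M.braided.ε = M'.braided.ε) (hμ : ∀ X Y, M.braided.μ X Y = M'.braided.μ X Y) :
    M = M' := by
  obtain @⟨h, hn⟩ := M
  obtain @⟨h', hn'⟩ := M'
  obtain rfl : h = h' := braided_ext hε (funext₂ hμ)
  rfl

variable [MonoidalClosed V]
  {S : Type w} [Category.{v₁} S] [EnrichedOrdinaryCategory V S]
  [MonoidalCategory S] [SymmetricCategory S] [SymmetricMonoidalEnriched V S]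
  {T : Type u₂} [Category.{v₂} T] [EnrichedOrdinaryCategory V T]
  [MonoidalCategory T] [SymmetricCategory T] [SymmetricMonoidalEnriched V T]
  {C : Type u} [Category.{v₃} C] [EnrichedOrdinaryCategory V C]
  [MonoidalCategory C] [SymmetricCategory C] [SymmetricMonoidalEnriched V C]
  {τ : SymmetricMonoidalVFunctor V S T} {G : SymmetricMonoidalVFunctor V S C}

lemma SymmetricMonoidalVFunctor.comp_μ (τ : SymmetricMonoidalVFunctor V S T)
    (H : SymmetricMonoidalVFunctor V T C) (a b : S) :
    μ (ordinary (τ.comp H).functor) a b =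
      μ (ordinary H.functor) (τ.functor.obj a) (τ.functor.obj b) ≫
        (ordinary H.functor).map (μ (ordinary τ.functor) a b) :=
  braidedComp_μ τ.functor H.functor a b

lemma SymmetricMonoidalVFunctor.comp_ε (τ : SymmetricMonoidalVFunctor V S T)
    (H : SymmetricMonoidalVFunctor V T C) :
    ε (ordinary (τ.comp H).functor) =
      ε (ordinary H.functor) ≫ (ordinary H.functor).map (ε (ordinary τ.functor)) :=
  braidedComp_ε τ.functor H.functor

/-- The maps `η a` are monoidal exactly if the symmetric monoidal structure of `H` is the one
induced by those of `τ` and `G`. -/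
lemma isMonoidalFamily_comp_iff (H : SymmetricMonoidalVFunctor V T C)
    (η : ∀ a : S, G.functor.obj a ⟶ H.functor.obj (τ.functor.obj a)) :
    IsMonoidalFamily G (τ.comp H) η ↔
      ε (ordinary H.functor) = kanUnit τ G η ∧
        IsTensorator τ G η (fun b b' => μ (ordinary H.functor) b b') := by
  have hunit : ε (ordinary G.functor) ≫ η (𝟙_ S) =
      ε (ordinary H.functor) ≫ (ordinary H.functor).map (ε (ordinary τ.functor)) ↔
        ε (ordinary H.functor) = kanUnit τ G η := by
    rw [kanUnit]
    constructor
    · intro h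
      rw [← Category.assoc, h, Category.assoc, ← Functor.map_comp, Functor.Monoidal.ε_η,
        CategoryTheory.Functor.map_id, Category.comp_id]
    · intro h
      rw [h, Category.assoc, Category.assoc, ← Functor.map_comp, Functor.Monoidal.η_ε,
        CategoryTheory.Functor.map_id, Category.comp_id]
  have htensor : (∀ a b, μ (ordinary G.functor) a b ≫ η (a ⊗ b) = (η a ⊗ₘ η b) ≫
      μ (ordinary H.functor) (τ.functor.obj a) (τ.functor.obj b) ≫
        (ordinary H.functor).map (μ (ordinary τ.functor) a b)) ↔
          IsTensorator τ G η (fun b b' => μ (ordinary H.functor) b b') := by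
    constructor
    · intro h a a' b b'
      have h' : (η a ⊗ₘ η a') ≫ μ (ordinary H.functor) (τ.functor.obj a) (τ.functor.obj a') =
          μ (ordinary G.functor) a a' ≫ η (a ⊗ a') ≫
            (ordinary H.functor).map (δ (ordinary τ.functor) a a') := by
        rw [← Category.assoc (μ _ _ _), h a a', Category.assoc, Category.assoc,
          ← Functor.map_comp, Functor.Monoidal.μ_δ, CategoryTheory.Functor.map_id,
          Category.comp_id]
      have e := H.gradedTensor_map_μ (𝟙 (τ.functor.obj a ⟶[V] b)) (𝟙 (τ.functor.obj a' ⟶[V] b'))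
      rw [Category.id_comp, Category.id_comp, id_gradedTensor_id] at e
      rw [kanι, kanι, gradedTensor_pre, Category.assoc, ← eHom_whisker_exchange, reassoc_of% e,
        ← eHomWhiskerRight_comp, h', eHomWhiskerRight_comp, eHomWhiskerRight_comp, dayMap, kanι]
      simp only [Category.assoc]
      rw [reassoc_of% eHomWhiskerRight_map]
    · intro h a b
      have h' := congrArg (fun k => (λ_ (𝟙_ V)).inv ≫
        (eId V (τ.functor.obj a) ⊗ₘ eId V (τ.functor.obj b)) ≫ k)
          (h a b (τ.functor.obj a) (τ.functor.obj b))
      have e : (λ_ (𝟙_ V)).inv ≫ (eId V (τ.functor.obj a) ⊗ₘ eId V (τ.functor.obj b)) ≫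
          dayMap τ a b _ _ = eHomEquiv V (δ (ordinary τ.functor) a b) := by
        have h := tensorMap_homEquiv (V := V) (𝟙 (τ.functor.obj a)) (𝟙 (τ.functor.obj b))
        rw [eHomEquiv_id, eHomEquiv_id] at h
        rw [dayMap, reassoc_of% h, ← eHomEquiv_comp_right, MonoidalCategory.id_tensorHom_id,
          Category.comp_id]
      have e' : eHomEquiv V (δ (ordinary τ.functor) a b) ≫ kanι η (a ⊗ b) _ =
          eHomEquiv V (η (a ⊗ b) ≫ (ordinary H.functor).map (δ (ordinary τ.functor) a b)) := by
        rw [kanι, ← Category.assoc, ← eHomEquiv_ordinary_map, ← eHomEquiv_comp_right]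
      beta_reduce at h'
      rw [reassoc_of% e, reassoc_of% e', ← eHomEquiv_comp_right,
        ← reassoc_of% comp_gradedTensor_comp, eId_kanι, eId_kanι,
        gradedTensor_eHomEquiv, Category.assoc, Iso.inv_hom_id_assoc,
        ← eHomEquiv_comp_left] at h'
      have h'' : (η a ⊗ₘ η b) ≫ μ (ordinary H.functor) (τ.functor.obj a) (τ.functor.obj b) =
          μ (ordinary G.functor) a b ≫ η (a ⊗ b) ≫
            (ordinary H.functor).map (δ (ordinary τ.functor) a b) := (eHomEquiv V).injective h'
      rw [← Category.assoc (η a ⊗ₘ η b), h'', Category.assoc, Category.assoc,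
        ← Functor.map_comp, Functor.Monoidal.δ_μ, CategoryTheory.Functor.map_id,
        Category.comp_id]
  constructor
  · intro h
    refine ⟨hunit.1 (h.unit.trans (τ.comp_ε H)), htensor.1 fun a b => (h.tensor a b).trans ?_⟩
    exact congrArg ((η a ⊗ₘ η b) ≫ ·) (τ.comp_μ H a b)
  · intro h
    refine ⟨(hunit.2 h.1).trans (τ.comp_ε H).symm, fun a b => (htensor.2 h.2 a b).trans ?_⟩
    exact congrArg ((η a ⊗ₘ η b) ≫ ·) (τ.comp_μ H a b).symm

end MonoidalStructure

section KanMonoidalStructure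

variable {V : Type v} [Category.{w} V] [MonoidalCategory V] [SymmetricCategory V]
  [MonoidalClosed V] [HasColimits V]
  {S : Type w} [Category.{v₁} S] [EnrichedOrdinaryCategory V S]
  [MonoidalCategory S] [SymmetricCategory S] [SymmetricMonoidalEnriched V S]
  {T : Type w} [Category.{v₂} T] [EnrichedOrdinaryCategory V T]
  [MonoidalCategory T] [SymmetricCategory T] [SymmetricMonoidalEnriched V T]
  {C : Type u} [Category.{v₃} C] [EnrichedOrdinaryCategory V C]
  [MonoidalCategory C] [SymmetricCategory C] [SymmetricMonoidalEnriched V C]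
  {τ : SymmetricMonoidalVFunctor V S T} {G : SymmetricMonoidalVFunctor V S C}
  {K : EnrichedFunctor V T C} {η : ∀ a : S, G.functor.obj a ⟶ K.obj (τ.functor.obj a)}

lemma IsTensorator.ordinary_natural
    (hleft : ∀ A : C, PreservesWeightedColimits (V := V) (tensorLeftV A))
    (hright : ∀ A : C, PreservesWeightedColimits (V := V) (tensorRightV A))
    (hK : IsPointwiseLeftKan τ.functor G.functor K η)
    {m : ∀ b b' : T, K.obj b ⊗ K.obj b' ⟶ K.obj (b ⊗ b')} (hm : IsTensorator τ G η m)
    {b c b' c' : T} (f : b ⟶ c) (g : b' ⟶ c') :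
    ((ordinary K).map f ⊗ₘ (ordinary K).map g) ≫ m c c' =
      m b b' ≫ (ordinary K).map (f ⊗ₘ g) := by
  apply (eHomEquiv V).injective
  have h := congrArg (fun k => (λ_ (𝟙_ V)).inv ≫ (eHomEquiv V f ⊗ₘ eHomEquiv V g) ≫ k)
    (hm.natural hleft hright hK b c b' c')
  beta_reduce at h
  rw [← reassoc_of% comp_gradedTensor_comp, ← eHomEquiv_ordinary_map, ← eHomEquiv_ordinary_map,
    gradedTensor_eHomEquiv, Category.assoc, Iso.inv_hom_id_assoc, ← eHomEquiv_comp_left,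
    reassoc_of% tensorMap_homEquiv, ← Category.assoc, ← eHomEquiv_ordinary_map,
    ← eHomEquiv_comp_right] at h
  exact h

/-- The tensorator and the unit map of a left Kan extension along a pattern form a symmetric
monoidal structure. -/
lemma exists_symmetricMonoidalStructure (hτ : IsPattern τ)
    (hleft : ∀ A : C, PreservesWeightedColimits (V := V) (tensorLeftV A))
    (hright : ∀ A : C, PreservesWeightedColimits (V := V) (tensorRightV A))
    (hK : IsPointwiseLeftKan τ.functor G.functor K η) :
    ∃ M : SymmetricMonoidalStructure K, IsMonoidalFamily G (τ.comp ⟨K, M⟩) η := by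
  obtain ⟨m, hm⟩ := exists_isTensorator hleft hright hK
  have := fun b b' => hm.isIso hτ hleft hright hK b b'
  have := isIso_kanUnit hτ hK
  let core : (ordinary K).CoreMonoidal :=
    { εIso := asIso (kanUnit τ G η)
      μIso b b' := asIso (m b b')
      μIso_hom_natural_left f b' := by
        have h := hm.ordinary_natural hleft hright hK f (𝟙 b')
        rw [CategoryTheory.Functor.map_id] at h
        rw [← MonoidalCategory.tensorHom_id, ← MonoidalCategory.tensorHom_id]
        exact h
      μIso_hom_natural_right b' f := by
        have h := hm.ordinary_natural hleft hright hK (𝟙 b') f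
        rw [CategoryTheory.Functor.map_id] at h
        rw [← MonoidalCategory.id_tensorHom, ← MonoidalCategory.id_tensorHom]
        exact h
      associativity b₁ b₂ b₃ := hm.associativity hleft hright hK b₁ b₂ b₃
      left_unitality b := hm.left_unitality hK b
      -- Right unitality follows from left unitality, by the braiding.
      right_unitality b := by
        have h₁ := hm.left_unitality hK b
        have h₂ := hm.braided hleft hright hK b (𝟙_ T)
        have h₃ := (ordinary K).congr_map (braiding_leftUnitor b)
        rw [Functor.map_comp] at h₃
        change _ = _ ◁ kanUnit τ G η ≫ m b (𝟙_ T) ≫ (ordinary K).map (ρ_ b).hom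
        rw [← h₃, reassoc_of% h₂, BraidedCategory.braiding_naturality_right_assoc]
        have h₄ := braiding_leftUnitor (K.obj b)
        rw [← h₄, h₁] }
  let str : (ordinary K).Braided :=
    { core.toMonoidal with
      braided b b' := hm.braided hleft hright hK b b' }
  refine ⟨⟨fun b c b' c' => ?_⟩, (isMonoidalFamily_comp_iff _ _).2 ⟨rfl, hm⟩⟩
  have h := hm.natural hleft hright hK b c b' c'
  rw [gradedTensor, Category.assoc] at h
  exact h

/-- The left Kan extension of a symmetric monoidal `V`-functor along a pattern has a unique
symmetric monoidal structure for which the unit is monoidal. -/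
lemma existsUnique_symmetricMonoidalStructure (hτ : IsPattern τ)
    (hleft : ∀ A : C, PreservesWeightedColimits (V := V) (tensorLeftV A))
    (hright : ∀ A : C, PreservesWeightedColimits (V := V) (tensorRightV A))
    (hK : IsPointwiseLeftKan τ.functor G.functor K η) :
    ∃! M : SymmetricMonoidalStructure K, IsMonoidalFamily G (τ.comp ⟨K, M⟩) η := by
  obtain ⟨M, hM⟩ := exists_symmetricMonoidalStructure hτ hleft hright hK
  refine ⟨M, hM, fun M' hM' => ?_⟩
  have h := (isMonoidalFamily_comp_iff ⟨K, M⟩ η).1 hM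
  have h' := (isMonoidalFamily_comp_iff ⟨K, M'⟩ η).1 hM'
  exact SymmetricMonoidalStructure.ext (h'.1.trans h.1.symm)
    fun b b' => h'.2.unique hleft hright hK h.2 b b'

end KanMonoidalStructure

/-! ### Monoidality of induced transformations -/

section Monoidality

variable {V : Type v} [Category.{w} V] [MonoidalCategory V] [SymmetricCategory V]

lemma tensorμ_braiding (P Q X Y : V) :
    tensorμ P Q X Y ≫ ((β_ P X).hom ⊗ₘ (β_ Q Y).hom) =
      (β_ (P ⊗ Q) (X ⊗ Y)).hom ≫ tensorμ X Y P Q := by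
  simp [tensorμ, SymmetricCategory.braiding_swap_eq_inv_braiding Y P]
  rw [MonoidalCategory.tensorHom_def]
  monoidal

/-- A family of maps `X ⟶ (F a ⟶[V] G a)` in `V` is compatible with the symmetric monoidal
structures of `F` and `G`, with respect to a comultiplication `d` and a counit `e` on `X`. No
coalgebra laws are required; for `X = 𝟙_ V` this is monoidality of a transformation, and for
cartesian `V`, with the diagonal of `X`, it is membership in the object of monoidal
transformations. -/
structure IsComonoidalFamily {S : Type u₁} [Category.{v₁} S] [EnrichedOrdinaryCategory V S]
    [MonoidalCategory S] [SymmetricCategory S] [SymmetricMonoidalEnriched V S]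
    {C : Type u} [Category.{v₃} C] [EnrichedOrdinaryCategory V C]
    [MonoidalCategory C] [SymmetricCategory C] [SymmetricMonoidalEnriched V C]
    {X : V} (d : X ⟶ X ⊗ X) (e : X ⟶ 𝟙_ V) (F G : SymmetricMonoidalVFunctor V S C)
    (α : ∀ a : S, X ⟶ (F.functor.obj a ⟶[V] G.functor.obj a)) : Prop where
  unit : α (𝟙_ S) ≫ eHomWhiskerRight V (ε (ordinary F.functor)) _ =
    e ≫ eHomEquiv V (ε (ordinary G.functor))
  tensor (a b : S) : α (a ⊗ b) ≫ eHomWhiskerRight V (μ (ordinary F.functor) a b) _ =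
    d ≫ α a ⊠ᵍ α b ≫ eHomWhiskerLeft V _ (μ (ordinary G.functor) a b)

section

variable {S : Type u₁} [Category.{v₁} S] [EnrichedOrdinaryCategory V S]
    [MonoidalCategory S] [SymmetricCategory S] [SymmetricMonoidalEnriched V S]
    {C : Type u} [Category.{v₃} C] [EnrichedOrdinaryCategory V C]
    [MonoidalCategory C] [SymmetricCategory C] [SymmetricMonoidalEnriched V C]
    {F G : SymmetricMonoidalVFunctor V S C}

lemma isComonoidalFamily_eHomEquiv_iff (φ : ∀ a : S, F.functor.obj a ⟶ G.functor.obj a) :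
    IsComonoidalFamily (λ_ (𝟙_ V)).inv (𝟙 _) F G (fun a => eHomEquiv V (φ a)) ↔
      IsMonoidalFamily F G φ := by
  have hu : eHomEquiv V (φ (𝟙_ S)) ≫ eHomWhiskerRight V (ε (ordinary F.functor)) _ =
      𝟙 _ ≫ eHomEquiv V (ε (ordinary G.functor)) ↔
        ε (ordinary F.functor) ≫ φ (𝟙_ S) = ε (ordinary G.functor) := by
    rw [← eHomEquiv_comp_right, Category.id_comp, (eHomEquiv V).injective.eq_iff]
  have ht : ∀ a b, eHomEquiv V (φ (a ⊗ b)) ≫ eHomWhiskerRight V (μ (ordinary F.functor) a b) _ =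
      (λ_ (𝟙_ V)).inv ≫ eHomEquiv V (φ a) ⊠ᵍ eHomEquiv V (φ b) ≫
        eHomWhiskerLeft V _ (μ (ordinary G.functor) a b) ↔
          μ (ordinary F.functor) a b ≫ φ (a ⊗ b) =
            (φ a ⊗ₘ φ b) ≫ μ (ordinary G.functor) a b := fun a b => by
    rw [gradedTensor_eHomEquiv, Category.assoc, Iso.inv_hom_id_assoc, ← eHomEquiv_comp_right,
      ← eHomEquiv_comp_left, (eHomEquiv V).injective.eq_iff]
  exact ⟨fun h => ⟨hu.1 h.unit, fun a b => (ht a b).1 (h.tensor a b)⟩,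
    fun h => ⟨hu.2 h.unit, fun a b => (ht a b).2 (h.tensor a b)⟩⟩

lemma isComonoidalFamily_diag_iff [IsCartesianMonoidal V] {X : V}
    (α : ∀ a : S, X ⟶ (F.functor.obj a ⟶[V] G.functor.obj a)) :
    IsComonoidalFamily (diag X) (counit X) F G α ↔ IsGradedMonoidal F G α := by
  have ht : ∀ a b, α a ⊠ᵍ α b ≫ eHomWhiskerLeft V _ (μ (ordinary G.functor) a b) =
      (α a ⊗ₘ α b) ≫ tensorMap _ _ _ _ ≫ eHomWhiskerLeft V _ (μ (ordinary G.functor) a b) :=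
    fun a b => by rw [gradedTensor, Category.assoc]
  exact ⟨fun h => ⟨h.unit, fun a b => (h.tensor a b).trans (congrArg (diag X ≫ ·) (ht a b))⟩,
    fun h => ⟨h.unit, fun a b => (h.tensor a b).trans (congrArg (diag X ≫ ·) (ht a b).symm)⟩⟩

end

variable [MonoidalClosed V]
  {S : Type w} [Category.{v₁} S] [EnrichedOrdinaryCategory V S]
  [MonoidalCategory S] [SymmetricCategory S] [SymmetricMonoidalEnriched V S]
  {T : Type u₂} [Category.{v₂} T] [EnrichedOrdinaryCategory V T]
  [MonoidalCategory T] [SymmetricCategory T] [SymmetricMonoidalEnriched V T]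
  {C : Type u} [Category.{v₃} C] [EnrichedOrdinaryCategory V C]
  [MonoidalCategory C] [SymmetricCategory C] [SymmetricMonoidalEnriched V C]
  {τ : SymmetricMonoidalVFunctor V S T} {G : SymmetricMonoidalVFunctor V S C}
  {K H : SymmetricMonoidalVFunctor V T C}
  {η : ∀ a : S, G.functor.obj a ⟶ K.functor.obj (τ.functor.obj a)}

lemma IsGradedVNatural.map_comm {F G : EnrichedFunctor V T C} {X : V}
    {α : ∀ a : T, X ⟶ (F.obj a ⟶[V] G.obj a)} (h : IsGradedVNatural V F G α) {a b : T}
    (f : a ⟶ b) :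
    α b ≫ eHomWhiskerRight V ((ordinary F).map f) _ =
      α a ≫ eHomWhiskerLeft V _ ((ordinary G).map f) := by
  have h₁ : F.map a b ⋆ᵍ α b = (β_ _ _).hom ≫ α a ⋆ᵍ G.map a b := h a b
  have h₂ := congrArg (fun k => (λ_ X).inv ≫ (eHomEquiv V f ▷ X) ≫ k) h₁
  beta_reduce at h₂
  rw [← comp_gradedComp, ← eHomEquiv_ordinary_map, eHomEquiv_gradedComp, Iso.inv_hom_id_assoc,
    BraidedCategory.braiding_naturality_left_assoc, ← gradedComp_comp, ← eHomEquiv_ordinary_map,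
    gradedComp_eHomEquiv] at h₂
  rw [h₂]
  simp

/-- A graded transformation out of a left Kan extension is monoidal if its restriction along the
unit is. -/
lemma IsComonoidalFamily.of_restrict
    (hleft : ∀ A : C, PreservesWeightedColimits (V := V) (tensorLeftV A))
    (hright : ∀ A : C, PreservesWeightedColimits (V := V) (tensorRightV A))
    (hK : IsPointwiseLeftKan τ.functor G.functor K.functor η)
    (hη : IsMonoidalFamily G (τ.comp K) η) {X : V} {d : X ⟶ X ⊗ X} {e : X ⟶ 𝟙_ V}
    {β : ∀ b, X ⟶ (K.functor.obj b ⟶[V] H.functor.obj b)}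
    (hβ : IsGradedVNatural V K.functor H.functor β)
    {α : ∀ a, X ⟶ (G.functor.obj a ⟶[V] H.functor.obj (τ.functor.obj a))}
    (hαβ : ∀ a, β (τ.functor.obj a) ≫ eHomWhiskerRight V (η a) _ = α a)
    (hα : IsComonoidalFamily d e G (τ.comp H) α) : IsComonoidalFamily d e K H β where
  unit := by
    have h : α (𝟙_ S) ≫ eHomWhiskerRight V (ε (ordinary G.functor)) _ =
        e ≫ eHomEquiv V
          (ε (ordinary H.functor) ≫ (ordinary H.functor).map (ε (ordinary τ.functor))) :=
      hα.unit.trans (congrArg (fun k => e ≫ eHomEquiv V k) (τ.comp_ε H))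
    rw [((isMonoidalFamily_comp_iff K η).1 hη).1, kanUnit, eHomWhiskerRight_comp,
      eHomWhiskerRight_comp, Category.assoc, ← Category.assoc (β _), hβ.map_comm, Category.assoc,
      eHom_whisker_exchange_assoc, ← Category.assoc (β _), hαβ, eHom_whisker_exchange,
      ← Category.assoc (α _), h, Category.assoc, ← eHomEquiv_comp_left, Category.assoc,
      ← Functor.map_comp, Functor.Monoidal.ε_η, CategoryTheory.Functor.map_id, Category.comp_id]
  tensor b b' := by
    have hm := ((isMonoidalFamily_comp_iff K η).1 hη).2
    refine IsTensorator.jointlyEpic_tensor hleft hright hK b b' _ _ fun p => ?_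
    obtain ⟨a, a'⟩ := p
    change (kanι η a b ⊠ᵍ kanι η a' b') ⋆ᵍ (β (b ⊗ b') ≫
        eHomWhiskerRight V (μ (ordinary K.functor) b b') _) =
      (kanι η a b ⊠ᵍ kanι η a' b') ⋆ᵍ (d ≫ β b ⊠ᵍ β b' ≫
        eHomWhiskerLeft V _ (μ (ordinary H.functor) b b'))
    have h : α (a ⊗ a') ≫ eHomWhiskerRight V (μ (ordinary G.functor) a a') _ =
        d ≫ α a ⊠ᵍ α a' ≫ eHomWhiskerLeft V _
          (μ (ordinary H.functor) (τ.functor.obj a) (τ.functor.obj a') ≫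
            (ordinary H.functor).map (μ (ordinary τ.functor) a a')) :=
      (hα.tensor a a').trans (congrArg (fun k => d ≫ α a ⊠ᵍ α a' ≫ eHomWhiskerLeft V _ k)
        (τ.comp_μ H a a'))
    have e₁ : ∀ a b, kanι η a b ⋆ᵍ β b = (β_ _ _).hom ≫ α a ⋆ᵍ H.functor.map _ b := fun a b => by
      rw [kanι_gradedComp_natural hβ, hαβ]
    have e₂ : dayMap τ a a' b b' ≫ H.functor.map _ _ ≫ eHomWhiskerRight V
        (μ (ordinary H.functor) (τ.functor.obj a) (τ.functor.obj a') ≫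
          (ordinary H.functor).map (μ (ordinary τ.functor) a a')) _ =
        H.functor.map (τ.functor.obj a) b ⊠ᵍ H.functor.map (τ.functor.obj a') b' ≫
          eHomWhiskerLeft V _ (μ (ordinary H.functor) b b') := by
      have e := H.gradedTensor_map_μ (𝟙 (τ.functor.obj a ⟶[V] b)) (𝟙 (τ.functor.obj a' ⟶[V] b'))
      rw [Category.id_comp, Category.id_comp, id_gradedTensor_id] at e
      rw [e, eHomWhiskerRight_comp, ← reassoc_of% eHomWhiskerRight_map, dayMap, Category.assoc,
        ← eHomWhiskerRight_comp_assoc, Functor.Monoidal.μ_δ, eHomWhiskerRight_id,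
        Category.id_comp]
    rw [← post_gradedComp, hm, ← Category.assoc (dayMap τ a a' b b'), pre_gradedComp,
      comp_gradedComp, e₁, Category.assoc, Category.assoc, ← pre_gradedComp, h,
      gradedComp_comp d, gradedComp_post, gradedTensor_gradedComp, e₁, e₁, comp_gradedTensor_comp,
      ← Category.assoc d, post_gradedComp, comp_gradedComp,
      BraidedCategory.braiding_naturality_left_assoc, MonoidalCategory.whisker_exchange_assoc,
      ← gradedComp_comp (dayMap τ a a' b b'),
      e₂, gradedComp_post, gradedTensor_gradedComp,
      ← BraidedCategory.braiding_naturality_right_assoc]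
    have e₃ := tensorμ_braiding (τ.functor.obj a ⟶[V] b) (τ.functor.obj a' ⟶[V] b') X X
    simp only [Category.assoc]
    rw [reassoc_of% e₃]

end Monoidality

/-! ### Comparison of adjunctions -/

section Comparison

/-- If the unit of `L ⊣ R` lies over the unit of `L₀ ⊣ R₀`, up to isomorphisms `φ`, then these are
natural, and the counit of `L ⊣ R` lies over the counit of `L₀ ⊣ R₀`. -/
lemma exists_iso_of_unit {X : Type u₁} [Category.{v₁} X] {Y : Type u₂} [Category.{v₂} Y]
    {X' : Type u} [Category.{v₃} X'] {Y' : Type u₃} [Category.{v} Y']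
    {L₀ : X ⥤ Y} {R₀ : Y ⥤ X} (adj₀ : L₀ ⊣ R₀) {L : X' ⥤ Y'} {R : Y' ⥤ X'} (adj : L ⊣ R)
    (U : X' ⥤ X) (W : Y' ⥤ Y) (i : R ⋙ U ≅ W ⋙ R₀)
    (φ : ∀ x, W.obj (L.obj x) ≅ L₀.obj (U.obj x))
    (hφ : ∀ x, U.map (adj.unit.app x) ≫ i.hom.app (L.obj x) ≫ R₀.map (φ x).hom =
      adj₀.unit.app (U.obj x)) :
    ∃ e : L ⋙ W ≅ U ⋙ L₀, (∀ x, e.hom.app x = (φ x).hom) ∧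
      ∀ y, e.hom.app (R.obj y) ≫ L₀.map (i.hom.app y) ≫ adj₀.counit.app (W.obj y) =
        W.map (adj.counit.app y) := by
  have hφ' : ∀ x, adj₀.unit.app (U.obj x) ≫ R₀.map (φ x).inv =
      U.map (adj.unit.app x) ≫ i.hom.app (L.obj x) := fun x => by
    rw [← hφ]
    simp [← Functor.map_comp]
  refine ⟨NatIso.ofComponents φ fun {x x'} f => ?_, fun x => rfl, fun y => ?_⟩
  · rw [← cancel_epi (φ x).inv]
    apply (adj₀.homEquiv _ _).injective
    have h₁ := i.hom.naturality (L.map f)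
    have h₂ := adj.unit.naturality f
    have h₃ := adj₀.unit.naturality (U.map f)
    simp only [Functor.comp_map, Functor.id_map] at h₁ h₂ h₃
    simp only [Adjunction.homEquiv_unit, Functor.comp_map, Functor.map_comp, Iso.inv_hom_id_assoc]
    rw [reassoc_of% hφ', ← reassoc_of% h₁, ← Functor.map_comp_assoc, ← h₂, Functor.map_comp,
      Category.assoc, hφ, h₃]
  · rw [← cancel_epi (φ (R.obj y)).inv]
    apply (adj₀.homEquiv _ _).injective
    have h₁ : U.map (R.map (adj.counit.app y)) ≫ i.hom.app y =
        i.hom.app (L.obj (R.obj y)) ≫ R₀.map (W.map (adj.counit.app y)) := i.hom.naturality _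
    have h₂ : i.hom.app y ≫ adj₀.unit.app (R₀.obj (W.obj y)) =
        adj₀.unit.app (U.obj (R.obj y)) ≫ R₀.map (L₀.map (i.hom.app y)) :=
      adj₀.unit.naturality (i.hom.app y)
    simp only [Adjunction.homEquiv_unit, Functor.map_comp, NatIso.ofComponents_hom_app,
      Iso.inv_hom_id_assoc]
    rw [reassoc_of% hφ', ← h₁, ← Functor.map_comp_assoc, adj.right_triangle_components,
      ← reassoc_of% h₂, adj₀.right_triangle_components]
    simp

end Comparison

/-! ### The adjunction between symmetric monoidal `V`-functors -/

section InducedAdjunction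

variable {V : Type v} [Category.{w} V] [MonoidalCategory V] [SymmetricCategory V]

lemma IsGradedVNatural.isVNatural {A : Type u₁} [EnrichedCategory V A] {B : Type u₂}
    [EnrichedCategory V B] {F G : EnrichedFunctor V A B}
    {α : ∀ a : A, 𝟙_ V ⟶ (F.obj a ⟶[V] G.obj a)} (h : IsGradedVNatural V F G α) :
    IsVNatural V F G α := fun a a' => by
  rw [h a a', rightUnitor_inv_braiding_assoc]

variable [MonoidalClosed V] [HasLimits V]
  {S : Type w} [Category.{v₁} S] [EnrichedOrdinaryCategory V S]
  [MonoidalCategory S] [SymmetricCategory S] [SymmetricMonoidalEnriched V S]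
  {T : Type w} [Category.{v₂} T] [EnrichedOrdinaryCategory V T]
  [MonoidalCategory T] [SymmetricCategory T] [SymmetricMonoidalEnriched V T]
  {C : Type u} [Category.{v₃} C] [EnrichedOrdinaryCategory V C]
  [MonoidalCategory C] [SymmetricCategory C] [SymmetricMonoidalEnriched V C]
  {τ : SymmetricMonoidalVFunctor V S T}

/-- The unit of a monoidal left Kan extension, as a monoidal transformation. -/
def monoidalUnit {G : SymmetricMonoidalVFunctor V S C} {K : SymmetricMonoidalVFunctor V T C}
    {η : ∀ a : S, G.functor.obj a ⟶ K.functor.obj (τ.functor.obj a)}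
    (hK : IsPointwiseLeftKan τ.functor G.functor K.functor η)
    (hη : IsMonoidalFamily G (τ.comp K) η) : G ⟶ τ.comp K :=
  MonoidalVNatTrans.mk η hK.unit_natural.isVNatural hη.unit hη.tensor

/-- The unit of a monoidal left Kan extension is a universal arrow to restriction between ordinary
categories of symmetric monoidal `V`-functors. -/
lemma existsUnique_monoidalUnit_comp
    (hleft : ∀ A : C, PreservesWeightedColimits (V := V) (tensorLeftV A))
    (hright : ∀ A : C, PreservesWeightedColimits (V := V) (tensorRightV A))
    {G : SymmetricMonoidalVFunctor V S C} {K : SymmetricMonoidalVFunctor V T C}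
    {η : ∀ a : S, G.functor.obj a ⟶ K.functor.obj (τ.functor.obj a)}
    (hK : IsPointwiseLeftKan τ.functor G.functor K.functor η)
    (hη : IsMonoidalFamily G (τ.comp K) η) (H : SymmetricMonoidalVFunctor V T C)
    (f : G ⟶ τ.comp H) :
    ∃! g : K ⟶ H, monoidalUnit hK hη ≫ (restrictionMonoidal C τ).map g = f := by
  have key : ∀ g : MonoidalVNatTrans K H,
      monoidalUnit hK hη ≫ (restrictionMonoidal C τ).map g = f ↔
        ∀ a, eHomEquiv V (g.app (τ.functor.obj a)) ≫ eHomWhiskerRight V (η a) _ =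
          eHomEquiv V (MonoidalVNatTrans.app f a) := fun g => by
    have e : ∀ a, eHomEquiv V (g.app (τ.functor.obj a)) ≫ eHomWhiskerRight V (η a) _ =
        eHomEquiv V (η a ≫ g.app (τ.functor.obj a)) := fun a => (eHomEquiv_comp_right _ _).symm
    exact ⟨fun h a => (e a).trans
        (congrArg (eHomEquiv V) (congrFun (congrArg MonoidalVNatTrans.app h) a)),
      fun h => MonoidalVNatTrans.ext (funext fun a =>
        (eHomEquiv V).injective ((e a).symm.trans (h a)))⟩
  have hf : IsMonoidalFamily G (τ.comp H) (MonoidalVNatTrans.app f) :=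
    ⟨MonoidalVNatTrans.unit f, MonoidalVNatTrans.tensor f⟩
  obtain ⟨β, hβ, hβf⟩ := hK.exists_graded (fun a => eHomEquiv V (MonoidalVNatTrans.app f a))
    (MonoidalVNatTrans.vnatural f).graded
  obtain ⟨φ, rfl⟩ : ∃ φ : ∀ b, K.functor.obj b ⟶ H.functor.obj b,
      β = fun b => eHomEquiv V (φ b) :=
    ⟨fun b => (eHomEquiv V).symm (β b), funext fun b => ((eHomEquiv V).apply_symm_apply _).symm⟩
  have hφ : IsMonoidalFamily K H φ := (isComonoidalFamily_eHomEquiv_iff φ).1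
    (IsComonoidalFamily.of_restrict hleft hright hK hη hβ hβf
      ((isComonoidalFamily_eHomEquiv_iff _).2 hf))
  refine ⟨MonoidalVNatTrans.mk φ hβ.isVNatural hφ.unit hφ.tensor, (key _).2 hβf, fun g hg => ?_⟩
  refine MonoidalVNatTrans.ext (funext fun b => (eHomEquiv V).injective ?_)
  exact congrFun (hK.graded_ext (MonoidalVNatTrans.vnatural g).graded hβ fun a =>
    ((key g).1 hg a).trans (hβf a).symm) b

/-- The unit of a monoidal left Kan extension is a universal arrow between `V`-categories of
symmetric monoidal `V`-functors. -/
lemma isUniversalArrow_restrictionMonoidalV [IsCartesianMonoidal V]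
    (hleft : ∀ A : C, PreservesWeightedColimits (V := V) (tensorLeftV A))
    (hright : ∀ A : C, PreservesWeightedColimits (V := V) (tensorRightV A))
    {K : SymmetricMonoidalVFunctor V S C → SymmetricMonoidalVFunctor V T C}
    {η : ∀ (G : SymmetricMonoidalVFunctor V S C) (a : S),
      G.functor.obj a ⟶ (K G).functor.obj (τ.functor.obj a)}
    (hK : ∀ G, IsPointwiseLeftKan τ.functor G.functor (K G).functor (η G))
    (hη : ∀ G, IsMonoidalFamily G (τ.comp (K G)) (η G))
    {u : ∀ G : SymmetricMonoidalVFunctor V S C, 𝟙_ V ⟶ (G ⟶[V] τ.comp (K G))}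
    (hu : ∀ G a, u G ≫ monProj G (τ.comp (K G)) a = eHomEquiv V (η G a)) :
    IsUniversalArrow (restrictionMonoidalV C τ) K u := by
  intro G H Z (f : Z ⟶ (G ⟶[V] τ.comp H))
  have e : ∀ (g : Z ⟶ (K G ⟶[V] H)) (a : S),
      (u G ⋆ᵍ (g ≫ restrictionMonoidalMap τ (K G) H)) ≫ monProj G (τ.comp H) a =
        (λ_ Z).hom ≫ (g ≫ monProj (K G) H (τ.functor.obj a)) ≫ eHomWhiskerRight V (η G a) _ :=
    fun g a => by
      rw [gradedComp, Category.assoc, eComp_monProj,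
        MonoidalCategory.tensorHom_comp_tensorHom_assoc, hu, Category.assoc,
        restrictionMonoidalMap_monProj]
      exact eHomEquiv_gradedComp _ _
  have key : ∀ g : Z ⟶ (K G ⟶[V] H),
      u G ⋆ᵍ (g ≫ restrictionMonoidalMap τ (K G) H) = (λ_ Z).hom ≫ f ↔
        ∀ a, (g ≫ monProj (K G) H (τ.functor.obj a)) ≫ eHomWhiskerRight V (η G a) _ =
          f ≫ monProj G (τ.comp H) a := fun g => by
    constructor
    · intro h a
      have h' := e g a
      rw [h, Category.assoc] at h'
      exact ((cancel_epi _).1 h').symm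
    · intro h
      refine mon_ext fun a => ?_
      rw [e, h, Category.assoc]
      rfl
  obtain ⟨β, hβ, hβf⟩ := (hK G).exists_graded _ ((monoidalProj_natural G (τ.comp H)).precomp f)
  have hβm : IsGradedMonoidal (K G) H β := (isComonoidalFamily_diag_iff β).1
    (IsComonoidalFamily.of_restrict hleft hright (hK G) (hη G) hβ hβf
      ((isComonoidalFamily_diag_iff _).2 ((monoidalProj_monoidal G (τ.comp H)).precomp f)))
  refine ⟨monoidalLift (K G) H β hβ hβm, (key _).2 fun a => ?_, fun g hg => mon_ext fun b => ?_⟩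
  · exact (congrArg (· ≫ _) (monoidalLift_proj (K G) H β hβ hβm _)).trans (hβf a)
  · refine Eq.trans ?_ (monoidalLift_proj (K G) H β hβ hβm b).symm
    exact congrFun ((hK G).graded_ext ((monoidalProj_natural (K G) H).precomp g) hβ fun a =>
      ((key g).1 hg a).trans (hβf a).symm) b

variable {L₀ : EnrichedFunctor V (EnrichedFunctor V S C) (EnrichedFunctor V T C)}

lemma eHomEquiv_unitComponent {τ : EnrichedFunctor V S T}
    (adj₀ : VAdjunction L₀ (restriction τ C)) (G : EnrichedFunctor V S C) (a : S) :
    eHomEquiv V (unitComponent adj₀ G a) =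
      ForgetEnrichment.homTo V (adj₀.adj.unit.app (ForgetEnrichment.of V G)) ≫
        natProj G (τ.comp V (L₀.obj G)) a :=
  Equiv.apply_symm_apply _ _

lemma forgetMonoidal_map_monoidalUnit {adj₀ : VAdjunction L₀ (restriction τ.functor C)}
    {G : SymmetricMonoidalVFunctor V S C} {M : SymmetricMonoidalStructure (L₀.obj G.functor)}
    (hK : IsPointwiseLeftKan τ.functor G.functor (L₀.obj G.functor)
      (unitComponent adj₀ G.functor))
    (hη : IsMonoidalFamily G (τ.comp ⟨L₀.obj G.functor, M⟩) (unitComponent adj₀ G.functor)) :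
    (forgetMonoidal S C).map (monoidalUnit hK hη) =
      adj₀.adj.unit.app (ForgetEnrichment.of V G.functor) := by
  refine forget_ext (nat_ext fun a => ?_)
  refine Eq.trans ?_ (eHomEquiv_unitComponent adj₀ G.functor a)
  exact natLift_proj _ _ _ (MonoidalVNatTrans.vnatural (monoidalUnit hK hη)).graded a

/-- The universal arrows given by the units of the monoidal left Kan extensions form an adjunction
which lies over `adj₀`, because its unit does. -/
lemma inducesAdjunction
    (hleft : ∀ A : C, PreservesWeightedColimits (V := V) (tensorLeftV A))
    (hright : ∀ A : C, PreservesWeightedColimits (V := V) (tensorRightV A))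
    (adj₀ : VAdjunction L₀ (restriction τ.functor C))
    (hK : ∀ G, IsPointwiseLeftKan τ.functor G (L₀.obj G) (unitComponent adj₀ G))
    (M : ∀ G : SymmetricMonoidalVFunctor V S C, SymmetricMonoidalStructure (L₀.obj G.functor))
    (hM : ∀ G : SymmetricMonoidalVFunctor V S C,
      IsMonoidalFamily G (τ.comp ⟨L₀.obj G.functor, M G⟩) (unitComponent adj₀ G.functor)) :
    InducesAdjunction τ L₀ adj₀ := by
  let L : SymmetricMonoidalVFunctor V S C → SymmetricMonoidalVFunctor V T C :=
    fun G => ⟨L₀.obj G.functor, M G⟩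
  let u : ∀ G, G ⟶ (restrictionMonoidal C τ).obj (L G) :=
    fun G => monoidalUnit (hK G.functor) (hM G)
  have h : ∀ G H (f : G ⟶ (restrictionMonoidal C τ).obj H),
      ∃! g : L G ⟶ H, u G ≫ (restrictionMonoidal C τ).map g = f :=
    fun G => existsUnique_monoidalUnit_comp hleft hright (hK G.functor) (hM G)
  have hunit : ∀ G, (forgetMonoidal S C).map ((adjunctionOfUniversal h).unit.app G) =
      adj₀.adj.unit.app (ForgetEnrichment.of V G.functor) := fun G =>
    (congrArg _ (adjunctionOfUniversal_unit h G)).trans (forgetMonoidal_map_monoidalUnit _ _)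
  -- Restriction commutes with forgetting the monoidal structures, with identity components.
  let i : restrictionMonoidal C τ ⋙ forgetMonoidal S C ≅
      forgetMonoidal T C ⋙ (restriction τ.functor C).forget :=
    NatIso.ofComponents (fun H => Iso.refl (ForgetEnrichment.of V (τ.functor.comp V H.functor)))
      fun {H H'} f => by
        refine (Category.comp_id _).trans (Eq.trans ?_ (Category.id_comp _).symm)
        refine forget_ext (nat_ext fun a => ?_)
        refine (natLift_proj _ _ _ ((restrictionMonoidal C τ).map f).vnatural.graded a).trans ?_
        have e₁ := restrictionMap_natProj τ.functor H.functor H'.functor a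
        have e₂ := natLift_proj H.functor H'.functor _
          (MonoidalVNatTrans.vnatural f).graded (τ.functor.obj a)
        refine Eq.trans e₂.symm (Eq.trans ?_ (Category.assoc _ _ _).symm)
        exact congrArg (natLift H.functor H'.functor _ (MonoidalVNatTrans.vnatural f).graded ≫ ·)
          e₁.symm
  have hR : ∀ K : EnrichedFunctor V T C,
      (restriction τ.functor C).forget.map (𝟙 (ForgetEnrichment.of V K)) = 𝟙 _ :=
    fun K => CategoryTheory.Functor.map_id _ _
  obtain ⟨e, he, he'⟩ := exists_iso_of_unit adj₀.adj (adjunctionOfUniversal h)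
    (forgetMonoidal S C) (forgetMonoidal T C) i (fun G => Iso.refl _) fun G => by
      refine Eq.trans ?_ ((Category.comp_id _).trans (hunit G))
      exact congrArg ((forgetMonoidal S C).map ((adjunctionOfUniversal h).unit.app G) ≫ ·)
        ((Category.id_comp _).trans (hR _))
  refine ⟨_, adjunctionOfUniversal h, e, fun G => ?_, fun H => ?_⟩
  · rw [he]
    refine Eq.trans ?_ ((Category.comp_id _).trans (hunit G))
    exact congrArg ((forgetMonoidal S C).map ((adjunctionOfUniversal h).unit.app G) ≫ ·) (hR _)
  · refine Eq.trans ?_ (he' H)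
    have hL : L₀.forget.map (𝟙 (ForgetEnrichment.of V (τ.comp H).functor)) = 𝟙 _ :=
      CategoryTheory.Functor.map_id _ _
    refine congrArg (e.hom.app (τ.comp H) ≫ ·) ?_
    exact ((congrArg (· ≫ adj₀.adj.counit.app (ForgetEnrichment.of V H.functor)) hL).trans
      (Category.id_comp _)).symm

lemma monι_restrictionMap [IsCartesianMonoidal V] (H H' : SymmetricMonoidalVFunctor V T C) :
    monι H H' ≫ restrictionMap τ.functor H.functor H'.functor =
      restrictionMonoidalMap τ H H' ≫ monι (τ.comp H) (τ.comp H') := by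
  refine nat_ext fun a => ?_
  have e₁ := restrictionMap_natProj τ.functor H.functor H'.functor a
  have e₂ := restrictionMonoidalMap_monProj τ H H' a
  refine (Category.assoc _ _ _).trans ((congrArg (monι H H' ≫ ·) e₁).trans ?_)
  exact e₂.symm.trans (Category.assoc _ _ _).symm

/-- `V`-naturality of the unit of a `V`-adjunction, for graded morphisms. -/
lemma VAdjunction.unit_gradedComp {X : Type u₁} [EnrichedCategory V X] {Y : Type u₂}
    [EnrichedCategory V Y] {L : EnrichedFunctor V X Y} {R : EnrichedFunctor V Y X}
    (adj : VAdjunction L R) {x x' : X} {P : V} (f : P ⟶ (x ⟶[V] x')) :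
    ForgetEnrichment.homTo V (adj.adj.unit.app (ForgetEnrichment.of V x)) ⋆ᵍ
        (f ≫ L.map x x' ≫ R.map _ _) =
      (λ_ P).hom ≫ (ρ_ P).inv ≫
        f ⋆ᵍ ForgetEnrichment.homTo V (adj.adj.unit.app (ForgetEnrichment.of V x')) := by
  have key : ∀ (p : 𝟙_ V ⟶ (x ⟶[V] R.obj (L.obj x))) (p' : 𝟙_ V ⟶ (x' ⟶[V] R.obj (L.obj x'))),
      (ρ_ _).inv ≫ 𝟙 (x ⟶[V] x') ⋆ᵍ p' = (λ_ _).inv ≫ p ⋆ᵍ (L.map x x' ≫ R.map _ _) →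
        p ⋆ᵍ (f ≫ L.map x x' ≫ R.map _ _) = (λ_ P).hom ≫ (ρ_ P).inv ≫ f ⋆ᵍ p' := by
    intro p p' h
    rw [Iso.eq_inv_comp] at h
    rw [gradedComp_comp, ← h, MonoidalCategory.leftUnitor_naturality_assoc,
      MonoidalCategory.rightUnitor_inv_naturality_assoc, ← comp_gradedComp, Category.comp_id]
  exact key _ _ (adj.unit_vnatural x x')

lemma gradedComp_monι [IsCartesianMonoidal V] {F G H : SymmetricMonoidalVFunctor V S C} {P Q : V}
    (f : P ⟶ (F ⟶[V] G)) (g : Q ⟶ (G ⟶[V] H)) :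
    (f ⋆ᵍ g) ≫ monι F H = (f ≫ monι F G) ⋆ᵍ (g ≫ monι G H) := by
  have h : eComp V F G H ≫ monι F H = (monι F G ⊗ₘ monι G H) ≫ eComp V _ _ _ :=
    (forgetMonoidalV V S C).map_comp F G H
  rw [gradedComp, Category.assoc, h, MonoidalCategory.tensorHom_comp_tensorHom_assoc, gradedComp]

/-- An equation that characterizes a map `l` of hom-objects by the universal property of `u`, in the
`V`-category of symmetric monoidal `V`-functors, gives the same equation in the `V`-category of
`V`-functors. -/
lemma gradedComp_restrictionMap_of_monoidal [IsCartesianMonoidal V]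
    {G G' : SymmetricMonoidalVFunctor V S C} {K K' : SymmetricMonoidalVFunctor V T C}
    {u : 𝟙_ V ⟶ (G ⟶[V] τ.comp K)} {u' : 𝟙_ V ⟶ (G' ⟶[V] τ.comp K')}
    {l : (G ⟶[V] G') ⟶ (K ⟶[V] K')}
    (h : u ⋆ᵍ (l ≫ restrictionMonoidalMap τ K K') = (λ_ _).hom ≫ (ρ_ _).inv ≫ 𝟙 _ ⋆ᵍ u') :
    (u ≫ monι G (τ.comp K)) ⋆ᵍ
        ((l ≫ monι K K') ≫ restrictionMap τ.functor K.functor K'.functor) =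
      (λ_ _).hom ≫ (ρ_ _).inv ≫ monι G G' ⋆ᵍ (u' ≫ monι G' (τ.comp K')) := by
  have h' := congrArg (· ≫ monι G (τ.comp K')) h
  beta_reduce at h'
  rw [gradedComp_monι, Category.assoc, ← monι_restrictionMap, Category.assoc, Category.assoc,
    gradedComp_monι, Category.id_comp] at h'
  exact (congrArg (_ ⋆ᵍ ·) (Category.assoc _ _ _)).trans h'

/-- The enriched version of `inducesAdjunction`, for cartesian `V`. -/
lemma inducesVAdjunction [IsCartesianMonoidal V]
    (hleft : ∀ A : C, PreservesWeightedColimits (V := V) (tensorLeftV A))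
    (hright : ∀ A : C, PreservesWeightedColimits (V := V) (tensorRightV A))
    (adj₀ : VAdjunction L₀ (restriction τ.functor C))
    (hK : ∀ G, IsPointwiseLeftKan τ.functor G (L₀.obj G) (unitComponent adj₀ G))
    (M : ∀ G : SymmetricMonoidalVFunctor V S C, SymmetricMonoidalStructure (L₀.obj G.functor))
    (hM : ∀ G : SymmetricMonoidalVFunctor V S C,
      IsMonoidalFamily G (τ.comp ⟨L₀.obj G.functor, M G⟩) (unitComponent adj₀ G.functor)) :
    InducesVAdjunction τ L₀ adj₀ := by
  let L : SymmetricMonoidalVFunctor V S C → SymmetricMonoidalVFunctor V T C :=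
    fun G => ⟨L₀.obj G.functor, M G⟩
  have hn : ∀ G, IsGradedVNatural V G.functor (τ.comp (L G)).functor
      (fun a => eHomEquiv V (unitComponent adj₀ G.functor a)) :=
    fun G => (hK G.functor).unit_natural
  have hm : ∀ G, IsGradedMonoidal G (τ.comp (L G))
      (fun a => eHomEquiv V (unitComponent adj₀ G.functor a)) := fun G => by
    have h := (isComonoidalFamily_eHomEquiv_iff _).2 (hM G)
    rw [← diag_unit, ← counit_unique (counit (𝟙_ V)) (𝟙 _)] at h
    exact (isComonoidalFamily_diag_iff _).1 h
  let u : ∀ G, 𝟙_ V ⟶ (G ⟶[V] τ.comp (L G)) := fun G => monoidalLift G _ _ (hn G) (hm G)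
  have hu : ∀ G a, u G ≫ monProj G (τ.comp (L G)) a = _ := fun G a =>
    monoidalLift_proj G _ _ (hn G) (hm G) a
  have h : IsUniversalArrow (restrictionMonoidalV C τ) L u :=
    isUniversalArrow_restrictionMonoidalV hleft hright (fun G => hK G.functor) hM hu
  -- The unit of `adj₀` is a universal arrow, too.
  have h₀ : IsUniversalArrow (restriction τ.functor C) L₀.obj (fun G =>
      ForgetEnrichment.homTo V (adj₀.adj.unit.app (ForgetEnrichment.of V G))) := by
    have e : (fun G => natLift G _ _ (hK G).unit_natural) = fun G =>
        ForgetEnrichment.homTo V (adj₀.adj.unit.app (ForgetEnrichment.of V G)) :=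
      funext fun G => nat_ext fun a =>
        (natLift_proj _ _ _ (hK G).unit_natural a).trans (eHomEquiv_unitComponent adj₀ G a)
    exact e ▸ isUniversalArrow_of_isPointwiseLeftKan hK
  have huι : ∀ G, u G ≫ monι G (τ.comp (L G)) =
      ForgetEnrichment.homTo V (adj₀.adj.unit.app (ForgetEnrichment.of V G.functor)) := fun G =>
    nat_ext fun a => (Category.assoc _ _ _).trans
      ((hu G a).trans (eHomEquiv_unitComponent adj₀ G.functor a))
  -- The two left adjoints act in the same way on hom-objects, by uniqueness in `h₀`.
  have hmap : ∀ G G', h.leftMap G G' ≫ monι (L G) (L G') =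
      monι G G' ≫ L₀.map G.functor G'.functor := fun G G' => by
    refine h₀.hom_ext ?_
    have e : u G ⋆ᵍ (h.leftMap G G' ≫ restrictionMonoidalMap τ (L G) (L G')) =
        (λ_ _).hom ≫ (ρ_ _).inv ≫ 𝟙 _ ⋆ᵍ u G' :=
      (congrArg (u G ⋆ᵍ ·) (Category.id_comp _).symm).trans (h.comp_leftMap_map (𝟙 (G ⟶[V] G')))
    have e' := gradedComp_restrictionMap_of_monoidal e
    rw [huι, huι] at e'
    refine e'.trans ?_
    refine (adj₀.unit_gradedComp (monι G G')).symm.trans ?_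
    exact congrArg (_ ⋆ᵍ ·) (Category.assoc _ _ _).symm
  have hunit : ∀ G : SymmetricMonoidalVFunctor V S C, (forgetMonoidalV V S C).forget.map
      (h.vAdjunction.adj.unit.app (ForgetEnrichment.of V G)) =
        adj₀.adj.unit.app (ForgetEnrichment.of V G.functor) := fun G => forget_ext (huι G)
  -- Restriction commutes with forgetting the monoidal structures, with identity components.
  let i : (restrictionMonoidalV C τ).forget ⋙ (forgetMonoidalV V S C).forget ≅
      (forgetMonoidalV V T C).forget ⋙ (restriction τ.functor C).forget :=
    NatIso.ofComponents (fun H => Iso.refl (ForgetEnrichment.of V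
        (τ.functor.comp V (ForgetEnrichment.to V H).functor)))
      fun {H H'} f => by
        refine (Category.comp_id _).trans (Eq.trans ?_ (Category.id_comp _).symm)
        refine forget_ext ?_
        have e := monι_restrictionMap (τ := τ) (ForgetEnrichment.to V H) (ForgetEnrichment.to V H')
        refine (Category.assoc _ _ _).trans (Eq.trans ?_ (Category.assoc _ _ _).symm)
        exact congrArg (ForgetEnrichment.homTo V f ≫ ·) e.symm
  have hR : ∀ K : EnrichedFunctor V T C,
      (restriction τ.functor C).forget.map (𝟙 (ForgetEnrichment.of V K)) = 𝟙 _ :=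
    fun K => CategoryTheory.Functor.map_id _ _
  obtain ⟨e, he, he'⟩ := exists_iso_of_unit adj₀.adj h.vAdjunction.adj
    (forgetMonoidalV V S C).forget (forgetMonoidalV V T C).forget i (fun G => Iso.refl _)
    fun G => by
      refine Eq.trans ?_ ((Category.comp_id _).trans (hunit (ForgetEnrichment.to V G)))
      exact congrArg ((forgetMonoidalV V S C).forget.map (h.vAdjunction.adj.unit.app G) ≫ ·)
        ((Category.id_comp _).trans (hR _))
  refine ⟨h.leftAdjoint, h.vAdjunction, e, fun G G' => ?_, fun G => ?_, fun H => ?_⟩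
  · have e₁ : ∀ G, ForgetEnrichment.homTo V (e.hom.app (ForgetEnrichment.of V G)) =
        eId V (L₀.obj G.functor) := fun G =>
      (congrArg _ (he _)).trans (ForgetEnrichment.homTo_id _ _)
    have e₂ : (ρ_ (G ⟶[V] G')).inv ≫ (h.leftMap G G' ≫ monι (L G) (L G')) ⋆ᵍ
          eId V (L₀.obj G'.functor) =
        (λ_ (G ⟶[V] G')).inv ≫ eId V (L₀.obj G.functor) ⋆ᵍ
          (monι G G' ≫ L₀.map G.functor G'.functor) := by
      rw [hmap, gradedComp_eId, eId_gradedComp, Iso.inv_hom_id_assoc, Iso.inv_hom_id_assoc]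
    refine (congrArg (fun k => (ρ_ (G ⟶[V] G')).inv ≫
      (h.leftMap G G' ≫ monι (L G) (L G')) ⋆ᵍ k) (e₁ G')).trans (e₂.trans ?_)
    exact congrArg (fun k => (λ_ (G ⟶[V] G')).inv ≫ k ⋆ᵍ
      (monι G G' ≫ L₀.map G.functor G'.functor)) (e₁ G).symm
  · rw [he]
    refine Eq.trans ?_ ((Category.comp_id _).trans (hunit G))
    exact congrArg ((forgetMonoidalV V S C).forget.map
      (h.vAdjunction.adj.unit.app (ForgetEnrichment.of V G)) ≫ ·) (hR _)
  · refine Eq.trans ?_ (he' (ForgetEnrichment.of V H))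
    have hL : L₀.forget.map (𝟙 (ForgetEnrichment.of V (τ.comp H).functor)) = 𝟙 _ :=
      CategoryTheory.Functor.map_id _ _
    refine congrArg (e.hom.app (ForgetEnrichment.of V (τ.comp H)) ≫ ·) ?_
    exact ((congrArg (· ≫ adj₀.adj.counit.app (ForgetEnrichment.of V H.functor)) hL).trans
      (Category.id_comp _)).symm

end InducedAdjunction

end EnrichedPattern

end

theorem mainTheorem5
    {V : Type v} [Category.{w} V] [MonoidalCategory V] [SymmetricCategory V] [MonoidalClosed V]
    [HasLimits V] [HasColimits V]
    {S : Type w} [Category.{v₁} S] [EnrichedOrdinaryCategory V S]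
    [MonoidalCategory S] [SymmetricCategory S] [SymmetricMonoidalEnriched V S]
    {T : Type w} [Category.{v₂} T] [EnrichedOrdinaryCategory V T]
    [MonoidalCategory T] [SymmetricCategory T] [SymmetricMonoidalEnriched V T]
    {C : Type u} [Category.{v₃} C] [EnrichedOrdinaryCategory V C]
    [MonoidalCategory C] [SymmetricCategory C] [SymmetricMonoidalEnriched V C]
    (hC : IsCocomplete V C)
    (hleft : ∀ A : C, PreservesWeightedColimits (V := V) (tensorLeftV A))
    (hright : ∀ A : C, PreservesWeightedColimits (V := V) (tensorRightV A))
    (τ : SymmetricMonoidalVFunctor V S T) (hτ : IsPattern τ) :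
    ∃ (L₀ : EnrichedFunctor V (EnrichedFunctor V S C) (EnrichedFunctor V T C))
      (adj₀ : VAdjunction L₀ (restriction τ.functor C)),
      (∀ G : EnrichedFunctor V S C,
        IsPointwiseLeftKan τ.functor G (L₀.obj G) (unitComponent adj₀ G)) ∧
      (∀ G : SymmetricMonoidalVFunctor V S C,
        ∃! M : SymmetricMonoidalStructure (L₀.obj G.functor),
          IsMonoidalFamily G (τ.comp ⟨L₀.obj G.functor, M⟩) (unitComponent adj₀ G.functor)) ∧
      InducesAdjunction τ L₀ adj₀ ∧
      (∀ _ : IsCartesianMonoidal V, InducesVAdjunction τ L₀ adj₀) := by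
  obtain ⟨L₀, adj₀, hK⟩ := exists_vAdjunction_isPointwiseLeftKan hC τ.functor
  have hM : ∀ G : SymmetricMonoidalVFunctor V S C,
      ∃! M : SymmetricMonoidalStructure (L₀.obj G.functor),
        IsMonoidalFamily G (τ.comp ⟨L₀.obj G.functor, M⟩) (unitComponent adj₀ G.functor) :=
    fun G => existsUnique_symmetricMonoidalStructure hτ hleft hright (hK G.functor)
  choose M hM' using fun G => (hM G).exists
  exact ⟨L₀, adj₀, hK, hM, inducesAdjunction hleft hright adj₀ hK M hM',
    fun _ => inducesVAdjunction hleft hright adj₀ hK M hM'⟩
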